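/- For $x,b\in[0,1]^n$ write $x\le b$ if $x$ is at most $b$ in every coordinate. A finite set $B\subseteq[0,1]^n$ is a \emph{Pareto cover} of a probability measure $\mu$ on $[0,1]^n$ if $\mu(\{x : x\le b \text{ for some } b\in B\})=1$. For $c\in\mathbb{Q}^n_{\ge0}$ let $c_B(x)=\min\{c^{\top}b : b\in B,\ x\le b\}$ (with $\min\emptyset=\infty$). A \emph{discrete instance} $(a,p,c)$ consists of rational numbers $0=a_0<a_1<\dots<a_M<a_{M+1}=1$, rational numbers $p^i_j\in[0,1]$ ($1\le i\le n$, $0\le j\le M+1$) with $\sum_{j}p^i_j=1$ for all $i$, and $c\in\mathbb{Q}^n_{\ge0}$; $\mu_{a,p}$ is the product distribution on $\{a_0,\dots,a_{M+1}\}^n$ whose $i$-th coordinate equals $a_j$ with probability $p^i_j$. For $p\in([0,1]\cap\mathbb{Q})^n$, $\mu_p$ is the product distribution on $\{0,1\}^n$ whose $i$-th coordinate equals $1$ with probability $p_i$. Rational numbers are given, and returned, as fractions of integers written in binary. Let $k\ge1$ be a fixed integer. (i) There is an algorithm that, given a discrete instance $(a,p,c)$ and a Pareto cover $B\subseteq\{a_0,\dots,a_{M+1}\}^n$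 of $\mu=\mu_{a,p}$ with $|B|=k$, computes $\operatorname{E}_\mu[c_B]$ in time polynomial in the length of the binary encoding of the input. (ii) The following problem (the discrete Pareto cover problem for the fixed $k$) is in NP: given a discrete instance $(a,p,c)$ and $\gamma\in\mathbb{Q}$, decide whether there is a Pareto cover $B\subseteq[0,1]^n$ of $\mu_{a,p}$ with $|B|=k$ and $\operatorname{E}_{\mu_{a,p}}[c_B]\le\gamma$. (iii) The following problem (the binary Pareto cover problem for the fixed $k$) is in NP: given $p\in([0,1]\cap\mathbb{Q})^n$, $c\in\mathbb{Q}^n_{\ge0}$ and $\gamma\in\mathbb{Q}$, decide whether there is a Pareto cover $B\subseteq[0,1]^n$ of $\mu_p$ with $|B|=k$ and $\operatorname{E}_{\mu_p}[c_B]\le\gamma$. -/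

import Mathlib

open scoped ENNReal
open Computability Turing MeasureTheory

namespace ParetoCover

/-! ### Pareto covers and their costs

The cube `[0,1]^n` is `Set.Icc 0 1` in `Fin n → ℝ`, ordered coordinatewise; a probability measure
on the cube is a measure on `Fin n → ℝ` concentrated on it. -/

/-- `B` is a Pareto cover of `μ`: a random point is almost surely covered by a point of `B`. -/
def IsParetoCover {n : ℕ} (μ : Measure (Fin n → ℝ)) (B : Set (Fin n → ℝ)) : Prop :=
  μ {x | ∃ b ∈ B, x ≤ b} = 1

/-- The function `c_B(x) = min {c • b : x ≤ b, b ∈ B}`, with value `∞` where `x` is not covered.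
It is only used for a nonnegative vector `c` and finite `B ⊆ [0,1]^n`, so that `c • b ≥ 0`. -/
noncomputable def coverCost {n : ℕ} (c : Fin n → ℝ) (B : Set (Fin n → ℝ)) (x : Fin n → ℝ) :
    ℝ≥0∞ :=
  ⨅ b ∈ B, ⨅ _ : x ≤ b, ENNReal.ofReal (∑ i, c i * b i)

/-- The expectation of `c_B` under `μ`. -/
noncomputable def expectedCost {n : ℕ} (μ : Measure (Fin n → ℝ)) (c : Fin n → ℝ)
    (B : Set (Fin n → ℝ)) : ℝ≥0∞ :=
  ∫⁻ x, coverCost c B x ∂μ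

/-- The product distribution on `{a_0, …, a_{M+1}}^n` in which the `i`-th coordinate equals `a_j`
with probability `p i j`. -/
noncomputable def discreteMeasure {n M : ℕ} (a : Fin (M + 2) → ℝ) (p : Fin n → Fin (M + 2) → ℝ) :
    Measure (Fin n → ℝ) :=
  ∑ x : Fin n → Fin (M + 2),
    (∏ i, ENNReal.ofReal (p i (x i))) • Measure.dirac (fun i => a (x i))

/-- The product distribution on `{0,1}^n` in which the `i`-th coordinate equals `1` with
probability `p i`. -/
noncomputable def binaryMeasure {n : ℕ} (p : Fin n → ℝ) : Measure (Fin n → ℝ) :=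
  ∑ x : Fin n → Bool,
    (∏ i, ENNReal.ofReal (if x i then p i else 1 - p i)) •
      Measure.dirac (fun i => if x i then (1 : ℝ) else 0)

/-- There is a Pareto cover `B ⊆ [0,1]^n` of `μ` with exactly `k` points and expected cost at
most `γ`. The comparison takes place in `EReal`, so that negative `γ` are treated correctly. -/
def HasCheapCover {n : ℕ} (k : ℕ) (μ : Measure (Fin n → ℝ)) (c : Fin n → ℝ) (γ : ℝ) : Prop :=
  ∃ B : Finset (Fin n → ℝ), (∀ b ∈ B, b ∈ Set.Icc 0 1) ∧ B.card = k ∧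
    IsParetoCover μ B ∧ (expectedCost μ c B : EReal) ≤ (γ : EReal)

/-! ### Instances -/

/-- A fraction (not necessarily in lowest terms) representing a rational number. -/
structure Fraction where
  num : ℤ
  den : ℕ
  den_pos : 0 < den

/-- The rational number represented by a fraction, as a real number. -/
noncomputable def Fraction.val (q : Fraction) : ℝ := (q.num : ℝ) / (q.den : ℝ)

/-- The data `(a, p, c)` of an instance of the discrete Pareto cover problem. -/
structure DiscreteInstance where
  n : ℕ
  M : ℕ
  a : Fin (M + 2) → Fraction
  p : Fin n → Fin (M + 2) → Fraction
  c : Fin n → Fraction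
  a_zero : (a 0).val = 0
  a_last : (a (Fin.last (M + 1))).val = 1
  a_strictMono : StrictMono fun j => (a j).val
  p_mem : ∀ i j, (p i j).val ∈ Set.Icc (0 : ℝ) 1
  p_sum : ∀ i, ∑ j, (p i j).val = 1
  c_nonneg : ∀ i, 0 ≤ (c i).val

/-- The measure `μ_{a,p}` of an instance. -/
noncomputable def DiscreteInstance.measure (I : DiscreteInstance) : Measure (Fin I.n → ℝ) :=
  discreteMeasure (fun j => (I.a j).val) (fun i j => (I.p i j).val)

/-- The cost vector of an instance. -/
noncomputable def DiscreteInstance.cost (I : DiscreteInstance) : Fin I.n → ℝ :=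
  fun i => (I.c i).val

/-- The data `(p, c)` of an instance of the binary Pareto cover problem. -/
structure BinaryInstance where
  n : ℕ
  p : Fin n → Fraction
  c : Fin n → Fraction
  p_mem : ∀ i, (p i).val ∈ Set.Icc (0 : ℝ) 1
  c_nonneg : ∀ i, 0 ≤ (c i).val

/-- The measure `μ_p` of a binary instance. -/
noncomputable def BinaryInstance.measure (I : BinaryInstance) : Measure (Fin I.n → ℝ) :=
  binaryMeasure fun i => (I.p i).val

/-- The cost vector of a binary instance. -/
noncomputable def BinaryInstance.cost (I : BinaryInstance) : Fin I.n → ℝ :=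
  fun i => (I.c i).val

/-- Data `(a, p, c)` together with a Pareto cover `B = {b_1, …, b_k} ⊆ {a_0, …, a_{M+1}}^n` of
`μ_{a,p}` with `|B| = k`, given by a list of its points. -/
structure CoverInstance (k : ℕ) extends DiscreteInstance where
  b : Fin k → Fin n → Fraction
  b_injective : Function.Injective fun j i => (b j i).val
  b_grid : ∀ j i, ∃ l, (b j i).val = (a l).val
  b_cover : IsParetoCover toDiscreteInstance.measure (Set.range fun j i => (b j i).val)

/-- The cover `B` as a set of points. -/
noncomputable def CoverInstance.cover {k : ℕ} (I : CoverInstance k) : Set (Fin I.n → ℝ) :=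
  Set.range fun j i => (I.b j i).val

/-! ### Binary encodings

Words over the alphabet consisting of `bit 0`, `bit 1`, `bra`, `ket`, `comma` (and an unused
`blank`). Natural numbers are written in binary and terminated by `comma`, an integer is a sign bit
followed by its absolute value, a fraction is its numerator followed by its denominator, and a
list is the concatenation of the codes of its entries between `bra` and `ket`. -/

def encNat (m : ℕ) : List Γ' := (encodeNat m).map Γ'.bit ++ [Γ'.comma]

def encInt (z : ℤ) : List Γ' := Γ'.bit (decide (z < 0)) :: encNat z.natAbs

def encFraction (q : Fraction) : List Γ' := encInt q.num ++ encNat q.den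

def encFamily {α : Type} {m : ℕ} (e : α → List Γ') (v : Fin m → α) : List Γ' :=
  Γ'.bra :: ((List.ofFn v).flatMap e ++ [Γ'.ket])

def encDiscrete (I : DiscreteInstance) : List Γ' :=
  encFamily encFraction I.a ++ encFamily (encFamily encFraction) I.p ++ encFamily encFraction I.c

def encBinary (I : BinaryInstance) : List Γ' :=
  encFamily encFraction I.p ++ encFamily encFraction I.c

def encCover {k : ℕ} (I : CoverInstance k) : List Γ' :=
  encDiscrete I.toDiscreteInstance ++ encFamily (encFamily encFraction) I.b

/-! ### Polynomial time and NP -/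

/-- `f` is computable in polynomial time, with respect to the encodings `ea` and `eb`, by a
(multi-stack) Turing machine. -/
def PolyTime {α β A A₂ : Type} (ea : α → List A) (eb : β → List A₂) (f : α → β) : Prop :=
  Nonempty (TM2ComputableInPolyTime ea eb f)

/-- The complexity class NP: a word is in `L` if and only if it has a certificate of polynomially
bounded length that is accepted by a polynomial-time verifier. The verifier is defined on all
pairs of words, which are encoded as the concatenation over the disjoint union of the alphabets. -/
def InNP {A : Type} (L : Language A) : Prop :=
  ∃ (q : Polynomial ℕ) (V : List A × List Bool → Bool),
    PolyTime (encodingProd (encodingList A) (encodingList Bool)).encode encodeBool V ∧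
    ∀ w, w ∈ L ↔ ∃ u : List Bool, u.length ≤ q.eval w.length ∧ V (w, u) = true

/-- The discrete Pareto cover problem for covers of size `k`: the codes of its yes-instances. -/
def discreteParetoCoverProblem (k : ℕ) : Language Γ' :=
  {w | ∃ (I : DiscreteInstance) (γ : Fraction), w = encDiscrete I ++ encFraction γ ∧
    HasCheapCover k I.measure I.cost γ.val}

/-- The binary Pareto cover problem for covers of size `k`: the codes of its yes-instances. -/
def binaryParetoCoverProblem (k : ℕ) : Language Γ' :=
  {w | ∃ (I : BinaryInstance) (γ : Fraction), w = encBinary I ++ encFraction γ ∧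
    HasCheapCover k I.measure I.cost γ.val}

end ParetoCover

/-!
Let `B = {b_1, …, b_k}`. The value `c_B(x)` depends only on the set of points of `B` that dominate
`x`. Reading the coordinates of a random `x` one after the other, this set shrinks from `B`, and
its distribution is supported on at most `2 ^ k` sets. For fixed `k` it can therefore be updated in
polynomial time per coordinate, and `E[c_B]` is a sum over these sets. Over a common denominator
for each coordinate, the numerators and denominators stay polynomially long.

For a product distribution on a grid, rounding the points of a cover down to the grid covers the
same grid points and does not increase the cost, so a cover with grid points is a certificate that
the above algorithm checks. Rounding may identify points, but points of the cube can be added to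
a cover at will as soon as there are infinitely many of them, that is, in positive dimension.

Polynomial time is established in a calculus of functions on binary trees, which are computed by
structured programs on finitely many stacks; a single Turing machine runs such a program with
constant overhead per step.
-/

/-- Structured programs on a family of stacks, where stack `k` has alphabet `Γ k`. They are a
convenient intermediate language between functions on data types and Turing machines. -/
inductive StackProgram {K : Type} (Γ : K → Type) : Type
  | skip : StackProgram Γ
  | push (k : K) (a : Γ k) : StackProgram Γ
  | pop (k : K) (f : Option (Γ k) → StackProgram Γ) : StackProgram Γ
  | seq (P Q : StackProgram Γ) : StackProgram Γ
  | loop (k : K) (c : Option (Γ k) → Bool) (P : StackProgram Γ) : StackProgram Γ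

namespace StackProgram

open StateTransition

section Compilation

variable {K : Type} {Γ : K → Type}

/-- The labels needed to compile a program to a multi-stack Turing machine. -/
def Label : StackProgram Γ → Type
  | .skip => Empty
  | .push _ _ => Unit
  | .pop _ f => Option (Σ o, Label (f o))
  | .seq P Q => Label P ⊕ Label Q
  | .loop _ _ P => Option (Label P)

theorem finite_label [∀ k, Finite (Γ k)] (P : StackProgram Γ) : Finite (Label P) := by
  induction P with
  | skip => exact inferInstanceAs (Finite Empty)
  | push => exact inferInstanceAs (Finite Unit)
  | pop k f ih =>
    have := ih
    exact inferInstanceAs (Finite (Option (Σ o, Label (f o))))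
  | seq P Q _ _ => exact inferInstanceAs (Finite (Label P ⊕ Label Q))
  | loop k c P _ => exact inferInstanceAs (Finite (Option (Label P)))

variable [DecidableEq K]

/-- Big-step semantics: `P.RunsWithin s s' t` says that `P` transforms the stacks `s` into `s'`
within at most `t` steps. -/
inductive RunsWithin : StackProgram Γ → (∀ k, List (Γ k)) → (∀ k, List (Γ k)) → ℕ → Prop
  | skip (s) : RunsWithin .skip s s 0
  | push (k a s) : RunsWithin (.push k a) s (Function.update s k (a :: s k)) 1
  | pop {k f s s' t} : RunsWithin (f (s k).head?) (Function.update s k (s k).tail) s' t →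
      RunsWithin (.pop k f) s s' (t + 1)
  | seq {P Q s₁ s₂ s₃ t₁ t₂} : RunsWithin P s₁ s₂ t₁ → RunsWithin Q s₂ s₃ t₂ →
      RunsWithin (.seq P Q) s₁ s₃ (t₁ + t₂)
  | loop_done {k c P s} : c (s k).head? = false → RunsWithin (.loop k c P) s s 1
  | loop_step {k c P s₁ s₂ s₃ t₁ t₂} : c (s₁ k).head? = true → RunsWithin P s₁ s₂ t₁ →
      RunsWithin (.loop k c P) s₂ s₃ t₂ → RunsWithin (.loop k c P) s₁ s₃ (t₁ + t₂ + 1)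
  | mono {P s s' t t'} : RunsWithin P s s' t → t ≤ t' → RunsWithin P s s' t'

theorem RunsWithin.length_le {P : StackProgram Γ} {s s' : ∀ k, List (Γ k)} {t : ℕ}
    (h : RunsWithin P s s' t) (j : K) : (s' j).length ≤ (s j).length + t := by
  induction h with
  | skip s => simp
  | push k a s =>
    by_cases hk : j = k
    · subst hk; simp
    · simp [hk]
  | @pop k f s s' t _ ih =>
    refine ih.trans ?_
    by_cases hk : j = k
    · subst hk
      simp only [Function.update_self, List.length_tail]
      omega
    · simp [hk]
  | seq _ _ ih₁ ih₂ => omega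
  | loop_done _ => simp
  | loop_step _ _ _ ih₁ ih₂ => omega
  | mono _ ht ih => omega

/-- The label at which a compiled program starts. Here and in `compile`, `emb` embeds the labels of
the program into those of the whole machine, and `exit` is the label reached at the end. -/
def entry : (P : StackProgram Γ) → {L : Type} → (Label P → L) → L → L
  | .skip, _, _, exit => exit
  | .push _ _, _, emb, _ => emb ()
  | .pop _ _, _, emb, _ => emb none
  | .seq P Q, _, emb, exit =>
      entry P (fun l => emb (.inl l)) (entry Q (fun l => emb (.inr l)) exit)
  | .loop _ _ _, _, emb, _ => emb none

/-- The statements of a compiled program. The internal state of the machine stores, for every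
stack, the symbol that was read from it last. -/
def compile : (P : StackProgram Γ) → {L : Type} → (Label P → L) → L → Label P →
    TM2.Stmt Γ L (∀ k, Option (Γ k))
  | .skip, _, _, _, l => l.elim
  | .push k a, _, _, exit, _ => .push k (fun _ => a) (.goto fun _ => exit)
  | .pop k f, _, emb, exit, none =>
      .pop k (fun v o => Function.update v k o)
        (.goto fun v => entry (f (v k)) (fun l => emb (some ⟨_, l⟩)) exit)
  | .pop _ f, _, emb, exit, some ⟨o, l⟩ => compile (f o) (fun l => emb (some ⟨o, l⟩)) exit l
  | .seq P Q, _, emb, exit, .inl l =>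
      compile P (fun l => emb (.inl l)) (entry Q (fun l => emb (.inr l)) exit) l
  | .seq _ Q, _, emb, exit, .inr l => compile Q (fun l => emb (.inr l)) exit l
  | .loop k c P, _, emb, exit, none =>
      .peek k (fun v o => Function.update v k o)
        (.goto fun v => cond (c (v k)) (entry P (fun l => emb (some l)) (emb none)) exit)
  | .loop _ _ P, _, emb, _, some l => compile P (fun l => emb (some l)) (emb none) l

/-- Reachability of configurations within a number of steps, as a proposition. -/
def Reaches {σ : Type} (f : σ → Option σ) (a b : σ) (t : ℕ) : Prop :=
  Nonempty (EvalsToInTime f a (some b) t)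

namespace Reaches

variable {σ : Type} {f : σ → Option σ} {a b c : σ} {t t' : ℕ}

theorem refl (f : σ → Option σ) (a : σ) : Reaches f a a 0 := ⟨.refl f a⟩

theorem single (h : f a = some b) : Reaches f a b 1 := ⟨⟨⟨1, h⟩, le_rfl⟩⟩

theorem mono (h : Reaches f a b t) (ht : t ≤ t') : Reaches f a b t' :=
  h.map fun e => ⟨e.toEvalsTo, e.steps_le_m.trans ht⟩

theorem trans (h₁ : Reaches f a b t) (h₂ : Reaches f b c t') : Reaches f a c (t + t') :=
  let ⟨e₁⟩ := h₁
  let ⟨e₂⟩ := h₂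
  mono ⟨e₁.trans f _ _ _ _ _ e₂⟩ (add_comm t' t).le

end Reaches

theorem RunsWithin.reaches {P : StackProgram Γ} {s s' : ∀ k, List (Γ k)} {t : ℕ}
    (h : RunsWithin P s s' t) :
    ∀ {L : Type} (emb : Label P → L) (exit : L) (m : L → TM2.Stmt Γ L (∀ k, Option (Γ k))),
      (∀ l, m (emb l) = compile P emb exit l) → ∀ v, ∃ v',
        Reaches (TM2.step m) ⟨some (entry P emb exit), v, s⟩ ⟨some exit, v', s'⟩ t := by
  induction h with
  | skip s => exact fun emb exit m _ v => ⟨v, .refl _ _⟩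
  | push k a s =>
    intro L emb exit m hm v
    exact ⟨v, .single (by simp [entry, TM2.step, hm (), compile])⟩
  | @pop k f s s' t _ ih =>
    intro L emb exit m hm v
    obtain ⟨v', hv⟩ := ih (fun l => emb (some ⟨_, l⟩)) exit m
      (fun l => hm (some ⟨_, l⟩)) (Function.update v k (s k).head?)
    have entry_eq : ∀ o, o = (s k).head? →
        entry (f o) (fun l => emb (some ⟨_, l⟩)) exit =
          entry (f (s k).head?) (fun l => emb (some ⟨_, l⟩)) exit := by
      rintro _ rfl; rfl
    refine ⟨v', ((Reaches.single ?_).trans hv).mono (add_comm 1 t).le⟩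
    simp [entry, TM2.step, hm none, compile, entry_eq _ (Function.update_self k (s k).head? v)]
  | @seq P Q s₁ s₂ s₃ t₁ t₂ _ _ ih₁ ih₂ =>
    intro L emb exit m hm v
    obtain ⟨v₁, h₁⟩ := ih₁ (fun l => emb (.inl l)) (entry Q (fun l => emb (.inr l)) exit) m
      (fun l => hm (.inl l)) v
    obtain ⟨v₂, h₂⟩ := ih₂ (fun l => emb (.inr l)) exit m (fun l => hm (.inr l)) v₁
    exact ⟨v₂, h₁.trans h₂⟩
  | @loop_done k c P s hc =>
    intro L emb exit m hm v
    exact ⟨Function.update v k (s k).head?,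
      .single (by simp [entry, TM2.step, hm none, compile, hc])⟩
  | @loop_step k c P s₁ s₂ s₃ t₁ t₂ hc _ _ ih₁ ih₂ =>
    intro L emb exit m hm v
    obtain ⟨v₁, h₁⟩ := ih₁ (fun l => emb (some l)) (emb none) m
      (fun l => hm (some l)) (Function.update v k (s₁ k).head?)
    obtain ⟨v₂, h₂⟩ := ih₂ emb exit m hm v₁
    refine ⟨v₂, ((Reaches.single ?_).trans (h₁.trans h₂)).mono (by omega)⟩
    simp [entry, TM2.step, hm none, compile, hc]
  | mono _ ht ih =>
    intro L emb exit m hm v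
    obtain ⟨v', hv⟩ := ih emb exit m hm v
    exact ⟨v', hv.mono ht⟩

/-- The Turing machine that runs a program, clears its internal state and halts. -/
noncomputable def machine [Fintype K] [∀ k, Fintype (Γ k)] (P : StackProgram Γ) (k₀ k₁ : K) :
    FinTM2 where
  K := K
  k₀ := k₀
  k₁ := k₁
  Γ := Γ
  Λ := Option (Label P)
  main := entry P some none
  ΛFin := haveI := finite_label P; Fintype.ofFinite _
  σ := ∀ k, Option (Γ k)
  initialState := fun _ => none
  σFin := inferInstance
  m
    | none => .load (fun _ _ => none) .halt
    | some l => compile P some none l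

theorem RunsWithin.machine_reaches [Fintype K] [∀ k, Fintype (Γ k)] {P : StackProgram Γ} {k₀ k₁ : K}
    {s s' : ∀ k, List (Γ k)} {t : ℕ} (h : RunsWithin P s s' t) :
    Reaches (machine P k₀ k₁).step
      ⟨some (machine P k₀ k₁).main, (machine P k₀ k₁).initialState, s⟩
      ⟨none, (machine P k₀ k₁).initialState, s'⟩ (t + 1) := by
  obtain ⟨v, hv⟩ := h.reaches some none (machine P k₀ k₁).m (fun _ => rfl) fun _ => none
  exact Reaches.trans (f := (machine P k₀ k₁).step) hv (.single rfl)

end Compilation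

end StackProgram

/-- Binary trees, the universal data type on which the programs below operate. -/
inductive BinTree
  | leaf
  | node (l r : BinTree)

namespace BinTree

/-- The code of a tree in Polish notation. No such code is a proper prefix of another one, so a
tree can be recognized on top of a stack. -/
def enc : BinTree → List Bool
  | leaf => [false]
  | node l r => true :: (enc l ++ enc r)

/-- The number of leaves and nodes, which is the length of the code. -/
def size : BinTree → ℕ
  | leaf => 1
  | node l r => 1 + size l + size r

@[simp] theorem length_enc (t : BinTree) : t.enc.length = t.size := by
  induction t with
  | leaf => rfl
  | node l r ihl ihr => simp only [enc, size, List.length_cons, List.length_append, ihl, ihr]; omega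

theorem size_pos (t : BinTree) : 0 < t.size := by
  cases t <;> simp [size]

/-- The right comb with `n` nodes, which represents `n` in unary. -/
def comb : ℕ → BinTree
  | 0 => leaf
  | n + 1 => node leaf (comb n)

@[simp] theorem size_comb (n : ℕ) : (comb n).size = 2 * n + 1 := by
  induction n with
  | zero => rfl
  | succ n ih => simp only [comb, size, ih]; omega

end BinTree

/-- Names of the stacks of a working program: a main stack holding trees, two auxiliary stacks, a
counter that controls the traversal of a tree, and the input and output stacks. -/
inductive StackName
  | input | output | main | aux (j : Bool) | counter
  deriving DecidableEq

instance : Fintype StackName :=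
  ⟨{.input, .output, .main, .aux false, .aux true, .counter}, fun k => by
    rcases k with _ | _ | _ | (_ | _) | _ <;> simp⟩

/-- The alphabets of the stacks. On the auxiliary stacks, `none` separates words. -/
@[reducible] def StackSymbol (A B : ℕ) : StackName → Type
  | .input => Fin A
  | .output => Fin B
  | .main => Bool
  | .aux _ => Option Bool
  | .counter => Bool

instance (A B : ℕ) : ∀ k, Fintype (StackSymbol A B k)
  | .input => inferInstanceAs (Fintype (Fin A))
  | .output => inferInstanceAs (Fintype (Fin B))
  | .main => inferInstanceAs (Fintype Bool)
  | .aux _ => inferInstanceAs (Fintype (Option Bool))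
  | .counter => inferInstanceAs (Fintype Bool)

/-- The contents of all stacks; the head of a list is the top of the stack. -/
structure Stacks (A B : ℕ) where
  input : List (Fin A) := []
  output : List (Fin B) := []
  main : List Bool := []
  aux₀ : List (Option Bool) := []
  aux₁ : List (Option Bool) := []
  counter : List Bool := []

namespace Stacks

variable {A B : ℕ}

/-- The contents of a stack. -/
def get (S : Stacks A B) : ∀ k, List (StackSymbol A B k)
  | .input => S.input
  | .output => S.output
  | .main => S.main
  | .aux false => S.aux₀
  | .aux true => S.aux₁
  | .counter => S.counter

/-- Replace the contents of a stack. -/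
def set (S : Stacks A B) : ∀ k, List (StackSymbol A B k) → Stacks A B
  | .input, l => { S with input := l }
  | .output, l => { S with output := l }
  | .main, l => { S with main := l }
  | .aux false, l => { S with aux₀ := l }
  | .aux true, l => { S with aux₁ := l }
  | .counter, l => { S with counter := l }

theorem update_get (S : Stacks A B) (k : StackName) (l : List (StackSymbol A B k)) :
    Function.update S.get k l = (S.set k l).get := by
  funext k'
  rcases k with _ | _ | _ | (_ | _) | _ <;> rcases k' with _ | _ | _ | (_ | _) | _ <;> rfl

@[simp] theorem get_set (S : Stacks A B) (k : StackName) (l : List (StackSymbol A B k)) :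
    (S.set k l).get k = l := by
  rcases k with _ | _ | _ | (_ | _) | _ <;> rfl

@[simp] theorem set_set (S : Stacks A B) (k : StackName) (l l' : List (StackSymbol A B k)) :
    (S.set k l).set k l' = S.set k l' := by
  rcases k with _ | _ | _ | (_ | _) | _ <;> rfl

/-- Put a word on the main stack, first letter on top. -/
def pushWord (S : Stacks A B) (w : List Bool) : Stacks A B := { S with main := w ++ S.main }

/-- Put the code of a tree on the main stack. -/
def pushTree (S : Stacks A B) (t : BinTree) : Stacks A B := S.pushWord t.enc

/-- Put a word on an auxiliary stack, reversed and delimited by `none`. -/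
def saveWord (S : Stacks A B) (j : Bool) (w : List Bool) : Stacks A B :=
  S.set (.aux j) ((w.map some).reverse ++ none :: S.get (.aux j))

theorem pushWord_append (S : Stacks A B) (w w' : List Bool) :
    S.pushWord (w ++ w') = (S.pushWord w').pushWord w := by
  simp only [pushWord, List.append_assoc]

theorem pushTree_node (S : Stacks A B) (l r : BinTree) :
    S.pushTree (.node l r) = ((S.pushTree r).pushTree l).pushWord [true] := by
  simp only [pushTree, ← pushWord_append]
  rfl

theorem saveWord_concat (S : Stacks A B) (j : Bool) (w : List Bool) (x : Bool) :
    S.saveWord j (w ++ [x]) =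
      (S.saveWord j w).set (.aux j) (some x :: (S.saveWord j w).get (.aux j)) := by
  simp [saveWord]

theorem pushWord_saveWord (S : Stacks A B) (j : Bool) (v w : List Bool) :
    (S.saveWord j w).pushWord v = (S.pushWord v).saveWord j w := by
  cases j <;> rfl

end Stacks

namespace StackProgram

variable {A B : ℕ} {S S' : Stacks A B} {t : ℕ}

/-- `P.Transforms S S' t` says that the working program `P` transforms the stacks `S` into `S'`
within at most `t` steps. -/
def Transforms (P : StackProgram (StackSymbol A B)) (S S' : Stacks A B) (t : ℕ) : Prop :=
  P.RunsWithin S.get S'.get t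

namespace Transforms

variable {P Q : StackProgram (StackSymbol A B)} {k : StackName} {S₁ S₂ S₃ : Stacks A B}
  {t₁ t₂ t' : ℕ}

theorem mono (h : P.Transforms S S' t) (ht : t ≤ t') : P.Transforms S S' t' := RunsWithin.mono h ht

theorem skip (S : Stacks A B) : Transforms .skip S S 0 := RunsWithin.skip _

theorem seq (h₁ : P.Transforms S₁ S₂ t₁) (h₂ : Q.Transforms S₂ S₃ t₂) :
    Transforms (.seq P Q) S₁ S₃ (t₁ + t₂) := RunsWithin.seq h₁ h₂

theorem push (k : StackName) (x : StackSymbol A B k) (S : Stacks A B) :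
    Transforms (.push k x) S (S.set k (x :: S.get k)) 1 := by
  rw [Transforms, ← S.update_get]
  exact .push k x S.get

theorem pop {f : Option (StackSymbol A B k) → StackProgram (StackSymbol A B)}
    (h : Transforms (f (S.get k).head?) (S.set k (S.get k).tail) S' t) :
    Transforms (.pop k f) S S' (t + 1) :=
  RunsWithin.pop (by rwa [S.update_get])

theorem loop_done {c : Option (StackSymbol A B k) → Bool} (hc : c (S.get k).head? = false) :
    Transforms (.loop k c P) S S 1 := RunsWithin.loop_done hc

theorem loop_step {c : Option (StackSymbol A B k) → Bool} (hc : c (S₁.get k).head? = true)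
    (h₁ : P.Transforms S₁ S₂ t₁) (h₂ : Transforms (.loop k c P) S₂ S₃ t₂) :
    Transforms (.loop k c P) S₁ S₃ (t₁ + t₂ + 1) := RunsWithin.loop_step hc h₁ h₂

theorem pushBit (x : Bool) (S : Stacks A B) : Transforms (.push .main x) S (S.pushWord [x]) 1 :=
  push .main x S

theorem popBit {f : Option Bool → StackProgram (StackSymbol A B)} {x : Bool}
    (h : (f (some x)).Transforms S S' t) : Transforms (.pop .main f) (S.pushWord [x]) S' (t + 1) :=
  pop h

end Transforms

/-- Put a fixed word on the main stack. -/
def pushWord : List Bool → StackProgram (StackSymbol A B)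
  | [] => .skip
  | x :: w => .seq (pushWord w) (.push .main x)

theorem transforms_pushWord (S : Stacks A B) (w : List Bool) :
    (pushWord w).Transforms S (S.pushWord w) w.length := by
  induction w with
  | nil => exact .skip S
  | cons x w ih => exact ih.seq (.pushBit x _)

/-- Move one letter from the main stack to both auxiliary stacks. The counter holds one `true` for
every tree that is still to be read: a leaf completes one of them, a node replaces it by two. -/
def scanStep : StackProgram (StackSymbol A B) :=
  .pop .counter fun _ => .pop .main fun x =>
    .seq (.push (.aux false) x) <| .seq (.push (.aux true) x) <|
      if x = some true then .seq (.push .counter true) (.push .counter true) else .skip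

/-- Move letters to the auxiliary stacks until all trees have been read. -/
def scanLoop : StackProgram (StackSymbol A B) := .loop .counter (fun x => x == some true) scanStep

/-- Move a tree from the main stack to both auxiliary stacks. -/
def scan : StackProgram (StackSymbol A B) :=
  .seq (.push (.aux false) none) <| .seq (.push (.aux true) none) <| .seq (.push .counter false) <|
    .seq (.push .counter true) <| .seq scanLoop <| .pop .counter fun _ => .skip

theorem transforms_scanStep (S : Stacks A B) (x : Bool) :
    scanStep.Transforms { S.pushWord [x] with counter := true :: S.counter }
      { S with
        aux₀ := some x :: S.aux₀
        aux₁ := some x :: S.aux₁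
        counter := if x then true :: true :: S.counter else S.counter } 6 := by
  refine .mono (.pop <| .pop <| (Transforms.push ..).seq <| (Transforms.push ..).seq
    (?_ : Transforms _ _ _ 2)) (by norm_num)
  cases x
  · exact (Transforms.skip _).mono (by norm_num)
  · exact (Transforms.push .counter true _).seq (.push .counter true _)

theorem transforms_scanLoop (u : BinTree) : ∀ {S S' : Stacks A B} {t : ℕ},
    scanLoop.Transforms { S with
        aux₀ := (u.enc.map some).reverse ++ S.aux₀
        aux₁ := (u.enc.map some).reverse ++ S.aux₁ } S' t →
      scanLoop.Transforms { S.pushTree u with counter := true :: S.counter } S'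
        (t + 7 * u.size) := by
  induction u with
  | leaf =>
    intro S S' t h
    exact (Transforms.loop_step rfl (transforms_scanStep S false) h).mono
      (by simp only [BinTree.size]; omega)
  | node l r ihl ihr =>
    intro S S' t h
    have scan_right := ihr (S := { S with
        aux₀ := (l.enc.map some).reverse ++ some true :: S.aux₀
        aux₁ := (l.enc.map some).reverse ++ some true :: S.aux₁ }) (S' := S') (t := t)
      (by simpa [BinTree.enc] using h)
    have scan_children := ihl (S := { S.pushTree r with
        aux₀ := some true :: S.aux₀
        aux₁ := some true :: S.aux₁
        counter := true :: S.counter }) scan_right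
    rw [Stacks.pushTree_node]
    exact (Transforms.loop_step rfl (transforms_scanStep ((S.pushTree r).pushTree l) true)
      scan_children).mono (by simp only [BinTree.size]; omega)

theorem transforms_scan (S : Stacks A B) (u : BinTree) :
    scan.Transforms (S.pushTree u) ((S.saveWord false u.enc).saveWord true u.enc)
      (7 * u.size + 6) := by
  have loop := transforms_scanLoop u (S := { S with
    aux₀ := none :: S.aux₀, aux₁ := none :: S.aux₁, counter := false :: S.counter })
    (.loop_done rfl)
  exact .mono ((Transforms.push ..).seq <| (Transforms.push ..).seq <| (Transforms.push ..).seq <|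
    (Transforms.push ..).seq <| loop.seq <| .pop <| .skip _) (by omega)

/-- Pop one letter from an auxiliary stack, and put it on the main stack if `keep` is set. -/
def drainStep (j keep : Bool) : StackProgram (StackSymbol A B) :=
  .pop (.aux j) fun x : Option (Option Bool) =>
    if keep then .push .main (x.join.getD false) else .skip

/-- Pop letters from an auxiliary stack down to the next delimiter. -/
def drainLoop (j keep : Bool) : StackProgram (StackSymbol A B) :=
  .loop (.aux j) (fun x : Option (Option Bool) => x.join.isSome) (drainStep j keep)

/-- Take a word from an auxiliary stack, and put it on the main stack if `keep` is set. -/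
def drain (j keep : Bool) : StackProgram (StackSymbol A B) :=
  .seq (drainLoop j keep) (.pop (.aux j) fun _ => .skip)

theorem transforms_drainStep (S : Stacks A B) (j keep : Bool) (w : List Bool) (x : Bool) :
    (drainStep j keep).Transforms (S.saveWord j (w ++ [x]))
      ((S.pushWord (if keep then [x] else [])).saveWord j w) 2 := by
  rw [S.saveWord_concat]
  refine .pop ?_
  simp only [Stacks.get_set, Stacks.set_set, List.head?_cons, List.tail_cons]
  rw [show (S.saveWord j w).set (.aux j) ((S.saveWord j w).get (.aux j)) = S.saveWord j w by
    simp [Stacks.saveWord], ← Stacks.pushWord_saveWord]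
  cases keep
  · exact (Transforms.skip _).mono zero_le_one
  · exact .pushBit ..

theorem transforms_drainLoop (j keep : Bool) (w : List Bool) : ∀ S : Stacks A B,
    (drainLoop j keep).Transforms (S.saveWord j w)
      ((S.pushWord (if keep then w else [])).saveWord j []) (3 * w.length + 1) := by
  induction w using List.reverseRecOn with
  | nil =>
    intro S
    rw [ite_self]
    exact .loop_done (by simp [Stacks.saveWord])
  | append_singleton w x ih =>
    intro S
    have loop := ih (S.pushWord (if keep then [x] else []))
    rw [← Stacks.pushWord_append, show (if keep then w else []) ++ (if keep then [x] else []) =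
      if keep then w ++ [x] else [] by cases keep <;> rfl] at loop
    refine (Transforms.loop_step ?_ (transforms_drainStep S j keep w x) loop).mono ?_
    · simp [Stacks.saveWord]
    · rw [List.length_append, List.length_singleton]; omega

theorem transforms_drain (S : Stacks A B) (j keep : Bool) (w : List Bool) :
    (drain j keep).Transforms (S.saveWord j w) (S.pushWord (if keep then w else []))
      (3 * w.length + 2) := by
  refine (transforms_drainLoop j keep w S).seq (t₂ := 1) (.pop ?_)
  cases j <;> exact .skip _

/-- Duplicate the tree on top of the main stack. -/
def dup : StackProgram (StackSymbol A B) := .seq scan (.seq (drain true true) (drain false true))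

/-- Delete the tree on top of the main stack. -/
def drop : StackProgram (StackSymbol A B) := .seq scan (.seq (drain true false) (drain false false))

/-- Move the tree on top of the main stack to the first auxiliary stack. -/
def stash : StackProgram (StackSymbol A B) := .seq scan (drain true false)

/-- Move a stashed tree back to the main stack. -/
def unstash : StackProgram (StackSymbol A B) := drain false true

section

variable (S : Stacks A B) (u : BinTree)

theorem transforms_dup :
    dup.Transforms (S.pushTree u) ((S.pushTree u).pushTree u) (13 * u.size + 10) :=
  ((transforms_scan S u).seq <| (transforms_drain _ true true _).seq <|
    transforms_drain (S.pushTree u) false true u.enc).mono (by rw [BinTree.length_enc]; omega)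

theorem transforms_drop : drop.Transforms (S.pushTree u) S (13 * u.size + 10) :=
  ((transforms_scan S u).seq <| (transforms_drain _ true false _).seq <|
    transforms_drain S false false u.enc).mono (by rw [BinTree.length_enc]; omega)

theorem transforms_stash :
    stash.Transforms (S.pushTree u) (S.saveWord false u.enc) (10 * u.size + 8) :=
  ((transforms_scan S u).seq <| transforms_drain _ true false _).mono
    (by rw [BinTree.length_enc]; omega)

theorem transforms_unstash :
    unstash.Transforms (S.saveWord false u.enc) (S.pushTree u) (3 * u.size + 2) :=
  (transforms_drain S false true u.enc).mono (by rw [BinTree.length_enc])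

end

/-- Read a unary number below `N` from the main stack and branch. -/
def branch : (N : ℕ) → (Fin N → StackProgram (StackSymbol A B)) → StackProgram (StackSymbol A B)
  | 0, _ => .skip
  | N + 1, P => .pop .main fun x =>
      if x = some true then .pop .main fun _ => branch N fun j => P j.succ else P 0

theorem transforms_branch : ∀ {N : ℕ} (P : Fin N → StackProgram (StackSymbol A B)) (j : Fin N),
    (P j).Transforms S S' t →
      (branch N P).Transforms (S.pushTree (.comb j)) S' (t + (2 * N + 1))
  | N + 1, P, ⟨0, _⟩, h => (Transforms.popBit (x := false) h).mono (by omega)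
  | N + 1, P, ⟨j + 1, hj⟩, h => by
    have branch_tail := transforms_branch (fun j => P j.succ) ⟨j, by omega⟩ h
    have branch_succ := Transforms.popBit (x := true)
      (f := fun x => if x = some true then .pop .main fun _ => branch N fun j => P j.succ else P 0)
      (Transforms.popBit (x := false) branch_tail)
    exact branch_succ.mono (by omega)

end StackProgram

/-- Types whose elements are represented by binary trees. -/
class TreeCode (α : Type) where
  toTree : α → BinTree

open TreeCode

/-- The size of the tree that represents an element. -/
def codeSize {α : Type} [TreeCode α] (x : α) : ℕ := (toTree x).size

section Representations

variable {α β : Type} [TreeCode α] [TreeCode β]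

instance : TreeCode BinTree := ⟨id⟩

instance : TreeCode Unit := ⟨fun _ => .leaf⟩

-- Both codes have the same size, so that the size of a list of bits is determined by its length.
instance : TreeCode Bool :=
  ⟨fun b => if b then .node (.node .leaf .leaf) .leaf else .node .leaf (.node .leaf .leaf)⟩

instance : TreeCode (α × β) := ⟨fun p => .node (toTree p.1) (toTree p.2)⟩

instance : TreeCode (List α) := ⟨List.foldr (fun a t => .node (toTree a) t) .leaf⟩

instance : TreeCode ℕ := ⟨fun n => toTree n.bits⟩

instance (N : ℕ) : TreeCode (Fin N) := ⟨fun i => .comb i⟩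

theorem codeSize_pos (x : α) : 0 < codeSize x := BinTree.size_pos _

theorem length_enc_toTree (x : α) : (toTree x).enc.length = codeSize x := BinTree.length_enc _

@[simp] theorem codeSize_prod (p : α × β) : codeSize p = 1 + codeSize p.1 + codeSize p.2 := rfl

@[simp] theorem codeSize_nil : codeSize ([] : List α) = 1 := rfl

@[simp] theorem codeSize_cons (a : α) (l : List α) :
    codeSize (a :: l) = 1 + codeSize a + codeSize l := rfl

@[simp] theorem codeSize_bool (b : Bool) : codeSize b = 5 := by cases b <;> rfl

@[simp] theorem codeSize_fin {N : ℕ} (i : Fin N) : codeSize i = 2 * i + 1 := BinTree.size_comb _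

theorem codeSize_append (l l' : List α) : codeSize (l ++ l') + 1 = codeSize l + codeSize l' := by
  induction l with
  | nil => simp only [List.nil_append, codeSize_nil]; omega
  | cons a l ih => simp only [List.cons_append, codeSize_cons]; omega

@[simp] theorem codeSize_reverse (l : List α) : codeSize l.reverse = codeSize l := by
  induction l with
  | nil => rfl
  | cons a l ih =>
    have reverse_append := codeSize_append l.reverse [a]
    simp only [codeSize_cons, codeSize_nil] at reverse_append
    rw [List.reverse_cons, codeSize_cons]
    omega

theorem length_lt_codeSize (l : List α) : l.length < codeSize l := by
  induction l with
  | nil => simp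
  | cons a l ih => simp only [List.length_cons, codeSize_cons]; omega

theorem codeSize_le_of_isPrefix {l l' : List α} (h : l <+: l') : codeSize l ≤ codeSize l' := by
  obtain ⟨t, rfl⟩ := h
  have := codeSize_append l t
  have := codeSize_pos t
  omega

theorem codeSize_le_of_isSuffix {l l' : List α} (h : l <:+ l') : codeSize l ≤ codeSize l' := by
  rw [← codeSize_reverse l, ← codeSize_reverse l']
  exact codeSize_le_of_isPrefix (List.reverse_prefix.2 h)

theorem codeSize_lt_of_mem {a : α} {l : List α} (h : a ∈ l) : codeSize a < codeSize l := by
  induction l with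
  | nil => simp at h
  | cons b l ih =>
    rw [codeSize_cons]
    rcases List.mem_cons.1 h with rfl | h
    · have := codeSize_pos l; omega
    · have := ih h; omega

theorem codeSize_le_length_mul {l : List α} {n : ℕ} (h : ∀ a ∈ l, codeSize a ≤ n) :
    codeSize l ≤ l.length * (n + 1) + 1 := by
  induction l with
  | nil => simp
  | cons b l ih =>
    have head := h b (by simp)
    have tail := ih fun a ha => h a (by simp [ha])
    simp only [codeSize_cons, List.length_cons, add_mul, one_mul]
    omega

end Representations

namespace Stacks

variable {A B : ℕ} {α β : Type} [TreeCode α] [TreeCode β]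

/-- Put the code of an element on the main stack. -/
def pushCode (S : Stacks A B) (x : α) : Stacks A B := S.pushTree (toTree x)

theorem pushCode_prod (S : Stacks A B) (p : α × β) :
    S.pushCode p = ((S.pushCode p.2).pushCode p.1).pushWord [true] := pushTree_node ..

theorem pushCode_cons (S : Stacks A B) (a : α) (l : List α) :
    S.pushCode (a :: l) = ((S.pushCode l).pushCode a).pushWord [true] := pushTree_node ..

theorem pushCode_bool (S : Stacks A B) (b : Bool) :
    S.pushCode b = ((((S.pushWord [false]).pushWord [false]).pushWord [!b]).pushWord [b]).pushWord
      [true] := by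
  cases b <;> rfl

end Stacks

theorem eval_le_eval (p : Polynomial ℕ) {m n : ℕ} (h : m ≤ n) : p.eval m ≤ p.eval n := by
  rw [Polynomial.eval_eq_sum, Polynomial.eval_eq_sum]
  exact Finset.sum_le_sum fun i _ => Nat.mul_le_mul_left _ (Nat.pow_le_pow_left h i)

open StackProgram

/-- Functions computable in polynomial time by a working program that replaces the code of the
argument on top of the main stack by the code of the value. -/
@[fun_prop]
def StackPolyTime {α β : Type} [TreeCode α] [TreeCode β] (f : α → β) : Prop :=
  ∀ A B : ℕ, ∃ (P : StackProgram (StackSymbol A B)) (p : Polynomial ℕ), ∀ x (S : Stacks A B),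
    P.Transforms (S.pushCode x) (S.pushCode (f x)) (p.eval (codeSize x))

/-- Case distinction on a list, as a function to which `fun_prop` applies. -/
def listCases {β γ : Type} (l : List β) (y : γ) (g : β → List β → γ) : γ :=
  match l with
  | [] => y
  | b :: t => g b t

@[simp] theorem listCases_nil {β γ : Type} (y : γ) (g : β → List β → γ) :
    listCases [] y g = y := rfl

@[simp] theorem listCases_cons {β γ : Type} (b : β) (t : List β) (y : γ) (g : β → List β → γ) :
    listCases (b :: t) y g = g b t := rfl

namespace StackProgram

variable {A B : ℕ} {α β : Type} [TreeCode α] [TreeCode β]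

/-- Case distinction on the list `l` when the code of a pair `(l, x)` is on top of the main stack:
continue with `P` on the code of `x` if `l` is empty, and with `P'` on the code of `((b, t), x)` if
`l = b :: t`. -/
def caseList (P P' : StackProgram (StackSymbol A B)) : StackProgram (StackSymbol A B) :=
  .pop .main fun _ => .pop .main fun y =>
    if y = some true then .seq (.push .main true) (.seq (.push .main true) P') else P

theorem transforms_caseList {P P' : StackProgram (StackSymbol A B)} {S S' : Stacks A B} {t : ℕ}
    (x : α) : ∀ l : List β, (l = [] → P.Transforms (S.pushCode x) S' t) →
      (∀ b l', l = b :: l' → P'.Transforms (S.pushCode ((b, l'), x)) S' t) →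
      (caseList P P').Transforms (S.pushCode (l, x)) S' (t + 4)
  | [], nil, _ => by
    rw [Stacks.pushCode_prod]
    exact (Transforms.popBit (.popBit (nil rfl))).mono (by omega)
  | b :: l, _, cons => by
    have push_pair : Transforms (.push .main true) (((S.pushCode x).pushCode l).pushCode b)
        ((S.pushCode x).pushCode (b, l)) 1 := by
      rw [Stacks.pushCode_prod]; exact .pushBit true _
    have continuation := cons b l rfl
    rw [Stacks.pushCode_prod] at continuation
    rw [Stacks.pushCode_prod, Stacks.pushCode_cons]
    exact (Transforms.popBit <| .popBit <| push_pair.seq <|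
      (Transforms.pushBit true _).seq continuation).mono (by omega)

end StackProgram

namespace StackPolyTime

variable {α β γ : Type} [TreeCode α] [TreeCode β] [TreeCode γ]

theorem exists_codeSize_le {f : α → β} (hf : StackPolyTime f) :
    ∃ p : Polynomial ℕ, ∀ x, codeSize (f x) ≤ p.eval (codeSize x) := by
  obtain ⟨P, p, hP⟩ := hf 0 0
  refine ⟨p + .X, fun x => ?_⟩
  have length_main := (hP x {}).length_le .main
  simpa only [Stacks.get, Stacks.pushCode, Stacks.pushTree, Stacks.pushWord, List.append_nil,
    length_enc_toTree, Polynomial.eval_add, Polynomial.eval_X, add_comm] using length_main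

theorem congr_toTree {f : α → β} (hf : StackPolyTime f) {g : α → γ}
    (h : ∀ x, toTree (g x) = toTree (f x)) : StackPolyTime g := fun A B =>
  let ⟨P, p, hP⟩ := hf A B
  ⟨P, p, fun x S => by simpa only [Stacks.pushCode, h] using hP x S⟩

theorem congr {f g : α → β} (hf : StackPolyTime f) (h : ∀ x, f x = g x) : StackPolyTime g :=
  funext h ▸ hf

@[fun_prop]
theorem id : StackPolyTime fun x : α => x := fun _ _ =>
  ⟨.skip, 0, fun x S => (Transforms.skip (S.pushCode x)).mono (Nat.zero_le _)⟩

theorem of_toTree {f : α → β} (h : ∀ x, toTree (f x) = toTree x) : StackPolyTime f :=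
  id.congr_toTree h

@[fun_prop]
theorem const (y : β) : StackPolyTime fun _ : α => y := fun _ _ =>
  ⟨.seq drop (pushWord (toTree y).enc), 13 * .X + (10 + (codeSize y : Polynomial ℕ)), fun x S =>
    ((transforms_drop S (toTree x)).seq (transforms_pushWord S (toTree y).enc)).mono
      (by simp [codeSize, add_assoc])⟩

@[fun_prop]
theorem comp {f : β → γ} {g : α → β} (hf : StackPolyTime f) (hg : StackPolyTime g) :
    StackPolyTime fun x => f (g x) := by
  intro A B
  obtain ⟨q, hq⟩ := hg.exists_codeSize_le
  obtain ⟨P, p, hP⟩ := hf A B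
  obtain ⟨P', p', hP'⟩ := hg A B
  refine ⟨.seq P' P, p' + p.comp q, fun x S => ((hP' x S).seq (hP (g x) S)).mono ?_⟩
  rw [Polynomial.eval_add, Polynomial.eval_comp]
  exact Nat.add_le_add_left (eval_le_eval p (hq x)) _

@[fun_prop]
theorem pair {f : α → β} {g : α → γ} (hf : StackPolyTime f) (hg : StackPolyTime g) :
    StackPolyTime fun x => (f x, g x) := by
  intro A B
  obtain ⟨q, hq⟩ := hf.exists_codeSize_le
  obtain ⟨P, p, hP⟩ := hf A B
  obtain ⟨P', p', hP'⟩ := hg A B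
  refine ⟨.seq dup (.seq P (.seq stash (.seq P' (.seq unstash (.push .main true))))),
    p + p' + 13 * q + 13 * .X + 21, fun x S => ?_⟩
  rw [Stacks.pushCode_prod]
  refine ((transforms_dup S _).seq <| (hP x (S.pushCode x)).seq <|
    (transforms_stash (S.pushCode x) (toTree (f x))).seq <|
    (hP' x (S.saveWord false (toTree (f x)).enc)).seq <|
    (transforms_unstash (S.pushCode (g x)) _).seq <| .pushBit true _).mono ?_
  have := hq x
  simp only [codeSize, Polynomial.eval_add, Polynomial.eval_mul, Polynomial.eval_X,
    Polynomial.eval_ofNat] at *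
  omega

@[fun_prop]
theorem fst : StackPolyTime fun p : α × β => p.1 := fun _ _ => by
  refine ⟨.pop .main fun _ => .seq stash (.seq drop unstash), 13 * .X + 21, fun x S => ?_⟩
  rw [Stacks.pushCode_prod]
  refine (Transforms.popBit <| (transforms_stash (S.pushCode x.2) (toTree x.1)).seq <|
    (transforms_drop (S.saveWord false (toTree x.1).enc) _).seq <|
    transforms_unstash S (toTree x.1)).mono ?_
  have := codeSize_prod x
  simp only [codeSize, Polynomial.eval_add, Polynomial.eval_mul, Polynomial.eval_X,
    Polynomial.eval_ofNat] at *
  omega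

@[fun_prop]
theorem snd : StackPolyTime fun p : α × β => p.2 := fun _ _ => by
  refine ⟨.pop .main fun _ => drop, 13 * .X + 21, fun x S => ?_⟩
  rw [Stacks.pushCode_prod]
  refine (Transforms.popBit <| transforms_drop (S.pushCode x.2) (toTree x.1)).mono ?_
  have := codeSize_prod x
  simp only [codeSize, Polynomial.eval_add, Polynomial.eval_mul, Polynomial.eval_X,
    Polynomial.eval_ofNat] at *
  omega

theorem comp_fst {f : α → β × γ} (hf : StackPolyTime f) : StackPolyTime fun x => (f x).1 :=
  fst.comp hf

theorem comp_snd {f : α → β × γ} (hf : StackPolyTime f) : StackPolyTime fun x => (f x).2 :=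
  snd.comp hf

@[fun_prop]
theorem cons {f : α → β} {g : α → List β} (hf : StackPolyTime f) (hg : StackPolyTime g) :
    StackPolyTime fun x => f x :: g x :=
  (hf.pair hg).congr_toTree fun _ => rfl

@[fun_prop]
theorem ite {d : α → Bool} {f g : α → β} (hd : StackPolyTime d) (hf : StackPolyTime f)
    (hg : StackPolyTime g) : StackPolyTime fun x => if d x = true then f x else g x := by
  intro A B
  obtain ⟨R, r, hR⟩ := (hd.pair id) A B
  obtain ⟨P, p, hP⟩ := hf A B
  obtain ⟨P', p', hP'⟩ := hg A B
  let test : StackProgram (StackSymbol A B) :=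
    .pop .main fun _ => .pop .main fun _ => .pop .main fun y =>
      .pop .main fun _ => .pop .main fun _ => .pop .main fun _ => if y = some true then P else P'
  have transforms_test : ∀ x (S : Stacks A B), test.Transforms (S.pushCode (d x, x))
      (S.pushCode (if d x = true then f x else g x))
      (p.eval (codeSize x) + p'.eval (codeSize x) + 1 + 1 + 1 + 1 + 1 + 1) := by
    intro x S
    rw [Stacks.pushCode_prod, Stacks.pushCode_bool]
    refine .popBit <| .popBit <| .popBit <| .popBit <| .popBit <| .popBit ?_
    cases d x
    · exact (hP' x S).mono (Nat.le_add_left ..)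
    · exact (hP x S).mono (Nat.le_add_right ..)
  exact ⟨.seq R test, r + p + p' + 6, fun x S => ((hR x S).seq (transforms_test x S)).mono
    (by simp only [Polynomial.eval_add, Polynomial.eval_ofNat]; omega)⟩

theorem listCases {l : α → List β} {f : α → γ} {g : α → β → List β → γ} (hl : StackPolyTime l)
    (hf : StackPolyTime f)
    (hg : StackPolyTime fun p : (β × List β) × α => g p.2 p.1.1 p.1.2) :
    StackPolyTime fun x => listCases (l x) (f x) (g x) := by
  intro A B
  obtain ⟨R, r, hR⟩ := (hl.pair id) A B
  obtain ⟨q, hq⟩ := hl.exists_codeSize_le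
  obtain ⟨P, p, hP⟩ := hf A B
  obtain ⟨P', p', hP'⟩ := hg A B
  refine ⟨.seq R (caseList P P'), r + p + p'.comp (q + .X + 1) + 4, fun x S =>
    ((hR x S).seq (t₂ := (p + p'.comp (q + .X + 1)).eval (codeSize x) + 4)
      (transforms_caseList x (l x) (fun h => ?_) fun b t h => ?_)).mono (by
        simp only [Polynomial.eval_add, Polynomial.eval_ofNat]; omega)⟩
  · beta_reduce
    rw [h, listCases_nil]
    exact (hP x S).mono (by rw [Polynomial.eval_add]; omega)
  · beta_reduce
    rw [h, listCases_cons]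
    have size_l := hq x
    have time_le : p'.eval (codeSize ((b, t), x)) ≤ (p'.comp (q + .X + 1)).eval (codeSize x) := by
      rw [Polynomial.eval_comp]
      refine eval_le_eval p' ?_
      rw [h] at size_l
      simp only [codeSize_prod, codeSize_cons, Polynomial.eval_add, Polynomial.eval_X,
        Polynomial.eval_one] at *
      omega
    exact (hP' ((b, t), x) S).mono (by rw [Polynomial.eval_add]; omega)

end StackPolyTime

namespace StackProgram

variable {A B : ℕ} {β γ : Type} [TreeCode β] [TreeCode γ]

/-- Apply `G` to the state for every entry of the list on top of the stack. Here `G` replaces the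
code of `((b, t), y)` by the code of `(t, y')`, where `b` and `t` are the head and tail of the
list, and `y` and `y'` are the old and the new state. -/
def foldLoop (G : StackProgram (StackSymbol A B)) : StackProgram (StackSymbol A B) :=
  .loop .main (fun x => x == some true) <| .seq (.push .main true) <|
    .seq G (.pop .main fun _ => .skip)

theorem transforms_foldLoop {G : StackProgram (StackSymbol A B)} {g : γ → β → γ} {T : ℕ}
    (S : Stacks A B) (l : List β) : ∀ y,
    (∀ l₁ b l₂, l = l₁ ++ b :: l₂ → G.Transforms (S.pushCode ((b, l₂), l₁.foldl g y))
      (S.pushCode (l₂, g (l₁.foldl g y) b)) T) →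
    (foldLoop G).Transforms ((S.pushCode y).pushCode l)
      ((S.pushCode (l.foldl g y)).pushWord [false]) (l.length * (T + 3) + 1) := by
  induction l with
  | nil => exact fun y _ => (Transforms.loop_done rfl).mono (by omega)
  | cons b l ih =>
    intro y hG
    have step := hG [] b l rfl
    have rest := ih (g y b) fun l₁ b' l₂ h => hG (b :: l₁) b' l₂ (by rw [h]; rfl)
    have push_pair : Transforms (.push .main true) ((S.pushCode y).pushCode (b :: l))
        (S.pushCode ((b, l), y)) 1 := by
      simp only [Stacks.pushCode_prod, Stacks.pushCode_cons]
      exact .pushBit true _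
    have pop_pair : Transforms (.pop .main fun _ => .skip) (S.pushCode (l, g y b))
        ((S.pushCode (g y b)).pushCode l) 1 := by
      rw [Stacks.pushCode_prod]
      exact .popBit (.skip _)
    refine (Transforms.loop_step ?_ (push_pair.seq (step.seq pop_pair)) rest).mono ?_
    · rw [Stacks.pushCode_cons]; rfl
    · simp only [List.length_cons, add_mul, one_mul]; omega

end StackProgram

namespace StackPolyTime

variable {α β γ : Type} [TreeCode α] [TreeCode β] [TreeCode γ]

private theorem foldl_closed {L : α → List β} {s : α → γ} {g : γ → β → γ} (hL : StackPolyTime L)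
    (hs : StackPolyTime s) (hg : StackPolyTime fun p : γ × β => g p.1 p.2) (q : Polynomial ℕ)
    (hq : ∀ x l, l <+: L x → codeSize (l.foldl g (s x)) ≤ q.eval (codeSize x)) :
    StackPolyTime fun x => (L x).foldl g (s x) := by
  intro A B
  obtain ⟨r, hr⟩ := hL.exists_codeSize_le
  obtain ⟨I, i, hI⟩ := (hL.pair hs) A B
  have stepFun : StackPolyTime fun p : (β × List β) × γ => (p.1.2, g p.2 p.1.1) :=
    (fst.comp_snd).pair (hg.comp (snd.pair fst.comp_fst))
  obtain ⟨G, p, hG⟩ := stepFun A B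
  refine ⟨.seq I (.seq (.pop .main fun _ => .skip) (.seq (foldLoop G) (.pop .main fun _ => .skip))),
    i + r * (p.comp (r + q + 1) + 3) + 3, fun x S => ?_⟩
  have loop := transforms_foldLoop (T := p.eval (r.eval (codeSize x) + q.eval (codeSize x) + 1)) S
    (L x) (s x) fun l₁ b l₂ h => (hG ((b, l₂), l₁.foldl g (s x)) S).mono <| eval_le_eval p <| by
      have size_state := hq x l₁ ⟨_, h.symm⟩
      have size_list := hr x
      have size_split := codeSize_append l₁ (b :: l₂)
      have := codeSize_pos l₁
      rw [← h] at size_split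
      simp only [codeSize_prod, codeSize_cons] at *
      omega
  have initial := hI x S
  rw [Stacks.pushCode_prod] at initial
  refine (initial.seq <| (Transforms.popBit (.skip _)).seq <| loop.seq <| .popBit (.skip _)).mono ?_
  have rounds := Nat.mul_le_mul_right (p.eval (r.eval (codeSize x) + q.eval (codeSize x) + 1) + 3)
    ((length_lt_codeSize (L x)).le.trans (hr x))
  simp only [Polynomial.eval_add, Polynomial.eval_mul, Polynomial.eval_comp, Polynomial.eval_one,
    Polynomial.eval_ofNat]
  omega

theorem foldl_of_codeSize_le {L : α → List β} {s : α → γ} {g : α → γ → β → γ}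
    (hL : StackPolyTime L) (hs : StackPolyTime s)
    (hg : StackPolyTime fun p : (α × γ) × β => g p.1.1 p.1.2 p.2) (q : Polynomial ℕ)
    (hq : ∀ x l, l <+: L x → codeSize (l.foldl (g x) (s x)) ≤ q.eval (codeSize x)) :
    StackPolyTime fun x => (L x).foldl (g x) (s x) := by
  have foldl_pair : ∀ x y (l : List β),
      l.foldl (fun p b => (p.1, g p.1 p.2 b)) (x, y) = (x, l.foldl (g x) y) := by
    intro x y l
    induction l generalizing y with
    | nil => rfl
    | cons b _ ih => exact ih (g x y b)
  have fold : StackPolyTime fun x => (L x).foldl (fun p b => (p.1, g p.1 p.2 b)) (x, s x) :=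
    foldl_closed hL (id.pair hs) (fst.comp_fst.pair hg) (1 + .X + q) fun x l hl => by
      rw [foldl_pair]
      simpa using hq x l hl
  exact fold.comp_snd.congr fun x => by rw [foldl_pair]

theorem foldl_of_invariant {L : α → List β} {s : α → γ} {g : α → γ → β → γ}
    (hL : StackPolyTime L) (hs : StackPolyTime s)
    (hg : StackPolyTime fun p : (α × γ) × β => g p.1.1 p.1.2 p.2) (I : α → γ → Prop)
    (hI₀ : ∀ x, I x (s x)) (hI : ∀ x y b, b ∈ L x → I x y → I x (g x y b)) (q : Polynomial ℕ)
    (hq : ∀ x y b, b ∈ L x → I x y →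
      codeSize (g x y b) ≤ codeSize y + q.eval (codeSize x + codeSize b)) :
    StackPolyTime fun x => (L x).foldl (g x) (s x) := by
  obtain ⟨r, hr⟩ := hL.exists_codeSize_le
  obtain ⟨u, hu⟩ := hs.exists_codeSize_le
  refine foldl_of_codeSize_le hL hs hg (u + r * q.comp (.X + r)) fun x l hl => ?_
  have prefix_bound : ∀ l : List β, (∀ b ∈ l, b ∈ L x) →
      I x (l.foldl (g x) (s x)) ∧ codeSize (l.foldl (g x) (s x)) ≤
        codeSize (s x) + l.length * q.eval (codeSize x + r.eval (codeSize x)) := by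
    intro l hl
    induction l using List.reverseRecOn with
    | nil => simpa using hI₀ x
    | append_singleton l b ih =>
      have hb : b ∈ L x := hl b (by simp)
      obtain ⟨inv, size⟩ := ih fun b hb => hl b (by simp [hb])
      have size_step := hq x (l.foldl (g x) (s x)) b hb inv
      have increment : q.eval (codeSize x + codeSize b) ≤
          q.eval (codeSize x + r.eval (codeSize x)) :=
        eval_le_eval q (by have := codeSize_lt_of_mem hb; have := hr x; omega)
      rw [List.foldl_concat]
      refine ⟨hI x _ b hb inv, ?_⟩
      simp only [List.length_append, List.length_singleton, add_mul, one_mul]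
      omega
  have size := (prefix_bound l fun b hb => hl.subset hb).2
  have rounds := Nat.mul_le_mul_right (q.eval (codeSize x + r.eval (codeSize x)))
    (hl.length_le.trans ((length_lt_codeSize (L x)).le.trans (hr x)))
  have := hu x
  simp only [Polynomial.eval_add, Polynomial.eval_mul, Polynomial.eval_comp, Polynomial.eval_X]
  omega

theorem foldl_of_step {L : α → List β} {s : α → γ} {g : α → γ → β → γ}
    (hL : StackPolyTime L) (hs : StackPolyTime s)
    (hg : StackPolyTime fun p : (α × γ) × β => g p.1.1 p.1.2 p.2) (q : Polynomial ℕ)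
    (hq : ∀ x y b, b ∈ L x → codeSize (g x y b) ≤ codeSize y + q.eval (codeSize x + codeSize b)) :
    StackPolyTime fun x => (L x).foldl (g x) (s x) :=
  foldl_of_invariant hL hs hg (fun _ _ => True) (fun _ => trivial) (fun _ _ _ _ _ => trivial) q
    fun x y b hb _ => hq x y b hb

theorem finCases {N : ℕ} {h : Fin N → α → β} (hh : ∀ j, StackPolyTime (h j)) :
    StackPolyTime fun p : Fin N × α => h p.1 p.2 := by
  intro A B
  choose P p hP using fun j => hh j A B
  refine ⟨.pop .main fun _ => branch N P, (∑ j, p j) + (2 * N + 2 : ℕ), fun ⟨j, x⟩ S => ?_⟩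
  rw [Stacks.pushCode_prod]
  refine (Transforms.popBit <| transforms_branch P j (hP j x S)).mono ?_
  have time_le_sum : (p j).eval (codeSize x) ≤ ∑ j', (p j').eval (codeSize (j, x)) :=
    (eval_le_eval (p j) (by simp only [codeSize_prod]; omega)).trans <|
      Finset.single_le_sum (f := fun j' => (p j').eval (codeSize (j, x)))
        (fun _ _ => Nat.zero_le _) (Finset.mem_univ j)
  rw [Polynomial.eval_add, Polynomial.eval_finsetSum, Polynomial.eval_natCast, Nat.cast_id]
  omega

end StackPolyTime

open TreeCode StackProgram

/-- Sequential transduction: `f` updates the state for every entry of the list and emits a word.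
The value consists of the final state and the concatenation of the emitted words. -/
def transduce {σ β γ : Type} (f : σ → β → σ × List γ) : σ → List β → σ × List γ
  | s, [] => (s, [])
  | s, b :: l => ((transduce f (f s b).1 l).1, (f s b).2 ++ (transduce f (f s b).1 l).2)

theorem transduce_eq_foldl {σ β γ : Type} (f : σ → β → σ × List γ) (l : List β) (s : σ)
    (out : List γ) :
    l.foldl (fun t b => ((f t.1 b).1, t.2 ++ (f t.1 b).2)) (s, out) =
      ((transduce f s l).1, out ++ (transduce f s l).2) := by
  induction l generalizing s out with
  | nil => simp [transduce]
  | cons b l ih => rw [List.foldl_cons, ih]; simp [transduce, List.append_assoc]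

theorem transduce_zip {β γ : Type} (l : List β) (m : List γ) :
    (transduce (fun m b => listCases m ([], []) fun c t => (t, [(b, c)])) m l).2 = l.zip m := by
  induction l generalizing m with
  | nil => rfl
  | cons b l ih => cases m <;> simp [transduce, ih]

namespace StackPolyTime

variable {α β γ σ : Type} [TreeCode α] [TreeCode β] [TreeCode γ] [TreeCode σ]

/-! ### Lists and Boolean operations -/

@[fun_prop]
theorem reverse {f : α → List β} (hf : StackPolyTime f) : StackPolyTime fun x => (f x).reverse :=
  (foldl_of_step (g := fun _ acc b => b :: acc) hf (const []) (by fun_prop) (1 + .X)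
    fun _ _ _ _ => by simp; omega).congr fun _ => by simp

theorem foldr_of_codeSize_le {L : α → List β} {s : α → γ} {g : α → β → γ → γ}
    (hL : StackPolyTime L) (hs : StackPolyTime s)
    (hg : StackPolyTime fun p : (α × γ) × β => g p.1.1 p.2 p.1.2) (q : Polynomial ℕ)
    (hq : ∀ x l, l <:+ L x → codeSize (l.foldr (g x) (s x)) ≤ q.eval (codeSize x)) :
    StackPolyTime fun x => (L x).foldr (g x) (s x) := by
  refine (foldl_of_codeSize_le (g := fun x y b => g x b y) hL.reverse hs hg q
    fun x l hl => ?_).congr fun x => List.foldl_reverse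
  rw [← List.foldr_reverse]
  exact hq x l.reverse (List.reverse_prefix.1 (by rwa [List.reverse_reverse]))

theorem foldr_of_step {L : α → List β} {s : α → γ} {g : α → β → γ → γ} (hL : StackPolyTime L)
    (hs : StackPolyTime s) (hg : StackPolyTime fun p : (α × γ) × β => g p.1.1 p.2 p.1.2)
    (q : Polynomial ℕ)
    (hq : ∀ x y b, b ∈ L x → codeSize (g x b y) ≤ codeSize y + q.eval (codeSize x + codeSize b)) :
    StackPolyTime fun x => (L x).foldr (g x) (s x) :=
  (foldl_of_step (g := fun x y b => g x b y) hL.reverse hs hg q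
    fun x y b hb => hq x y b (List.mem_reverse.1 hb)).congr fun x => by simp

@[fun_prop]
theorem append {f g : α → List β} (hf : StackPolyTime f) (hg : StackPolyTime g) :
    StackPolyTime fun x => f x ++ g x :=
  (foldr_of_step (g := fun _ b acc => b :: acc) hf hg (by fun_prop) (1 + .X)
    fun _ _ _ _ => by simp; omega).congr fun _ => by simp

@[fun_prop]
theorem flatMap {L : α → List β} {f : α → β → List γ} (hL : StackPolyTime L)
    (hf : StackPolyTime fun p : α × β => f p.1 p.2) :
    StackPolyTime fun x => (L x).flatMap (f x) := by
  obtain ⟨q, hq⟩ := hf.exists_codeSize_le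
  have step : StackPolyTime fun p : (α × List γ) × β => f p.1.1 p.2 ++ p.1.2 :=
    append (hf.comp (g := fun p : (α × List γ) × β => (p.1.1, p.2)) (by fun_prop)) (by fun_prop)
  refine (foldr_of_step (g := fun x b acc => f x b ++ acc) hL (const []) step (q.comp (1 + .X))
    fun x y b _ => ?_).congr fun x => ?_
  · have size_append := codeSize_append (f x b) y
    have size_value := hq (x, b)
    simp only [codeSize_prod, add_assoc, Polynomial.eval_comp, Polynomial.eval_add,
      Polynomial.eval_one, Polynomial.eval_X] at *
    omega
  · induction L x with
    | nil => rfl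
    | cons b l ih => rw [List.foldr_cons, ih, List.flatMap_cons]

@[fun_prop]
theorem map {L : α → List β} {f : α → β → γ} (hL : StackPolyTime L)
    (hf : StackPolyTime fun p : α × β => f p.1 p.2) : StackPolyTime fun x => (L x).map (f x) :=
  (flatMap (f := fun x b => [f x b]) hL (hf.cons (const []))).congr fun _ =>
    List.map_eq_flatMap.symm

@[fun_prop]
theorem headD {f : α → List β} {d : α → β} (hf : StackPolyTime f) (hd : StackPolyTime d) :
    StackPolyTime fun x => (f x).headD (d x) :=
  (listCases (g := fun _ b _ => b) hf hd (by fun_prop)).congr fun x => by cases f x <;> rfl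

@[fun_prop]
theorem tail {f : α → List β} (hf : StackPolyTime f) : StackPolyTime fun x => (f x).tail :=
  (listCases (g := fun _ _ t => t) hf (const []) (by fun_prop)).congr fun x => by
    cases f x <;> rfl

@[fun_prop]
theorem isEmpty {f : α → List β} (hf : StackPolyTime f) : StackPolyTime fun x => (f x).isEmpty :=
  (listCases (g := fun _ _ _ => false) hf (const true) (by fun_prop)).congr fun x => by
    cases f x <;> rfl

@[fun_prop]
theorem and {f g : α → Bool} (hf : StackPolyTime f) (hg : StackPolyTime g) :
    StackPolyTime fun x => f x && g x :=
  (ite hf hg (const false)).congr fun x => by cases f x <;> rfl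

@[fun_prop]
theorem or {f g : α → Bool} (hf : StackPolyTime f) (hg : StackPolyTime g) :
    StackPolyTime fun x => f x || g x :=
  (ite hf (const true) hg).congr fun x => by cases f x <;> rfl

@[fun_prop]
theorem not {f : α → Bool} (hf : StackPolyTime f) : StackPolyTime fun x => !f x :=
  (ite hf (const false) (const true)).congr fun x => by cases f x <;> rfl

@[fun_prop]
theorem xor {f g : α → Bool} (hf : StackPolyTime f) (hg : StackPolyTime g) :
    StackPolyTime fun x => (f x ^^ g x) :=
  (ite hf hg.not hg).congr fun x => by cases f x <;> cases g x <;> rfl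

@[fun_prop]
theorem boolEq {f g : α → Bool} (hf : StackPolyTime f) (hg : StackPolyTime g) :
    StackPolyTime fun x => decide (f x = g x) :=
  (hf.xor hg).not.congr fun x => by cases f x <;> cases g x <;> rfl

@[fun_prop]
theorem all {L : α → List β} {p : α → β → Bool} (hL : StackPolyTime L)
    (hp : StackPolyTime fun y : α × β => p y.1 y.2) : StackPolyTime fun x => (L x).all (p x) := by
  have step : StackPolyTime fun y : (α × Bool) × β => p y.1.1 y.2 && y.1.2 :=
    and (hp.comp (g := fun y : (α × Bool) × β => (y.1.1, y.2)) (by fun_prop)) (by fun_prop)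
  refine (foldr_of_step (g := fun x b acc => p x b && acc) hL (const true) step 0
    fun x y b _ => by simp).congr fun x => ?_
  induction L x with
  | nil => rfl
  | cons b l ih => rw [List.foldr_cons, ih, List.all_cons]

theorem of_fin {N : ℕ} (h : Fin N → β) : StackPolyTime h :=
  (finCases (h := fun j (_ : Unit) => h j) fun j => const (h j)).comp
    (g := fun j => (j, ())) (by fun_prop)

theorem comp_finCases {N : ℕ} {a : α → Fin N} {h : Fin N → α → β} (ha : StackPolyTime a)
    (hh : ∀ j, StackPolyTime (h j)) : StackPolyTime fun x => h (a x) x :=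
  (finCases hh).comp (g := fun x => (a x, x)) (by fun_prop)

theorem transduce {f : σ → β → σ × List γ} {L : α → List β} {s : α → σ}
    (hf : StackPolyTime fun p : σ × β => f p.1 p.2) (hL : StackPolyTime L) (hs : StackPolyTime s)
    (q : Polynomial ℕ)
    (hq : ∀ y b, codeSize (f y b) ≤ codeSize y + q.eval (codeSize b)) :
    StackPolyTime fun x => transduce f (s x) (L x) := by
  have value : StackPolyTime fun p : (α × σ × List γ) × β => f p.1.2.1 p.2 :=
    hf.comp (g := fun p : (α × σ × List γ) × β => (p.1.2.1, p.2)) (by fun_prop)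
  refine (foldl_of_step (g := fun _ (t : σ × List γ) b => ((f t.1 b).1, t.2 ++ (f t.1 b).2)) hL
    (hs.pair (const [])) (value.comp_fst.pair (append (by fun_prop) value.comp_snd)) q
    fun x t b _ => ?_).congr fun _ => by rw [transduce_eq_foldl, List.nil_append]
  have size_value := hq t.1 b
  have size_append := codeSize_append t.2 (f t.1 b).2
  have size_mono : q.eval (codeSize b) ≤ q.eval (codeSize x + codeSize b) :=
    eval_le_eval q (Nat.le_add_left ..)
  simp only [codeSize_prod] at *
  omega

@[fun_prop]
theorem zip {f : α → List β} {g : α → List γ} (hf : StackPolyTime f) (hg : StackPolyTime g) :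
    StackPolyTime fun x => (f x).zip (g x) := by
  have step : StackPolyTime fun p : List γ × β =>
      _root_.listCases p.1 (([], []) : List γ × List (β × γ)) fun c t => (t, [(p.2, c)]) :=
    listCases (by fun_prop) (by fun_prop) (by fun_prop)
  refine (transduce step hf hg (3 + .X) ?_).comp_snd.congr fun x => transduce_zip _ _
  rintro (_ | ⟨c, t⟩) b
  · simp; omega
  · simp; omega

end StackPolyTime

/-! ### Binary arithmetic -/

theorem encodeNat_eq_bits (n : ℕ) : encodeNat n = n.bits := by
  have encodeNat_bit : ∀ b m, (m = 0 → b = true) → encodeNat (Nat.bit b m) = b :: encodeNat m := by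
    intro b m h
    unfold encodeNat
    rw [← Num.ofNat'_eq, ← Num.ofNat'_eq, Num.ofNat'_bit]
    rcases hm : Num.ofNat' m with _ | p
    · have : m = 0 := by rw [← Num.to_of_nat m, ← Num.ofNat'_eq, hm]; rfl
      rw [h this]
      rfl
    · cases b <;> rfl
  induction n using Nat.binaryRec' with
  | zero => rw [Nat.zero_bits]; rfl
  | bit b n h ih => rw [encodeNat_bit b n h, Nat.bits_append_bit n b h, ih]

/-- The natural number with the given binary digits, the least significant one first. Leading
zeros, at the end of the list, are allowed. -/
def ofBits (l : List Bool) : ℕ := l.foldr Nat.bit 0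

@[simp] theorem ofBits_nil : ofBits [] = 0 := rfl

@[simp] theorem ofBits_cons (b : Bool) (l : List Bool) : ofBits (b :: l) = Nat.bit b (ofBits l) :=
  rfl

@[simp] theorem ofBits_bits (n : ℕ) : ofBits n.bits = n := by
  induction n using Nat.binaryRec' with
  | zero => simp
  | bit b n h ih => rw [Nat.bits_append_bit n b h, ofBits_cons, ih]

theorem ofBits_append_false {α : Type} (l : List Bool) (m : List α) :
    ofBits (l ++ m.map fun _ => false) = ofBits l := by
  have ofBits_false : ofBits (m.map fun _ => false) = 0 := by
    induction m with
    | nil => rfl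
    | cons a m ih => rw [List.map_cons, ofBits_cons, ih]; rfl
  induction l with
  | nil => exact ofBits_false
  | cons b l ih => rw [List.cons_append, ofBits_cons, ofBits_cons, ih]

theorem bits_ofBits (l : List Bool) :
    (ofBits l).bits = l.foldr (fun b t => if t.isEmpty && !b then [] else b :: t) [] := by
  induction l with
  | nil => simp
  | cons b l ih =>
    rw [ofBits_cons, List.foldr_cons, ← ih]
    by_cases leading : ofBits l = 0 ∧ b = false
    · simp [leading.1, leading.2]
    · have digit : ofBits l = 0 → b = true := by simpa using leading
      rw [Nat.bits_append_bit _ _ digit, if_neg]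
      intro vanish
      obtain ⟨empty, hb⟩ := (Bool.and_eq_true _ _).mp vanish
      refine leading ⟨?_, by simpa using hb⟩
      rw [← ofBits_bits (ofBits l), List.isEmpty_iff.1 empty, ofBits_nil]

/-- The pairs of corresponding digits of two numbers, padded by leading zeros. -/
def digitPairs (l m : List Bool) : List (Bool × Bool) :=
  (l ++ m.map fun _ => false).zip (m ++ l.map fun _ => false)

@[simp] theorem ofBits_digitPairs_fst (l m : List Bool) :
    ofBits ((digitPairs l m).map Prod.fst) = ofBits l := by
  rw [digitPairs, List.map_fst_zip (by simp; omega), ofBits_append_false]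

@[simp] theorem ofBits_digitPairs_snd (l m : List Bool) :
    ofBits ((digitPairs l m).map Prod.snd) = ofBits m := by
  rw [digitPairs, List.map_snd_zip (by simp; omega), ofBits_append_false]

/-- One step of ripple-carry addition: the new carry and the digit of the sum. -/
def fullAdder (c : Bool) (p : Bool × Bool) : Bool × List Bool :=
  ((p.1 && p.2) || (c && (p.1 ^^ p.2)), [(p.1 ^^ p.2) ^^ c])

theorem ofBits_transduce_fullAdder (l : List (Bool × Bool)) (c : Bool) :
    ofBits ((transduce fullAdder c l).2 ++ [(transduce fullAdder c l).1]) =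
      ofBits (l.map Prod.fst) + ofBits (l.map Prod.snd) + c.toNat := by
  induction l generalizing c with
  | nil => cases c <;> rfl
  | cons p l ih =>
    simp only [transduce, fullAdder, List.cons_append, List.nil_append, ofBits_cons, List.map_cons,
      ih, Nat.bit_val]
    rcases p with ⟨_ | _, _ | _⟩ <;> cases c <;> simp <;> omega

/-- Compare two numbers given by their pairs of digits: the most significant pair of distinct
digits decides, and `c` is the value if all digits agree. -/
def digitsLE (l : List (Bool × Bool)) (c : Bool) : Bool :=
  l.foldl (fun c p => if (p.1 ^^ p.2) = true then p.2 else c) c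

theorem digitsLE_iff (l : List (Bool × Bool)) (c : Bool) :
    digitsLE l c = true ↔ ofBits (l.map Prod.fst) < ofBits (l.map Prod.snd) + c.toNat := by
  induction l generalizing c with
  | nil => cases c <;> simp [digitsLE]
  | cons p l ih =>
    simp only [digitsLE, List.foldl_cons] at ih ⊢
    rw [ih]
    simp only [List.map_cons, ofBits_cons, Nat.bit_val]
    rcases p with ⟨_ | _, _ | _⟩ <;> cases c <;> simp <;> omega

theorem codeSize_bits (l : List Bool) : codeSize l = 6 * l.length + 1 := by
  induction l with
  | nil => rfl
  | cons b l ih => simp only [codeSize_cons, codeSize_bool, ih, List.length_cons]; omega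

theorem codeSize_nat (n : ℕ) : codeSize n = 6 * n.size + 1 := by
  rw [← Nat.size_eq_bits_len, ← codeSize_bits]
  rfl

theorem codeSize_nat_mono {m n : ℕ} (h : m ≤ n) : codeSize m ≤ codeSize n := by
  have := Nat.size_le_size h
  rw [codeSize_nat, codeSize_nat]
  omega

theorem codeSize_mul_le (m n : ℕ) : codeSize (m * n) + 1 ≤ codeSize m + codeSize n := by
  have : (m * n).size ≤ m.size + n.size := by
    rw [Nat.size_le, pow_add]
    exact Nat.mul_lt_mul'' (Nat.lt_size_self m) (Nat.lt_size_self n)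
  simp only [codeSize_nat]
  omega

theorem codeSize_add_le (m n : ℕ) : codeSize (m + n) + 1 ≤ codeSize m + codeSize n := by
  have : (m + n).size ≤ m.size + n.size := by
    rw [Nat.size_le, pow_add]
    have := Nat.lt_size_self m
    have := Nat.lt_size_self n
    nlinarith
  simp only [codeSize_nat]
  omega

theorem codeSize_add_self_le (n : ℕ) : codeSize (n + n) ≤ codeSize n + 6 := by
  have : (n + n).size ≤ n.size + 1 := by
    rw [Nat.size_le, pow_succ]
    have := Nat.lt_size_self n
    omega
  simp only [codeSize_nat]
  omega

theorem foldr_bits_mul (l : List Bool) (m : ℕ) :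
    l.foldr (fun b a => a + a + if b = true then m else 0) 0 = ofBits l * m := by
  induction l with
  | nil => simp
  | cons b l ih =>
    simp only [List.foldr_cons, ih, ofBits_cons, Nat.bit_val]
    cases b
    · simp; ring
    · simp; ring

namespace StackPolyTime

variable {α β : Type} [TreeCode α] [TreeCode β]

@[fun_prop]
theorem bits : StackPolyTime Nat.bits := of_toTree fun _ => rfl

@[fun_prop]
theorem ofBits : StackPolyTime ofBits := by
  have trim : StackPolyTime fun l : List Bool =>
      l.foldr (fun b t => if t.isEmpty && !b then [] else b :: t) [] := by
    refine foldr_of_step (g := fun _ b t => if t.isEmpty && !b then [] else b :: t) id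
      (const []) (by fun_prop) (1 + .X) fun x y b _ => ?_
    have := codeSize_pos y
    split <;> simp <;> omega
  exact trim.congr_toTree fun l => by rw [← bits_ofBits]; rfl

theorem digitPairs {f g : α → List Bool} (hf : StackPolyTime f) (hg : StackPolyTime g) :
    StackPolyTime fun x => digitPairs (f x) (g x) := by
  unfold _root_.digitPairs
  fun_prop

@[fun_prop]
theorem add {f g : α → ℕ} (hf : StackPolyTime f) (hg : StackPolyTime g) :
    StackPolyTime fun x => f x + g x := by
  have adder : StackPolyTime fun p : Bool × (Bool × Bool) => fullAdder p.1 p.2 := by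
    unfold fullAdder
    fun_prop
  have sum := transduce adder (digitPairs (bits.comp hf) (bits.comp hg)) (const false) 12
    fun c p => by simp [fullAdder]
  refine (ofBits.comp (sum.comp_snd.append (sum.comp_fst.cons (const [])))).congr fun x => ?_
  rw [ofBits_transduce_fullAdder, ofBits_digitPairs_fst, ofBits_digitPairs_snd, ofBits_bits,
    ofBits_bits]
  rfl

@[fun_prop]
theorem le {f g : α → ℕ} (hf : StackPolyTime f) (hg : StackPolyTime g) :
    StackPolyTime fun x => decide (f x ≤ g x) := by
  have compare : StackPolyTime fun l : List (Bool × Bool) => digitsLE l true := by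
    unfold digitsLE
    exact foldl_of_step (g := fun _ (c : Bool) (p : Bool × Bool) =>
      if (p.1 ^^ p.2) = true then p.2 else c) id (const true) (by fun_prop) 0 fun _ _ _ _ => by simp
  refine (compare.comp (digitPairs (bits.comp hf) (bits.comp hg))).congr fun x => ?_
  rw [Bool.eq_iff_iff, digitsLE_iff]
  simp

@[fun_prop]
theorem natEq {f g : α → ℕ} (hf : StackPolyTime f) (hg : StackPolyTime g) :
    StackPolyTime fun x => decide (f x = g x) :=
  ((le hf hg).and (le hg hf)).congr fun x => by
    rw [Bool.eq_iff_iff]; simp [Nat.le_antisymm_iff]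

@[fun_prop]
theorem mul {f g : α → ℕ} (hf : StackPolyTime f) (hg : StackPolyTime g) :
    StackPolyTime fun x => f x * g x := by
  have doubleAndAdd : StackPolyTime fun p : List Bool × ℕ =>
      p.1.foldr (fun b a => a + a + if b = true then p.2 else 0) 0 := by
    refine foldr_of_step (g := fun p b a => a + a + if b = true then p.2 else 0) fst (const 0)
      (by fun_prop) (12 + .X) fun x y b _ => ?_
    have size_double := codeSize_add_self_le y
    have size_add := codeSize_add_le (y + y) (if b = true then x.2 else 0)
    have size_digit : codeSize (if b = true then x.2 else 0) ≤ codeSize x.2 :=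
      codeSize_nat_mono (by split <;> omega)
    simp only [codeSize_prod, Polynomial.eval_add, Polynomial.eval_X, Polynomial.eval_ofNat]
    omega
  exact (doubleAndAdd.comp ((bits.comp hf).pair hg)).congr fun x => by
    rw [foldr_bits_mul, ofBits_bits]

@[fun_prop]
theorem sum {f : α → List ℕ} (hf : StackPolyTime f) : StackPolyTime fun x => (f x).sum :=
  foldr_of_step (g := fun _ b n => b + n) hf (const 0) (by fun_prop) .X fun x y b _ => by
    have := codeSize_add_le b y
    simp only [Polynomial.eval_X]
    omega

@[fun_prop]
theorem length {f : α → List β} (hf : StackPolyTime f) : StackPolyTime fun x => (f x).length :=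
  (sum (map (f := fun _ _ => 1) hf (const 1))).congr fun x => by simp

theorem listEq [DecidableEq β] (hb : StackPolyTime fun p : β × β => decide (p.1 = p.2))
    {f g : α → List β} (hf : StackPolyTime f) (hg : StackPolyTime g) :
    StackPolyTime fun x => decide (f x = g x) := by
  have entriesEq : StackPolyTime fun x => ((f x).zip (g x)).all fun p => decide (p.1 = p.2) :=
    all (hf.zip hg) (hb.comp snd)
  refine ((natEq hf.length hg.length).and entriesEq).congr fun x => ?_
  rw [Bool.eq_iff_iff]
  simp [← List.forall₂_eq_eq_eq, List.forall₂_iff_zip]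

@[fun_prop]
theorem bitsEq {f g : α → List Bool} (hf : StackPolyTime f) (hg : StackPolyTime g) :
    StackPolyTime fun x => decide (f x = g x) := listEq (by fun_prop) hf hg

end StackPolyTime

/-! ### Turing machines -/

namespace StackProgram

variable {A B : ℕ}

/-- Read a letter of the input, and prepend it to the list on top of the main stack. -/
def readLetter : StackProgram (StackSymbol A B) :=
  .pop .input fun x : Option (Fin A) => match x with
    | some j => .seq (pushWord (BinTree.comb j).enc) (.push .main true)
    | none => .skip

/-- Prepend the letters of the input to the list on top of the main stack. -/
def readLoop : StackProgram (StackSymbol A B) :=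
  .loop .input (fun x : Option (Fin A) => x.isSome) readLetter

theorem transforms_readLetter (S : Stacks A B) (j : Fin A) (acc : List (Fin A)) :
    readLetter.Transforms { S.pushCode acc with input := j :: S.input } (S.pushCode (j :: acc))
      (2 * A + 2) := by
  refine .mono (.pop (t := 2 * j + 1 + 1) ?_) (by omega)
  rw [Stacks.pushCode_cons, ← BinTree.size_comb, ← BinTree.length_enc]
  exact (transforms_pushWord (S.pushCode acc) _).seq (.pushBit true _)

theorem transforms_readLoop (l : List (Fin A)) : ∀ acc : List (Fin A),
    readLoop.Transforms (({ input := l } : Stacks A B).pushCode acc)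
      (({} : Stacks A B).pushCode (l.reverse ++ acc)) (l.length * (2 * A + 3) + 1) := by
  induction l with
  | nil => exact fun acc => (Transforms.loop_done rfl).mono (by omega)
  | cons j l ih =>
    intro acc
    rw [List.reverse_cons, List.append_assoc, List.singleton_append]
    refine (Transforms.loop_step rfl (transforms_readLetter { input := l } j acc)
      (ih (j :: acc))).mono ?_
    simp only [List.length_cons, add_mul, one_mul]
    omega

/-- Move the first entry of the list on top of the main stack to the output. -/
def writeLetter : StackProgram (StackSymbol A B) :=
  .pop .main fun _ => branch B fun j => .push .output j

/-- Move the entries of the list on top of the main stack to the output. -/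
def writeLoop : StackProgram (StackSymbol A B) :=
  .loop .main (fun x => x == some true) writeLetter

theorem transforms_writeLetter (S : Stacks A B) (j : Fin B) (l : List (Fin B)) :
    writeLetter.Transforms (S.pushCode (j :: l)) ({ S with output := j :: S.output }.pushCode l)
      (2 * B + 3) := by
  rw [Stacks.pushCode_cons]
  exact (Transforms.popBit (transforms_branch (fun j => .push .output j) j
    (.push .output j (S.pushCode l)))).mono (by omega)

theorem transforms_writeLoop (l : List (Fin B)) : ∀ acc : List (Fin B),
    writeLoop.Transforms (({ output := acc } : Stacks A B).pushCode l)
      (({ output := l.reverse ++ acc } : Stacks A B).pushWord [false])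
      (l.length * (2 * B + 4) + 1) := by
  induction l with
  | nil => exact fun acc => (Transforms.loop_done rfl).mono (by omega)
  | cons j l ih =>
    intro acc
    rw [List.reverse_cons, List.append_assoc, List.singleton_append]
    refine (Transforms.loop_step rfl (transforms_writeLetter { output := acc } j l)
      (ih (j :: acc))).mono ?_
    simp only [List.length_cons, add_mul, one_mul]
    omega

end StackProgram

theorem StackPolyTime.exists_transforms_output {A B : ℕ} {F : List (Fin A) → List (Fin B)}
    (hF : StackPolyTime F) :
    ∃ (P : StackProgram (StackSymbol A B)) (p : Polynomial ℕ), ∀ l,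
      P.Transforms { input := l } { output := F l } (p.eval l.length) := by
  have reversed : StackPolyTime fun l : List (Fin A) => (F l.reverse).reverse :=
    (hF.comp id.reverse).reverse
  obtain ⟨q, hq⟩ := reversed.exists_codeSize_le
  obtain ⟨P, p, hP⟩ := reversed A B
  let r : Polynomial ℕ := .X * (2 * A + 2 : ℕ) + 1
  refine ⟨.seq (.push .main false) <| .seq readLoop <| .seq P <| .seq writeLoop <|
    .pop .main fun _ => .skip,
    .X * (2 * A + 3 : ℕ) + p.comp r + q.comp r * (2 * B + 4 : ℕ) + 4, fun l => ?_⟩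
  have size_input : codeSize l.reverse ≤ r.eval l.length := by
    have := codeSize_le_length_mul (l := l.reverse) (n := 2 * A + 1) fun j _ => by simp
    simpa [r, add_assoc] using this
  have length_output : (F l).reverse.length ≤ q.eval (r.eval l.length) := by
    have size_output := (hq l.reverse).trans (eval_le_eval q size_input)
    rw [List.reverse_reverse] at size_output
    exact (length_lt_codeSize _).le.trans size_output
  have read := transforms_readLoop (B := B) l []
  have compute : P.Transforms (({} : Stacks A B).pushCode l.reverse)
      (({} : Stacks A B).pushCode (F l).reverse) (p.eval (codeSize l.reverse)) := by
    simpa only [List.reverse_reverse] using hP l.reverse {}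
  have write := transforms_writeLoop (A := A) (F l).reverse []
  rw [List.append_nil] at read write
  rw [List.reverse_reverse] at write
  refine ((Transforms.pushBit false { input := l }).seq <| read.seq <| compute.seq <| write.seq <|
    .popBit (.skip _)).mono ?_
  have time_compute := eval_le_eval p size_input
  have time_write := Nat.mul_le_mul_right (2 * B + 4) length_output
  simp only [Polynomial.eval_add, Polynomial.eval_mul, Polynomial.eval_comp, Polynomial.eval_X,
    Polynomial.eval_natCast, Polynomial.eval_ofNat, Nat.cast_id]
  omega

theorem initList_machine {A B : ℕ} (P : StackProgram (StackSymbol A B)) (l : List (Fin A)) :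
    initList (machine P .input .output) l =
      ⟨some (machine P .input .output).main, (machine P .input .output).initialState,
        ({ input := l } : Stacks A B).get⟩ := by
  unfold initList
  congr 1
  funext k
  rcases k with _ | _ | _ | (_ | _) | _ <;> rfl

theorem haltList_machine {A B : ℕ} (P : StackProgram (StackSymbol A B)) (l : List (Fin B)) :
    haltList (machine P .input .output) l =
      ⟨none, (machine P .input .output).initialState, ({ output := l } : Stacks A B).get⟩ := by
  unfold haltList
  congr 1
  funext k
  rcases k with _ | _ | _ | (_ | _) | _ <;> rfl

theorem polyTime_of_stackPolyTime {α β A₀ A₁ : Type} {ea : α → List A₀} {eb : β → List A₁}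
    {A B : ℕ} (eA : A₀ ≃ Fin A) (eB : A₁ ≃ Fin B) {f : α → β} {F : List (Fin A) → List (Fin B)}
    (hF : StackPolyTime F) (h : ∀ x, F ((ea x).map eA) = (eb (f x)).map eB) :
    ParetoCover.PolyTime ea eb f := by
  obtain ⟨P, p, hP⟩ := hF.exists_transforms_output
  refine ⟨{
    tm := machine P .input .output
    inputAlphabet := eA.symm
    outputAlphabet := eB.symm
    time := p + 1
    outputsFun := fun x => Classical.choice ?_ }⟩
  have run := (hP ((ea x).map eA)).machine_reaches (k₀ := .input) (k₁ := .output)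
  rw [h, ← initList_machine, ← haltList_machine, List.length_map] at run
  rw [TM2OutputsInTime, Polynomial.eval_add, Polynomial.eval_one]
  exact run

/-! ### Fractions of natural numbers -/

namespace ParetoCover

/-- The real number represented by a pair of a numerator and a denominator. -/
noncomputable def fracVal (q : ℕ × ℕ) : ℝ := (q.1 : ℝ) / (q.2 : ℝ)

theorem fracVal_nonneg (q : ℕ × ℕ) : 0 ≤ fracVal q := by
  unfold fracVal
  positivity

/-- Comparison of two fractions by cross-multiplication. -/
def fracLE (x y : ℕ × ℕ) : Bool := decide (x.1 * y.2 ≤ y.1 * x.2)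

theorem fracLE_iff {x y : ℕ × ℕ} (hx : 0 < x.2) (hy : 0 < y.2) :
    fracLE x y = true ↔ fracVal x ≤ fracVal y := by
  unfold fracLE fracVal
  rw [div_le_div_iff₀ (by exact_mod_cast hx) (by exact_mod_cast hy), decide_eq_true_iff]
  exact_mod_cast Iff.rfl

/-- Numerators of a list of fractions over a common denominator, together with that denominator,
for which the product of all denominators is taken. -/
def clearDenominators (l : List (ℕ × ℕ)) : List ℕ × ℕ :=
  l.foldr (fun q s => (q.1 * s.2 :: s.1.map fun w => q.2 * w, q.2 * s.2)) ([], 1)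

theorem clearDenominators_cons (q : ℕ × ℕ) (l : List (ℕ × ℕ)) :
    clearDenominators (q :: l) =
      (q.1 * (clearDenominators l).2 :: (clearDenominators l).1.map fun w => q.2 * w,
        q.2 * (clearDenominators l).2) := rfl

theorem clearDenominators_snd_pos {l : List (ℕ × ℕ)} (h : ∀ q ∈ l, 0 < q.2) :
    0 < (clearDenominators l).2 := by
  induction l with
  | nil => exact one_pos
  | cons q l ih =>
    exact Nat.mul_pos (h q List.mem_cons_self) (ih fun r hr => h r (List.mem_cons_of_mem q hr))

@[simp] theorem length_clearDenominators_fst (l : List (ℕ × ℕ)) :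
    (clearDenominators l).1.length = l.length := by
  induction l with
  | nil => rfl
  | cons q l ih =>
    rw [clearDenominators_cons, List.length_cons, List.length_map, ih, List.length_cons]

theorem fracVal_mul_left {d : ℕ} (hd : 0 < d) (q : ℕ × ℕ) :
    fracVal (d * q.1, d * q.2) = fracVal q := by
  have hd : (d : ℝ) ≠ 0 := by exact_mod_cast hd.ne'
  simp only [fracVal, Nat.cast_mul, mul_div_mul_left _ _ hd]

theorem map_fracVal_clearDenominators {l : List (ℕ × ℕ)} (h : ∀ q ∈ l, 0 < q.2) :
    (clearDenominators l).1.map (fun w => fracVal (w, (clearDenominators l).2)) =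
      l.map fracVal := by
  induction l with
  | nil => rfl
  | cons q l ih =>
    have hl : ∀ r ∈ l, 0 < r.2 := fun r hr => h r (List.mem_cons_of_mem q hr)
    simp only [clearDenominators_cons, List.map_cons, List.map_map, Function.comp_def,
      ← ih hl, fracVal_mul_left (h q List.mem_cons_self) (_, (clearDenominators l).2)]
    congr 1
    simpa only [mul_comm] using fracVal_mul_left (clearDenominators_snd_pos hl) q

/-- The sum of a list of fractions. -/
def fracSum (l : List (ℕ × ℕ)) : ℕ × ℕ :=
  ((clearDenominators l).1.sum, (clearDenominators l).2)

theorem fracVal_list_sum (m : List ℕ) (d : ℕ) :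
    fracVal (m.sum, d) = (m.map fun w => fracVal (w, d)).sum := by
  induction m with
  | nil => simp [fracVal]
  | cons w m ih =>
    rw [List.map_cons, List.sum_cons, List.sum_cons, ← ih]
    simp only [fracVal, Nat.cast_add, add_div]

theorem fracVal_fracSum {l : List (ℕ × ℕ)} (h : ∀ q ∈ l, 0 < q.2) :
    fracVal (fracSum l) = (l.map fracVal).sum := by
  rw [← map_fracVal_clearDenominators h]
  exact fracVal_list_sum _ _

/-- The scalar product of two vectors of fractions. -/
def fracDot (x y : List (ℕ × ℕ)) : ℕ × ℕ :=
  fracSum ((x.zip y).map fun q => (q.1.1 * q.2.1, q.1.2 * q.2.2))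

theorem forall_mem_ofFn_iff {τ : Type} {N : ℕ} {f : Fin N → τ} {P : τ → Prop} :
    (∀ y ∈ List.ofFn f, P y) ↔ ∀ i, P (f i) := by
  simp only [List.mem_ofFn, forall_exists_index, forall_apply_eq_imp_iff]

theorem fracDot_ofFn {n : ℕ} (x y : Fin n → ℕ × ℕ) :
    fracDot (List.ofFn x) (List.ofFn y) =
      fracSum (List.ofFn fun i => ((x i).1 * (y i).1, (x i).2 * (y i).2)) := by
  rw [fracDot]
  congr 1
  apply List.ext_getElem <;> simp

section Vectors

variable {n : ℕ} {x y : Fin n → ℕ × ℕ} (hx : ∀ i, 0 < (x i).2) (hy : ∀ i, 0 < (y i).2)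
include hx hy

theorem fracVal_fracDot :
    fracVal (fracDot (List.ofFn x) (List.ofFn y)) = ∑ i, fracVal (x i) * fracVal (y i) := by
  rw [fracDot_ofFn, fracVal_fracSum (forall_mem_ofFn_iff.2 fun i => Nat.mul_pos (hx i) (hy i)),
    List.map_ofFn, List.sum_ofFn]
  simp only [Function.comp_apply, fracVal, Nat.cast_mul, div_mul_div_comm]

theorem fracDot_snd_pos : 0 < (fracDot (List.ofFn x) (List.ofFn y)).2 := by
  rw [fracDot_ofFn]
  exact clearDenominators_snd_pos (forall_mem_ofFn_iff.2 fun i => Nat.mul_pos (hx i) (hy i))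

end Vectors

theorem ofFn_getD {τ : Type} {N : ℕ} {l : List τ} (d : τ) (h : l.length = N) :
    List.ofFn (fun j : Fin N => l.getD j d) = l := by
  subst h
  apply List.ext_getElem <;> simp

/-- The common denominator of a family of fractions. -/
def commonDen {N : ℕ} (q : Fin N → ℕ × ℕ) : ℕ := (clearDenominators (List.ofFn q)).2

/-- The `j`-th numerator of a family of fractions over its common denominator. -/
def numerator {N : ℕ} (q : Fin N → ℕ × ℕ) (j : Fin N) : ℕ :=
  (clearDenominators (List.ofFn q)).1.getD j 0

theorem ofFn_numerator {N : ℕ} (q : Fin N → ℕ × ℕ) :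
    List.ofFn (numerator q) = (clearDenominators (List.ofFn q)).1 :=
  ofFn_getD 0 (by simp only [length_clearDenominators_fst, List.length_ofFn])

section Family

variable {N : ℕ} {q : Fin N → ℕ × ℕ} (h : ∀ j, 0 < (q j).2)
include h

theorem commonDen_pos : 0 < commonDen q := clearDenominators_snd_pos (forall_mem_ofFn_iff.2 h)

theorem fracVal_eq_numerator_div (j : Fin N) : fracVal (q j) = numerator q j / commonDen q := by
  have map_eq := map_fracVal_clearDenominators (forall_mem_ofFn_iff.2 h)
  rw [← ofFn_numerator, List.map_ofFn, List.map_ofFn] at map_eq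
  exact (congrFun (List.ofFn_injective map_eq) j).symm

theorem sum_numerator (hsum : ∑ j, fracVal (q j) = 1) : ∑ j, numerator q j = commonDen q := by
  have den_ne_zero : (commonDen q : ℝ) ≠ 0 := by exact_mod_cast (commonDen_pos h).ne'
  simp only [fracVal_eq_numerator_div h, ← Finset.sum_div] at hsum
  rw [div_eq_one_iff_eq den_ne_zero] at hsum
  exact_mod_cast hsum

end Family

/-! ### The distribution of the set of cover points above a random point -/

/-- The intersection of two sets given by bit lists. -/
def bitInter (m m' : List Bool) : List Bool := (m.zip m').map fun q => q.1 && q.2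

theorem bitInter_ofFn {k : ℕ} (f g : Fin k → Bool) :
    bitInter (List.ofFn f) (List.ofFn g) = List.ofFn fun l => f l && g l := by
  apply List.ext_getElem <;> simp [bitInter]

theorem length_bitInter (m m' : List Bool) :
    (bitInter m m').length = min m.length m'.length := by
  simp only [bitInter, List.length_map, List.length_zip]

/-- All bit lists of length `k`, that is, all subsets of a `k`-element set. -/
noncomputable def bitLists (k : ℕ) : List (List Bool) :=
  (List.finite_length_eq Bool k).toFinset.toList

theorem mem_bitLists {k : ℕ} {m : List Bool} : m ∈ bitLists k ↔ m.length = k := by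
  simp [bitLists]

/-- The integral of `g` with respect to a measure given by a list of point masses. -/
def weightedSum (L : List (List Bool × ℕ)) (g : List Bool → ℕ) : ℕ :=
  (L.map fun s => s.2 * g s.1).sum

theorem weightedSum_cons (s : List Bool × ℕ) (L : List (List Bool × ℕ)) (g : List Bool → ℕ) :
    weightedSum (s :: L) g = s.2 * g s.1 + weightedSum L g := rfl

theorem weightedSum_append (L L' : List (List Bool × ℕ)) (g : List Bool → ℕ) :
    weightedSum (L ++ L') g = weightedSum L g + weightedSum L' g := by
  simp only [weightedSum, List.map_append, List.sum_append]

/-- The list of point masses in which the masses at each bit list of length `k` are merged. This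
keeps the tables of the dynamic program at the fixed length `2 ^ k`. -/
noncomputable def collect (k : ℕ) (C : List (List Bool × ℕ)) : List (List Bool × ℕ) :=
  (bitLists k).map fun m =>
    (m, (C.map fun c => if decide (c.1 = m) = true then c.2 else 0).sum)

theorem weightedSum_collect {k : ℕ} (C : List (List Bool × ℕ)) (g : List Bool → ℕ) :
    weightedSum (collect k C) g = weightedSum (C.filter fun c => c.1.length = k) g := by
  simp only [weightedSum, collect, List.map_map, bitLists, Finset.sum_map_toList,
    Function.comp_def]
  induction C with
  | nil => simp
  | cons c C ih =>
    simp only [List.map_cons, List.sum_cons, add_mul, Finset.sum_add_distrib, ih]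
    by_cases hc : c.1.length = k <;> simp [hc]

theorem length_of_mem_collect {k : ℕ} {C : List (List Bool × ℕ)} :
    ∀ s ∈ collect k C, s.1.length = k := by
  intro s hs
  obtain ⟨m, hm, rfl⟩ := List.mem_map.1 hs
  exact mem_bitLists.1 hm

/-- All intersections of a set from `L` with a set from `row`, with the products of the masses. -/
def interProducts (L row : List (List Bool × ℕ)) : List (List Bool × ℕ) :=
  L.flatMap fun s => row.map fun r => (bitInter s.1 r.1, s.2 * r.2)

theorem weightedSum_interProducts (L row : List (List Bool × ℕ)) (g : List Bool → ℕ) :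
    weightedSum (interProducts L row) g =
      weightedSum L fun m => weightedSum row fun m' => g (bitInter m m') := by
  induction L with
  | nil => rfl
  | cons s L ih =>
    rw [interProducts, List.flatMap_cons, weightedSum_append, ← interProducts, ih,
      weightedSum_cons]
    simp only [weightedSum, List.map_map, Function.comp_def, ← List.sum_map_mul_left, mul_assoc]

/-- One step of the dynamic program: take the values of another coordinate into account. -/
noncomputable def interStep (k : ℕ) (L row : List (List Bool × ℕ)) : List (List Bool × ℕ) :=
  collect k (interProducts L row)

theorem weightedSum_interStep {k : ℕ} {L row : List (List Bool × ℕ)}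
    (hL : ∀ s ∈ L, s.1.length = k) (hrow : ∀ r ∈ row, r.1.length = k) (g : List Bool → ℕ) :
    weightedSum (interStep k L row) g =
      weightedSum L fun m => weightedSum row fun m' => g (bitInter m m') := by
  rw [interStep, weightedSum_collect, List.filter_eq_self.2, weightedSum_interProducts]
  intro c hc
  simp only [interProducts, List.mem_flatMap, List.mem_map] at hc
  obtain ⟨s, hs, r, hr, rfl⟩ := hc
  simp [length_bitInter, hL s hs, hrow r hr]

/-- The distribution of the intersection of random sets, one from each of the lists in `R`. -/
noncomputable def interDistribution (k : ℕ) (R : List (List (List Bool × ℕ))) :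
    List (List Bool × ℕ) :=
  R.foldl (interStep k) [(List.replicate k true, 1)]

/-- The iterated integral over the choices of one set from each of the lists in `R`. -/
def choiceSum : List (List (List Bool × ℕ)) → (List Bool → ℕ) → List Bool → ℕ
  | [], g, m => g m
  | row :: R, g, m => weightedSum row fun m' => choiceSum R g (bitInter m m')

theorem weightedSum_foldl_interStep {k : ℕ} {R : List (List (List Bool × ℕ))}
    (hR : ∀ row ∈ R, ∀ r ∈ row, r.1.length = k) {L : List (List Bool × ℕ)}
    (hL : ∀ s ∈ L, s.1.length = k) (g : List Bool → ℕ) :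
    weightedSum (R.foldl (interStep k) L) g = weightedSum L (choiceSum R g) := by
  induction R generalizing L with
  | nil => rfl
  | cons row R ih =>
    rw [List.foldl_cons, ih (fun r hr => hR r (List.mem_cons_of_mem row hr))
      (by exact length_of_mem_collect), weightedSum_interStep hL (hR row List.mem_cons_self)]
    rfl

theorem choiceSum_ofFn {k N : ℕ} (g : List Bool → ℕ) {n : ℕ} (B : Fin n → Fin N → Fin k → Bool)
    (w : Fin n → Fin N → ℕ) (μ : Fin k → Bool) :
    choiceSum (List.ofFn fun i => List.ofFn fun j => (List.ofFn (B i j), w i j)) g (List.ofFn μ) =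
      ∑ x : Fin n → Fin N, (∏ i, w i (x i)) *
        g (List.ofFn fun l => μ l && decide (∀ i, B i (x i) l = true)) := by
  induction n generalizing μ with
  | zero => simp [choiceSum]
  | succ n ih =>
    rw [List.ofFn_succ]
    simp only [choiceSum, weightedSum, List.map_ofFn, List.sum_ofFn, Function.comp_apply,
      bitInter_ofFn]
    rw [← (Fin.consEquiv fun _ => Fin N).sum_comp, Fintype.sum_prod_type]
    refine Finset.sum_congr rfl fun j _ => ?_
    rw [ih (fun i => B i.succ) (fun i => w i.succ), Finset.mul_sum]
    refine Finset.sum_congr rfl fun x _ => ?_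
    rw [Fin.prod_univ_succ, ← mul_assoc]
    congr 2
    congr 1
    funext l
    rw [Bool.eq_iff_iff]
    simp [Fin.forall_fin_succ, Fin.consEquiv, and_assoc]

/-- The smallest second component of the pairs in `Z` with first component `true`; it is `s` if
there is no such component below `s`. -/
def minSelected (s : ℕ) (Z : List (Bool × ℕ)) : ℕ :=
  Z.foldr (fun q t => if (q.1 && decide (q.2 ≤ t)) = true then q.2 else t) s

theorem minSelected_cons (s : ℕ) (q : Bool × ℕ) (Z : List (Bool × ℕ)) :
    minSelected s (q :: Z) =
      if (q.1 && decide (q.2 ≤ minSelected s Z)) = true then q.2 else minSelected s Z := rfl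

theorem minSelected_le {s w : ℕ} {Z : List (Bool × ℕ)} (h : (true, w) ∈ Z) :
    minSelected s Z ≤ w := by
  induction Z with
  | nil => simp at h
  | cons q Z ih =>
    rw [minSelected_cons]
    split_ifs with hq
    · rcases List.mem_cons.1 h with rfl | h
      · rfl
      · exact (of_decide_eq_true (Bool.and_eq_true_iff.1 hq).2).trans (ih h)
    · rcases List.mem_cons.1 h with rfl | h
      · exact (not_le.1 fun h_le => hq (by simpa using h_le)).le
      · exact ih h

theorem minSelected_eq_or_mem (s : ℕ) (Z : List (Bool × ℕ)) :
    minSelected s Z = s ∨ (true, minSelected s Z) ∈ Z := by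
  induction Z with
  | nil => exact .inl rfl
  | cons q Z ih =>
    rw [minSelected_cons]
    split_ifs with hq
    · refine .inr (List.mem_cons.2 (.inl ?_))
      rw [← (Bool.and_eq_true_iff.1 hq).1]
    · exact ih.imp_right (List.mem_cons_of_mem q)

theorem true_mem_zip_ofFn_iff {k : ℕ} {K : Fin k → ℕ} {μ : Fin k → Bool} {w : ℕ} :
    (true, w) ∈ (List.ofFn μ).zip (List.ofFn K) ↔ ∃ l, μ l = true ∧ K l = w := by
  have zip_eq : (List.ofFn μ).zip (List.ofFn K) = List.ofFn fun l => (μ l, K l) := by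
    apply List.ext_getElem <;> simp
  simp [zip_eq]

theorem exists_minSelected_zip_ofFn_eq {k : ℕ} (K : Fin k → ℕ) (μ : Fin k → Bool)
    (h : ∃ l, μ l = true) :
    ∃ l, μ l = true ∧
      K l = minSelected (List.ofFn K).sum ((List.ofFn μ).zip (List.ofFn K)) := by
  obtain ⟨l, hl⟩ := h
  rcases minSelected_eq_or_mem (List.ofFn K).sum ((List.ofFn μ).zip (List.ofFn K)) with
    h_sum | h_mem
  · refine ⟨l, hl, le_antisymm ?_ (minSelected_le (true_mem_zip_ofFn_iff.2 ⟨l, hl, rfl⟩))⟩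
    rw [h_sum, List.sum_ofFn]
    exact Finset.single_le_sum (fun _ _ => Nat.zero_le _) (Finset.mem_univ l)
  · exact true_mem_zip_ofFn_iff.1 h_mem

/-- The first `t.length` columns of a matrix given by its rows. -/
def columns {τ : Type} (t : List τ) (b : List (List (ℕ × ℕ))) : List (List (ℕ × ℕ)) :=
  b.foldr (fun r s => (r.zip s).map fun q => q.1 :: q.2) (t.map fun _ => [])

theorem columns_ofFn {τ : Type} {n k : ℕ} (t : Fin n → τ) (b : Fin k → Fin n → ℕ × ℕ) :
    columns (List.ofFn t) (List.ofFn fun l => List.ofFn (b l)) =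
      List.ofFn fun i => List.ofFn fun l => b l i := by
  induction k with
  | zero => simp [columns, Function.comp_def]
  | succ k ih =>
    rw [List.ofFn_succ, columns, List.foldr_cons, ← columns, ih fun l => b l.succ]
    apply List.ext_getElem <;> simp [List.ofFn_succ]

/-- For each coordinate the list of its possible values: a value is represented by the set of those
points of the cover `b` that are at least as large in this coordinate, and by its weight. -/
def coordinateTables (a : List (ℕ × ℕ)) (p b : List (List (ℕ × ℕ))) :
    List (List (List Bool × ℕ)) :=
  (p.zip (columns p b)).map fun q =>
    (a.zip (clearDenominators q.1).1).map fun r => (q.2.map fun y => fracLE r.1 y, r.2)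

/-- The distribution, scaled to natural numbers, of the set of those points of the cover `b` that
lie above a random point. -/
noncomputable def coverDistribution (k : ℕ) (a : List (ℕ × ℕ)) (p b : List (List (ℕ × ℕ))) :
    List (List Bool × ℕ) :=
  interDistribution k (coordinateTables a p b)

/-- The total weight of the points that are not covered. -/
noncomputable def uncoveredWeight (k : ℕ) (a : List (ℕ × ℕ)) (p b : List (List (ℕ × ℕ))) : ℕ :=
  weightedSum (coverDistribution k a p b) fun m => if m.all (fun x => !x) = true then 1 else 0

/-- The expected cost, as a fraction. -/
noncomputable def expectedCostFrac (k : ℕ) (a : List (ℕ × ℕ)) (p : List (List (ℕ × ℕ)))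
    (c : List (ℕ × ℕ)) (b : List (List (ℕ × ℕ))) : ℕ × ℕ :=
  (weightedSum (coverDistribution k a p b) fun m =>
      minSelected (clearDenominators (b.map fun y => fracDot c y)).1.sum
        (m.zip (clearDenominators (b.map fun y => fracDot c y)).1),
    weightedSum (coverDistribution k a p b) (fun _ => 1) *
      (clearDenominators (b.map fun y => fracDot c y)).2)

section Matrices

variable {k n N : ℕ} (a : Fin N → ℕ × ℕ) (p : Fin n → Fin N → ℕ × ℕ) (b : Fin k → Fin n → ℕ × ℕ)

theorem coordinateTables_ofFn :
    coordinateTables (List.ofFn a) (List.ofFn fun i => List.ofFn (p i))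
        (List.ofFn fun l => List.ofFn (b l)) =
      List.ofFn fun i => List.ofFn fun j =>
        (List.ofFn fun l => fracLE (a j) (b l i), numerator (p i) j) := by
  rw [coordinateTables, columns_ofFn]
  apply List.ext_getElem
  · simp
  · intro i _ _
    simp only [List.getElem_map, List.getElem_zip, List.getElem_ofFn, ← ofFn_numerator]
    apply List.ext_getElem <;> simp [Function.comp_def, List.map_ofFn]

/-- The set of the points of the cover `b` that lie above the grid point with index `x`. -/
def coverSet (x : Fin n → Fin N) : List Bool :=
  List.ofFn fun l => decide (∀ i, fracLE (a (x i)) (b l i) = true)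

/-- The weight of the grid point with index `x`, before normalization. -/
def gridWeight (x : Fin n → Fin N) : ℕ := ∏ i, numerator (p i) (x i)

theorem weightedSum_coverDistribution (g : List Bool → ℕ) :
    weightedSum (coverDistribution k (List.ofFn a) (List.ofFn fun i => List.ofFn (p i))
      (List.ofFn fun l => List.ofFn (b l))) g =
      ∑ x : Fin n → Fin N, gridWeight p x * g (coverSet a b x) := by
  rw [coverDistribution, coordinateTables_ofFn, interDistribution, weightedSum_foldl_interStep]
  · simp only [weightedSum, List.map_cons, List.map_nil, List.sum_cons, List.sum_nil, one_mul,
      add_zero, ← List.ofFn_const]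
    rw [choiceSum_ofFn g (fun i j l => fracLE (a j) (b l i)) (fun i => numerator (p i))]
    simp only [Bool.true_and, gridWeight, coverSet]
  · simp only [forall_mem_ofFn_iff, List.length_ofFn, implies_true]
  · simp only [List.mem_singleton, forall_eq, List.length_replicate]

theorem coverSet_all_not_iff (x : Fin n → Fin N) :
    (coverSet a b x).all (fun y => !y) = true ↔
      ¬ ∃ l, ∀ i, fracLE (a (x i)) (b l i) = true := by
  simp [coverSet, List.all_eq_true, List.mem_ofFn]

theorem uncoveredWeight_eq_zero_iff :
    uncoveredWeight k (List.ofFn a) (List.ofFn fun i => List.ofFn (p i))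
        (List.ofFn fun l => List.ofFn (b l)) = 0 ↔
      ∀ x, gridWeight p x = 0 ∨ ∃ l, ∀ i, fracLE (a (x i)) (b l i) = true := by
  simp only [uncoveredWeight, weightedSum_coverDistribution, Finset.sum_eq_zero_iff,
    Finset.mem_univ, forall_const, mul_eq_zero, coverSet_all_not_iff, ite_eq_right_iff,
    one_ne_zero, imp_false, not_not]

/-- The numerator of the cost of the cheapest point of the cover above the grid point with index
`x`, over the common denominator of the costs of the points of the cover. -/
def minCostNumerator (c : Fin n → ℕ × ℕ) (x : Fin n → Fin N) : ℕ :=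
  let K := List.ofFn (numerator fun l => fracDot (List.ofFn c) (List.ofFn (b l)))
  minSelected K.sum ((coverSet a b x).zip K)

theorem expectedCostFrac_ofFn (c : Fin n → ℕ × ℕ) :
    expectedCostFrac k (List.ofFn a) (List.ofFn fun i => List.ofFn (p i)) (List.ofFn c)
        (List.ofFn fun l => List.ofFn (b l)) =
      (∑ x, gridWeight p x * minCostNumerator a b c x,
        (∑ x, gridWeight p x) * commonDen fun l => fracDot (List.ofFn c) (List.ofFn (b l))) := by
  simp only [expectedCostFrac, weightedSum_coverDistribution, List.map_ofFn, Function.comp_def,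
    mul_one, minCostNumerator, ofFn_numerator, commonDen]

section Weights

variable {p} (hp : ∀ i j, 0 < (p i j).2) (hsum : ∀ i, ∑ j, fracVal (p i j) = 1)
include hp hsum

theorem sum_gridWeight : ∑ x, gridWeight p x = ∏ i, commonDen (p i) := by
  simp only [gridWeight, ← Fintype.piFinset_univ, ← Finset.prod_univ_sum,
    sum_numerator (hp _) (hsum _)]

theorem sum_gridWeight_pos : 0 < ∑ x, gridWeight p x := by
  rw [sum_gridWeight hp hsum]
  exact Finset.prod_pos fun i _ => commonDen_pos (hp i)

theorem prod_fracVal (x : Fin n → Fin N) :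
    ∏ i, fracVal (p i (x i)) = (gridWeight p x : ℝ) / (∑ y, gridWeight p y : ℕ) := by
  rw [sum_gridWeight hp hsum, gridWeight]
  simp only [fracVal_eq_numerator_div (hp _), Finset.prod_div_distrib, Nat.cast_prod]

end Weights

end Matrices

end ParetoCover

/-! ### The expected cost of a cover -/

namespace ParetoCover

section DiscreteMeasure

variable {n M : ℕ} (a : Fin (M + 2) → ℝ) (p : Fin n → Fin (M + 2) → ℝ)

theorem lintegral_discreteMeasure (f : (Fin n → ℝ) → ℝ≥0∞) :
    ∫⁻ x, f x ∂(discreteMeasure a p) =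
      ∑ x : Fin n → Fin (M + 2), (∏ i, ENNReal.ofReal (p i (x i))) * f fun i => a (x i) := by
  simp [discreteMeasure, lintegral_finsetSum_measure, lintegral_smul_measure, lintegral_dirac]

theorem discreteMeasure_apply (S : Set (Fin n → ℝ)) :
    discreteMeasure a p S = ∑ x : Fin n → Fin (M + 2),
      (∏ i, ENNReal.ofReal (p i (x i))) * S.indicator 1 fun i => a (x i) := by
  simp [discreteMeasure]

variable {p} in
theorem isProbabilityMeasure_discreteMeasure (hp : ∀ i j, 0 ≤ p i j)
    (hsum : ∀ i, ∑ j, p i j = 1) : IsProbabilityMeasure (discreteMeasure a p) := by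
  refine ⟨?_⟩
  simp only [discreteMeasure_apply, Set.indicator_univ, Pi.one_apply, mul_one]
  rw [← Fintype.piFinset_univ,
    ← Finset.prod_univ_sum (fun _ => Finset.univ) fun i j => ENNReal.ofReal (p i j)]
  simp only [← ENNReal.ofReal_sum_of_nonneg fun j _ => hp _ j, hsum, ENNReal.ofReal_one,
    Finset.prod_const_one]

end DiscreteMeasure

theorem measurableSet_covered {n : ℕ} {B : Set (Fin n → ℝ)} (hB : B.Countable) :
    MeasurableSet {x | ∃ b ∈ B, x ≤ b} := by
  have covered_eq : {x | ∃ b ∈ B, x ≤ b} = ⋃ b ∈ B, Set.Iic b := by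
    ext x
    simp only [Set.mem_ofPred_eq, Set.mem_iUnion, Set.mem_Iic, exists_prop]
  rw [covered_eq]
  exact MeasurableSet.biUnion hB fun b _ => measurableSet_Iic

theorem isParetoCover_discreteMeasure_iff {n M : ℕ} {a : Fin (M + 2) → ℝ}
    {p : Fin n → Fin (M + 2) → ℝ} (hp : ∀ i j, 0 ≤ p i j) (hsum : ∀ i, ∑ j, p i j = 1)
    {B : Set (Fin n → ℝ)} (hB : B.Countable) :
    IsParetoCover (discreteMeasure a p) B ↔
      ∀ x : Fin n → Fin (M + 2), ∏ i, p i (x i) = 0 ∨ ∃ b ∈ B, (fun i => a (x i)) ≤ b := by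
  have := isProbabilityMeasure_discreteMeasure a hp hsum
  rw [IsParetoCover, ← prob_compl_eq_zero_iff (measurableSet_covered hB), discreteMeasure_apply,
    Finset.sum_eq_zero_iff]
  simp only [← ENNReal.ofReal_prod_of_nonneg fun i _ => hp i _, Finset.mem_univ, forall_const,
    mul_eq_zero, ENNReal.ofReal_eq_zero, Set.indicator_apply_eq_zero, Set.mem_compl_iff,
    Set.mem_ofPred_eq, Pi.one_apply, one_ne_zero, imp_false, not_not]
  refine forall_congr' fun x => or_congr_left ?_
  exact (Finset.prod_nonneg fun i _ => hp i _).ge_iff_eq'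

theorem coverCost_range {n k : ℕ} (c : Fin n → ℝ) (b : Fin k → Fin n → ℝ) (x : Fin n → ℝ) :
    coverCost c (Set.range b) x =
      ⨅ l, ⨅ _ : x ≤ b l, ENNReal.ofReal (∑ i, c i * b l i) := by
  rw [coverCost, iInf_range]

section Evaluation

variable {k n M : ℕ} {a : Fin (M + 2) → ℕ × ℕ} {p : Fin n → Fin (M + 2) → ℕ × ℕ}
  {c : Fin n → ℕ × ℕ} {b : Fin k → Fin n → ℕ × ℕ}
  (ha : ∀ j, 0 < (a j).2) (hp : ∀ i j, 0 < (p i j).2)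
  (hsum : ∀ i, ∑ j, fracVal (p i j) = 1) (hc : ∀ i, 0 < (c i).2) (hb : ∀ l i, 0 < (b l i).2)

include ha hb in
theorem le_iff_forall_fracLE (x : Fin n → Fin (M + 2)) (l : Fin k) :
    ((fun i => fracVal (a (x i))) ≤ fun i => fracVal (b l i)) ↔
      ∀ i, fracLE (a (x i)) (b l i) = true :=
  forall_congr' fun i => (fracLE_iff (ha _) (hb l i)).symm

include ha hp hsum hb in
theorem isParetoCover_iff_uncoveredWeight_eq_zero :
    IsParetoCover (discreteMeasure (fun j => fracVal (a j)) fun i j => fracVal (p i j))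
        (Set.range fun l i => fracVal (b l i)) ↔
      uncoveredWeight k (List.ofFn a) (List.ofFn fun i => List.ofFn (p i))
        (List.ofFn fun l => List.ofFn (b l)) = 0 := by
  have total_pos : (0 : ℝ) < (∑ x, gridWeight p x : ℕ) := by
    exact_mod_cast sum_gridWeight_pos hp hsum
  rw [isParetoCover_discreteMeasure_iff (fun i j => fracVal_nonneg _) hsum
    (Set.countable_range _), uncoveredWeight_eq_zero_iff]
  simp only [prod_fracVal hp hsum, div_eq_zero_iff, total_pos.ne', or_false, Nat.cast_eq_zero,
    Set.exists_range_iff, le_iff_forall_fracLE ha hb]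

include hc hb in
theorem cost_eq_numerator_div (l : Fin k) : ∑ i, fracVal (c i) * fracVal (b l i) =
    numerator (fun l => fracDot (List.ofFn c) (List.ofFn (b l))) l /
      commonDen fun l => fracDot (List.ofFn c) (List.ofFn (b l)) := by
  rw [← fracVal_fracDot hc (hb l)]
  exact fracVal_eq_numerator_div (q := fun l => fracDot (List.ofFn c) (List.ofFn (b l)))
    (fun l => fracDot_snd_pos hc (hb l)) l

include ha hc hb in
theorem coverCost_eq_minCostNumerator_div (x : Fin n → Fin (M + 2))
    (hx : ∃ l, ∀ i, fracLE (a (x i)) (b l i) = true) :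
    coverCost (fun i => fracVal (c i)) (Set.range fun l i => fracVal (b l i))
        (fun i => fracVal (a (x i))) =
      ENNReal.ofReal (minCostNumerator a b c x /
        commonDen fun l => fracDot (List.ofFn c) (List.ofFn (b l))) := by
  rw [coverCost_range]
  simp only [le_iff_forall_fracLE ha hb, cost_eq_numerator_div hc hb]
  apply le_antisymm
  · obtain ⟨l, hl, cost_eq_min⟩ := exists_minSelected_zip_ofFn_eq
      (numerator fun l => fracDot (List.ofFn c) (List.ofFn (b l)))
      (fun l => decide (∀ i, fracLE (a (x i)) (b l i) = true)) (by simpa using hx)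
    rw [minCostNumerator, coverSet, ← cost_eq_min]
    exact iInf₂_le l (of_decide_eq_true hl)
  · refine le_iInf₂ fun l hl => ENNReal.ofReal_le_ofReal ?_
    gcongr
    exact minSelected_le (true_mem_zip_ofFn_iff.2 ⟨l, decide_eq_true hl, rfl⟩)

include hp hsum hc hb in
theorem expectedCostFrac_snd_pos :
    0 < (expectedCostFrac k (List.ofFn a) (List.ofFn fun i => List.ofFn (p i)) (List.ofFn c)
      (List.ofFn fun l => List.ofFn (b l))).2 := by
  rw [expectedCostFrac_ofFn]
  exact Nat.mul_pos (sum_gridWeight_pos hp hsum)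
    (commonDen_pos fun l => fracDot_snd_pos hc (hb l))

include ha hp hsum hc hb in
theorem expectedCost_eq_fracVal_expectedCostFrac
    (h_cover : IsParetoCover (discreteMeasure (fun j => fracVal (a j)) fun i j => fracVal (p i j))
      (Set.range fun l i => fracVal (b l i))) :
    expectedCost (discreteMeasure (fun j => fracVal (a j)) fun i j => fracVal (p i j))
        (fun i => fracVal (c i)) (Set.range fun l i => fracVal (b l i)) =
      ENNReal.ofReal (fracVal (expectedCostFrac k (List.ofFn a)
        (List.ofFn fun i => List.ofFn (p i)) (List.ofFn c)
        (List.ofFn fun l => List.ofFn (b l)))) := by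
  rw [isParetoCover_iff_uncoveredWeight_eq_zero ha hp hsum hb, uncoveredWeight_eq_zero_iff]
    at h_cover
  rw [expectedCost, lintegral_discreteMeasure, expectedCostFrac_ofFn]
  set D := commonDen fun l => fracDot (List.ofFn c) (List.ofFn (b l))
  set W := ∑ x, gridWeight p x
  have term_eq (x : Fin n → Fin (M + 2)) :
      (∏ i, ENNReal.ofReal (fracVal (p i (x i)))) * coverCost (fun i => fracVal (c i))
          (Set.range fun l i => fracVal (b l i)) (fun i => fracVal (a (x i))) =
        ENNReal.ofReal ((gridWeight p x * minCostNumerator a b c x : ℕ) / (W * D : ℕ)) := by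
    rw [← ENNReal.ofReal_prod_of_nonneg fun i _ => fracVal_nonneg _, prod_fracVal hp hsum]
    rcases h_cover x with weight_zero | h_covered
    · simp [weight_zero]
    · rw [coverCost_eq_minCostNumerator_div ha hc hb x h_covered,
        ← ENNReal.ofReal_mul (by positivity), div_mul_div_comm, Nat.cast_mul, Nat.cast_mul]
  simp only [term_eq]
  rw [fracVal, ← ENNReal.ofReal_sum_of_nonneg fun x _ => by positivity, ← Finset.sum_div,
    Nat.cast_sum]

end Evaluation

end ParetoCover

/-! ### The evaluation takes polynomial time -/

namespace ParetoCover

variable {α β : Type} [TreeCode α] [TreeCode β]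

@[fun_prop]
theorem stackPolyTime_fracLE {f g : α → ℕ × ℕ} (hf : StackPolyTime f) (hg : StackPolyTime g) :
    StackPolyTime fun x => fracLE (f x) (g x) := by
  unfold fracLE
  fun_prop

theorem codeSize_clearDenominators_snd_le (l : List (ℕ × ℕ)) :
    codeSize (clearDenominators l).2 ≤ codeSize l + 6 := by
  induction l with
  | nil => simp [clearDenominators, codeSize_nat]
  | cons q l ih =>
    have mul_le := codeSize_mul_le q.2 (clearDenominators l).2
    simp only [clearDenominators_cons, codeSize_cons, codeSize_prod]
    omega

theorem codeSize_le_of_mem_clearDenominators_fst {l : List (ℕ × ℕ)} :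
    ∀ w ∈ (clearDenominators l).1, codeSize w ≤ codeSize l + 6 := by
  induction l with
  | nil => simp [clearDenominators]
  | cons q l ih =>
    intro w hw
    simp only [clearDenominators_cons, List.mem_cons, List.mem_map] at hw
    simp only [codeSize_cons, codeSize_prod]
    rcases hw with rfl | ⟨v, hv, rfl⟩
    · have mul_le := codeSize_mul_le q.1 (clearDenominators l).2
      have den_le := codeSize_clearDenominators_snd_le l
      omega
    · have mul_le := codeSize_mul_le q.2 v
      have v_le := ih v hv
      omega

theorem codeSize_clearDenominators_le (l : List (ℕ × ℕ)) :
    codeSize (clearDenominators l) ≤ codeSize l * (codeSize l + 7) + codeSize l + 8 := by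
  have den_le := codeSize_clearDenominators_snd_le l
  have num_le := codeSize_le_length_mul (codeSize_le_of_mem_clearDenominators_fst (l := l))
  have length_le : l.length * (codeSize l + 6 + 1) ≤ codeSize l * (codeSize l + 7) :=
    Nat.mul_le_mul (length_lt_codeSize l).le le_rfl
  rw [length_clearDenominators_fst] at num_le
  rw [codeSize_prod]
  omega

@[fun_prop]
theorem stackPolyTime_clearDenominators {f : α → List (ℕ × ℕ)} (hf : StackPolyTime f) :
    StackPolyTime fun x => clearDenominators (f x) := by
  suffices StackPolyTime clearDenominators from this.comp hf
  refine .foldr_of_codeSize_le (g := fun _ (q : ℕ × ℕ) (s : List ℕ × ℕ) =>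
    (q.1 * s.2 :: s.1.map fun w => q.2 * w, q.2 * s.2)) (by fun_prop) (by fun_prop)
    (by fun_prop) (.X * (.X + 7) + .X + 8) fun l l' h => ?_
  have le_codeSize : codeSize l' ≤ codeSize l := codeSize_le_of_isSuffix h
  refine (codeSize_clearDenominators_le l').trans ?_
  simp only [Polynomial.eval_add, Polynomial.eval_mul, Polynomial.eval_X, Polynomial.eval_ofNat]
  gcongr

@[fun_prop]
theorem stackPolyTime_fracDot {f g : α → List (ℕ × ℕ)} (hf : StackPolyTime f)
    (hg : StackPolyTime g) : StackPolyTime fun x => fracDot (f x) (g x) := by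
  unfold fracDot fracSum
  fun_prop

theorem codeSize_map_zip_cons_le (r : List α) (s : List (List α)) :
    codeSize ((r.zip s).map fun q => q.1 :: q.2) ≤ codeSize s + codeSize r := by
  induction r generalizing s with
  | nil =>
    have := codeSize_pos s
    simp only [List.zip_nil_left, List.map_nil, codeSize_nil]
    omega
  | cons a r ih =>
    rcases s with _ | ⟨t, s⟩
    · simp only [List.zip_nil_right, List.map_nil, codeSize_nil]
      omega
    · have := ih s
      simp only [List.zip_cons_cons, List.map_cons, codeSize_cons]
      omega

@[fun_prop]
theorem stackPolyTime_columns {f : α → List β} {g : α → List (List (ℕ × ℕ))}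
    (hf : StackPolyTime f) (hg : StackPolyTime g) :
    StackPolyTime fun x => columns (f x) (g x) := by
  unfold columns
  refine .foldr_of_step (g := fun _ (r : List (ℕ × ℕ)) (s : List (List (ℕ × ℕ))) =>
    (r.zip s).map fun q => q.1 :: q.2) (s := fun x => (f x).map fun _ => []) hg (by fun_prop)
    (by fun_prop) .X fun x y r _ => ?_
  rw [Polynomial.eval_X]
  exact (codeSize_map_zip_cons_le r y).trans (by omega)

@[fun_prop]
theorem stackPolyTime_coordinateTables {f : α → List (ℕ × ℕ)} {g h : α → List (List (ℕ × ℕ))}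
    (hf : StackPolyTime f) (hg : StackPolyTime g) (hh : StackPolyTime h) :
    StackPolyTime fun x => coordinateTables (f x) (g x) (h x) := by
  unfold coordinateTables
  fun_prop

theorem weightedSum_collect_le (k : ℕ) (C : List (List Bool × ℕ)) (g : List Bool → ℕ) :
    weightedSum (collect k C) g ≤ weightedSum C g := by
  rw [weightedSum_collect]
  exact (List.filter_sublist.map _).sum_le_sum fun _ _ => Nat.zero_le _

theorem weightedSum_const (L : List (List Bool × ℕ)) (t : ℕ) :
    weightedSum L (fun _ => t) = weightedSum L (fun _ => 1) * t := by
  simp only [weightedSum, mul_one, List.sum_map_mul_right]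

theorem weightedSum_interStep_one_le (k : ℕ) (L row : List (List Bool × ℕ)) :
    weightedSum (interStep k L row) (fun _ => 1) ≤
      weightedSum L (fun _ => 1) * weightedSum row (fun _ => 1) := by
  refine (weightedSum_collect_le k _ _).trans_eq ?_
  rw [weightedSum_interProducts, weightedSum_const]

theorem interDistribution_concat (k : ℕ) (R : List (List (List Bool × ℕ)))
    (row : List (List Bool × ℕ)) :
    interDistribution k (R ++ [row]) = interStep k (interDistribution k R) row := by
  rw [interDistribution, List.foldl_append]
  rfl

theorem weightedSum_interDistribution_one_le (k : ℕ) (R : List (List (List Bool × ℕ))) :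
    weightedSum (interDistribution k R) (fun _ => 1) ≤
      (R.map fun row => weightedSum row fun _ => 1).prod := by
  induction R using List.reverseRecOn with
  | nil => rfl
  | append_singleton R row ih =>
    rw [interDistribution_concat, List.map_append, List.prod_append, List.map_singleton,
      List.prod_singleton]
    exact (weightedSum_interStep_one_le k _ row).trans (Nat.mul_le_mul_right _ ih)

theorem length_interDistribution_le (k : ℕ) (R : List (List (List Bool × ℕ))) :
    (interDistribution k R).length ≤ (bitLists k).length + 1 := by
  rcases List.eq_nil_or_concat R with rfl | ⟨R, row, rfl⟩
  · simp [interDistribution]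
  · simp [interDistribution_concat, interStep, collect]

theorem length_of_mem_interDistribution {k : ℕ} {R : List (List (List Bool × ℕ))} :
    ∀ s ∈ interDistribution k R, s.1.length = k := by
  rcases List.eq_nil_or_concat R with rfl | ⟨R, row, rfl⟩
  · simp [interDistribution]
  · rw [List.concat_eq_append, interDistribution_concat]
    exact length_of_mem_collect

theorem codeSize_weightedSum_one_le (L : List (List Bool × ℕ)) :
    codeSize (weightedSum L fun _ => 1) ≤ codeSize L := by
  induction L with
  | nil => simp [weightedSum, codeSize_nat]
  | cons s L ih =>
    have add_le := codeSize_add_le s.2 (weightedSum L fun _ => 1)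
    simp only [weightedSum_cons, mul_one, codeSize_cons, codeSize_prod]
    omega

theorem codeSize_prod_weightedSum_one_le (R : List (List (List Bool × ℕ))) :
    codeSize (R.map fun row => weightedSum row fun _ => 1).prod ≤ codeSize R + 6 := by
  induction R with
  | nil => simp [codeSize_nat]
  | cons row R ih =>
    have mul_le := codeSize_mul_le (weightedSum row fun _ => 1)
      (R.map fun row => weightedSum row fun _ => 1).prod
    have row_le := codeSize_weightedSum_one_le row
    simp only [List.map_cons, List.prod_cons, codeSize_cons]
    omega

theorem codeSize_interDistribution_le (k : ℕ) (R : List (List (List Bool × ℕ))) :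
    codeSize (interDistribution k R) ≤
      ((bitLists k).length + 1) * (codeSize R + (6 * k + 9)) + 1 := by
  have entry_le : ∀ s ∈ interDistribution k R, codeSize s ≤ codeSize R + (6 * k + 8) := by
    intro s hs
    have mass_le_sum : s.2 ≤ weightedSum (interDistribution k R) fun _ => 1 :=
      List.single_le_sum (fun _ _ => Nat.zero_le _) _ (List.mem_map.2 ⟨s, hs, mul_one _⟩)
    have mass_le := (codeSize_nat_mono (mass_le_sum.trans
      (weightedSum_interDistribution_one_le k R))).trans (codeSize_prod_weightedSum_one_le R)
    have set_eq := codeSize_bits s.1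
    rw [length_of_mem_interDistribution s hs] at set_eq
    rw [codeSize_prod]
    omega
  exact (codeSize_le_length_mul entry_le).trans
    (Nat.add_le_add_right (Nat.mul_le_mul (length_interDistribution_le k R) le_rfl) 1)

@[fun_prop]
theorem stackPolyTime_bitInter {f g : α → List Bool} (hf : StackPolyTime f)
    (hg : StackPolyTime g) : StackPolyTime fun x => bitInter (f x) (g x) := by
  unfold bitInter
  fun_prop

theorem stackPolyTime_interStep (k : ℕ) {f g : α → List (List Bool × ℕ)}
    (hf : StackPolyTime f) (hg : StackPolyTime g) :
    StackPolyTime fun x => interStep k (f x) (g x) := by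
  unfold interStep collect interProducts
  fun_prop

@[fun_prop]
theorem stackPolyTime_interDistribution (k : ℕ) {f : α → List (List (List Bool × ℕ))}
    (hf : StackPolyTime f) : StackPolyTime fun x => interDistribution k (f x) := by
  suffices StackPolyTime (interDistribution k) from this.comp hf
  refine .foldl_of_codeSize_le (g := fun _ => interStep k) (by fun_prop) (by fun_prop)
    (stackPolyTime_interStep k (by fun_prop) (by fun_prop))
    (((bitLists k).length + 1 : ℕ) * (.X + (6 * k + 9 : ℕ)) + 1) fun R R' h => ?_
  have le_codeSize : codeSize R' ≤ codeSize R := codeSize_le_of_isPrefix h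
  refine (codeSize_interDistribution_le k R').trans ?_
  simp only [Polynomial.eval_add, Polynomial.eval_mul, Polynomial.eval_X,
    Polynomial.eval_natCast, Polynomial.eval_one, Nat.cast_id]
  gcongr

@[fun_prop]
theorem stackPolyTime_minSelected {f : α → ℕ} {g : α → List (Bool × ℕ)} (hf : StackPolyTime f)
    (hg : StackPolyTime g) : StackPolyTime fun x => minSelected (f x) (g x) := by
  unfold minSelected
  refine .foldr_of_step (g := fun _ (q : Bool × ℕ) (t : ℕ) =>
    if (q.1 && decide (q.2 ≤ t)) = true then q.2 else t) hg hf (by fun_prop) .X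
    fun x y b _ => ?_
  rw [Polynomial.eval_X]
  split
  · rw [codeSize_prod]; omega
  · omega

@[fun_prop]
theorem stackPolyTime_uncoveredWeight (k : ℕ) {a : α → List (ℕ × ℕ)}
    {p b : α → List (List (ℕ × ℕ))} (ha : StackPolyTime a) (hp : StackPolyTime p)
    (hb : StackPolyTime b) : StackPolyTime fun x => uncoveredWeight k (a x) (p x) (b x) := by
  unfold uncoveredWeight coverDistribution weightedSum
  fun_prop

@[fun_prop]
theorem stackPolyTime_expectedCostFrac (k : ℕ) {a c : α → List (ℕ × ℕ)}
    {p b : α → List (List (ℕ × ℕ))} (ha : StackPolyTime a) (hp : StackPolyTime p)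
    (hc : StackPolyTime c) (hb : StackPolyTime b) :
    StackPolyTime fun x => expectedCostFrac k (a x) (p x) (c x) (b x) := by
  unfold expectedCostFrac coverDistribution weightedSum
  fun_prop

end ParetoCover

namespace BinTree

/-- The list of trees that a tree represents, reading `leaf` as the empty list. -/
def asList : BinTree → List BinTree
  | leaf => []
  | node l r => l :: r.asList

/-- The list of bits that a tree represents. -/
def asBits (t : BinTree) : List Bool :=
  t.asList.map fun b => !(b.asList.headD leaf).asList.isEmpty

theorem toTree_asList (t : BinTree) : toTree t.asList = t := by
  induction t with
  | leaf => rfl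
  | node l r _ ih => exact congrArg (node l) ih

theorem asList_toTree {α : Type} [TreeCode α] (l : List α) : (toTree l).asList = l.map toTree := by
  induction l with
  | nil => rfl
  | cons a l ih => exact congrArg _ ih

@[simp] theorem asBits_toTree (l : List Bool) : (toTree l).asBits = l := by
  rw [asBits, asList_toTree, List.map_map]
  exact List.map_id'' (fun b => by cases b <;> rfl) l

@[simp] theorem asBits_toTree_nat (n : ℕ) : (toTree n).asBits = n.bits := asBits_toTree n.bits

theorem codeSize_asList (t : BinTree) : codeSize t.asList = codeSize t :=
  congrArg size (toTree_asList t)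

theorem codeSize_asBits_le (t : BinTree) : codeSize t.asBits ≤ 6 * codeSize t := by
  have length_lt := length_lt_codeSize t.asList
  rw [codeSize_asList] at length_lt
  rw [codeSize_bits, asBits, List.length_map]
  omega

end BinTree

theorem codeSize_ofBits_le (l : List Bool) : codeSize (ofBits l) ≤ codeSize l := by
  have length_le : (ofBits l).bits.length ≤ l.length := by
    induction l with
    | nil => simp
    | cons b l ih =>
      rw [ofBits_cons, Nat.size_eq_bits_len, List.length_cons, Nat.size_le, pow_succ, Nat.bit_val]
      rw [Nat.size_eq_bits_len, Nat.size_le] at ih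
      have := b.toNat_le
      omega
  rw [codeSize_nat, codeSize_bits, ← Nat.size_eq_bits_len]
  omega

/-- A numbering of the alphabet of the encodings. -/
noncomputable def symbolEquiv : Γ' ≃ Fin 6 := Fintype.equivFinOfCardEq rfl

noncomputable instance : TreeCode Γ' := ⟨fun g => toTree (symbolEquiv g)⟩

namespace StackPolyTime

variable {α β : Type} [TreeCode α] [TreeCode β]

@[fun_prop]
theorem toTree {f : α → β} (hf : StackPolyTime f) : StackPolyTime fun x => toTree (f x) :=
  hf.congr_toTree fun _ => rfl

@[fun_prop]
theorem asList {f : α → BinTree} (hf : StackPolyTime f) : StackPolyTime fun x => (f x).asList :=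
  hf.congr_toTree fun _ => BinTree.toTree_asList _

@[fun_prop]
theorem asBits {f : α → BinTree} (hf : StackPolyTime f) : StackPolyTime fun x => (f x).asBits := by
  unfold BinTree.asBits
  fun_prop

@[fun_prop]
theorem symbolEquiv {f : α → Γ'} (hf : StackPolyTime f) :
    StackPolyTime fun x => symbolEquiv (f x) :=
  hf.congr_toTree fun _ => rfl

theorem symbolCases {a : α → Γ'} {h : Γ' → α → β} (ha : StackPolyTime a)
    (hh : ∀ g, StackPolyTime (h g)) : StackPolyTime fun x => h (a x) x :=
  (comp_finCases (h := fun j => h (_root_.symbolEquiv.symm j)) ha.symbolEquiv fun j => hh _).congr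
    fun x => by rw [Equiv.symm_apply_apply]

@[fun_prop]
theorem wordEq {f g : α → List Γ'} (hf : StackPolyTime f) (hg : StackPolyTime g) :
    StackPolyTime fun x => decide (f x = g x) := by
  refine listEq ?_ hf hg
  have symbolEq (g₀ : Γ') : StackPolyTime fun p : Γ' × Γ' => decide (g₀ = p.2) :=
    symbolCases (h := fun g _ => decide (g₀ = g)) snd fun g => const _
  exact symbolCases (h := fun g p => decide (g = p.2)) fst symbolEq

@[fun_prop]
theorem bit {f : α → Bool} (hf : StackPolyTime f) : StackPolyTime fun x => Γ'.bit (f x) :=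
  (ite hf (const (Γ'.bit true)) (const (Γ'.bit false))).congr fun x => by cases f x <;> rfl

end StackPolyTime

namespace ParetoCover

section Encodings

variable {α β : Type} [TreeCode α] [TreeCode β]

@[fun_prop]
theorem stackPolyTime_encNat {f : α → ℕ} (hf : StackPolyTime f) :
    StackPolyTime fun x => encNat (f x) := by
  simp only [encNat, encodeNat_eq_bits]
  fun_prop

/-- The code of a nonnegative fraction, given by its numerator and its denominator. -/
def encFrac (q : ℕ × ℕ) : List Γ' := Γ'.bit false :: (encNat q.1 ++ encNat q.2)

/-- The code of a list, in terms of the codes of its entries. -/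
def encList {τ : Type} (e : τ → List Γ') (l : List τ) : List Γ' :=
  Γ'.bra :: (l.flatMap e ++ [Γ'.ket])

/-- The code of a list of nonnegative fractions. -/
abbrev encFracs : List (ℕ × ℕ) → List Γ' := encList encFrac

/-- The code of a matrix of nonnegative fractions, given by its rows. -/
abbrev encMatrix : List (List (ℕ × ℕ)) → List Γ' := encList encFracs

@[fun_prop]
theorem stackPolyTime_encFrac {f : α → ℕ × ℕ} (hf : StackPolyTime f) :
    StackPolyTime fun x => encFrac (f x) := by
  unfold encFrac
  fun_prop

@[fun_prop]
theorem stackPolyTime_encList {f : α → List β} {e : β → List Γ'} (hf : StackPolyTime f)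
    (he : StackPolyTime e) : StackPolyTime fun x => encList e (f x) := by
  unfold encList
  fun_prop

theorem length_encList {τ : Type} (e : τ → List Γ') (l : List τ) :
    (encList e l).length = (l.map fun x => (e x).length).sum + 2 := by
  simp [encList, List.length_flatMap]

theorem length_encList_le {τ : Type} {e : τ → List Γ'} {l : List τ} {N : ℕ}
    (h : ∀ x ∈ l, (e x).length ≤ N) : (encList e l).length ≤ l.length * N + 2 := by
  have sum_le := List.sum_le_card_nsmul (l.map fun x => (e x).length) N (by simpa using h)
  rw [List.length_map, smul_eq_mul] at sum_le
  rw [length_encList]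
  omega

theorem length_le_length_encList {τ : Type} {e : τ → List Γ'} {l : List τ} {x : τ} (h : x ∈ l) :
    (e x).length ≤ (encList e l).length := by
  have le_sum := List.single_le_sum (l := l.map fun x => (e x).length) (by simp) _
    (List.mem_map_of_mem h)
  rw [length_encList]
  omega

theorem length_encFrac_pos (q : ℕ × ℕ) : 1 ≤ (encFrac q).length := by simp [encFrac]

theorem list_length_le_length_encList {τ : Type} {e : τ → List Γ'} {l : List τ}
    (he : ∀ x, 1 ≤ (e x).length) : l.length ≤ (encList e l).length := by
  have le_sum := List.card_nsmul_le_sum (l.map fun x => (e x).length) 1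
    (by simpa using fun x _ => he x)
  rw [List.length_map, smul_eq_mul, mul_one] at le_sum
  rw [length_encList]
  omega

end Encodings

/-! ### Parsing -/

/-- One step of the parser, which reads words from right to left. The stack holds the lists that
have not been completed yet, and a number is the list of its bits. -/
def parseStep : Γ' → List (List BinTree) → List (List BinTree)
  | .blank, _ => []
  | .bit b, st => (toTree (toTree b :: ((st.headD []).headD .leaf).asList) ::
      (st.headD []).tail) :: st.tail
  | .bra, st => (toTree (st.headD []) :: st.tail.headD []) :: st.tail.tail
  | .ket, st => [] :: st
  | .comma, st => (.leaf :: st.headD []) :: st.tail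

/-- The list of the items of a word. -/
def parse (w : List Γ') : List BinTree := (w.foldr parseStep [[]]).headD []

/-- The word `w` is the code of a sequence of items, whatever follows it. -/
def IsCodeOf (w : List Γ') (items : List BinTree) : Prop :=
  ∀ current rest, w.foldr parseStep (current :: rest) = (items ++ current) :: rest

theorem stackPolyTime_parse : StackPolyTime parse := by
  have step : StackPolyTime fun p : (List Γ' × List (List BinTree)) × Γ' => parseStep p.2 p.1.2 :=
    StackPolyTime.symbolCases
      (h := fun g (p : (List Γ' × List (List BinTree)) × Γ') => parseStep g p.1.2)
      (by fun_prop) fun g => by cases g <;> unfold parseStep <;> fun_prop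
  refine StackPolyTime.headD (StackPolyTime.foldr_of_step (g := fun _ => parseStep)
    StackPolyTime.id (.const [[]]) step 20 fun _ stack symbol _ => ?_) (.const [])
  have codeSize_leaf : codeSize BinTree.leaf = 1 := rfl
  have codeSize_toTree (l : List BinTree) : codeSize (toTree l) = codeSize l := rfl
  have codeSize_toTree_bool (b : Bool) : codeSize (toTree b) = 5 := codeSize_bool b
  cases symbol
  · simp [parseStep]
  · rcases stack with _ | ⟨_ | ⟨t, top⟩, rest⟩ <;>
      simp [parseStep, BinTree.asList, BinTree.codeSize_asList, codeSize_toTree,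
        codeSize_toTree_bool] <;> omega
  · rcases stack with _ | ⟨top, _ | ⟨next, rest⟩⟩ <;>
      simp [parseStep, codeSize_toTree] <;> omega
  · simp [parseStep]; omega
  · rcases stack with _ | ⟨top, rest⟩
    · simp [parseStep, codeSize_leaf]
    · simp [parseStep, codeSize_leaf]; omega

/-- The items of the code of a nonnegative fraction: the sign bit is read as a digit of the
numerator. -/
def fracItems (q : ℕ × ℕ) : List BinTree := [toTree (false :: q.1.bits), toTree q.2]

namespace IsCodeOf

theorem parse_eq {w : List Γ'} {items : List BinTree} (h : IsCodeOf w items) :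
    parse w = items := by
  rw [parse, h, List.append_nil]
  rfl

theorem append {v w : List Γ'} {items items' : List BinTree} (hv : IsCodeOf v items)
    (hw : IsCodeOf w items') : IsCodeOf (v ++ w) (items ++ items') := fun current rest => by
  rw [List.foldr_append, hw, hv, List.append_assoc]

theorem flatMap {τ : Type} {e : τ → List Γ'} {items : τ → List BinTree}
    (h : ∀ x, IsCodeOf (e x) (items x)) (l : List τ) :
    IsCodeOf (l.flatMap e) (l.flatMap items) := by
  induction l with
  | nil => exact fun _ _ => rfl
  | cons x l ih => exact (h x).append ih

theorem encList {τ : Type} {e : τ → List Γ'} {items : τ → List BinTree}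
    (h : ∀ x, IsCodeOf (e x) (items x)) (l : List τ) :
    IsCodeOf (encList e l) [toTree (l.flatMap items)] := fun current rest => by
  rw [ParetoCover.encList, List.foldr_cons, List.foldr_append]
  exact (congrArg (parseStep .bra) (flatMap h l [] (current :: rest))).trans (by simp [parseStep])

theorem foldr_parseStep_bits (l s : List Bool) (current : List BinTree)
    (rest : List (List BinTree)) :
    (l.map Γ'.bit).foldr parseStep ((toTree s :: current) :: rest) =
      (toTree (l ++ s) :: current) :: rest := by
  induction l with
  | nil => rfl
  | cons b l ih =>
    rw [List.map_cons, List.foldr_cons, ih]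
    change (BinTree.node (toTree b) (toTree (toTree (l ++ s)).asList) :: current) :: rest = _
    rw [BinTree.toTree_asList]
    rfl

theorem encNat (n : ℕ) : IsCodeOf (encNat n) [toTree n] := fun current rest => by
  rw [ParetoCover.encNat, encodeNat_eq_bits, List.foldr_append]
  refine (foldr_parseStep_bits n.bits [] current rest).trans ?_
  rw [List.append_nil]
  rfl

theorem encFrac (q : ℕ × ℕ) : IsCodeOf (encFrac q) (fracItems q) := fun current rest => by
  rw [ParetoCover.encFrac, List.foldr_cons, (encNat q.1).append (encNat q.2)]
  exact foldr_parseStep_bits [false] q.1.bits (toTree q.2 :: current) rest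

end IsCodeOf

/-- Join the items of the codes of nonnegative fractions in pairs. The state of the transducer is
the list of the numerators, at most one, that still lack a denominator. -/
def joinItems (items : List BinTree) : List (ℕ × ℕ) :=
  (transduce (fun numerators t => listCases numerators ([ofBits t.asBits.tail], [])
    fun n _ => ([], [(n, ofBits t.asBits)])) [] items).2

theorem joinItems_flatMap_fracItems (l : List (ℕ × ℕ)) :
    joinItems (l.flatMap fracItems) = l := by
  induction l with
  | nil => rfl
  | cons q l ih =>
    change (ofBits (toTree (false :: q.1.bits)).asBits.tail, ofBits (toTree q.2).asBits) ::
      joinItems (l.flatMap fracItems) = q :: l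
    rw [ih, BinTree.asBits_toTree, BinTree.asBits_toTree_nat, List.tail_cons, ofBits_bits,
      ofBits_bits]

theorem stackPolyTime_joinItems : StackPolyTime joinItems := by
  have step : StackPolyTime fun p : List ℕ × BinTree =>
      listCases p.1 (([ofBits p.2.asBits.tail], []) : List ℕ × List (ℕ × ℕ))
        fun n _ => ([], [(n, ofBits p.2.asBits)]) :=
    StackPolyTime.listCases (by fun_prop) (by fun_prop) (by fun_prop)
  refine (StackPolyTime.transduce step StackPolyTime.id (.const []) (6 * .X + 10)
    fun numerators t => ?_).comp_snd
  have asBits_le := BinTree.codeSize_asBits_le t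
  have tail_le := codeSize_le_of_isSuffix (List.tail_suffix t.asBits)
  have numerator_le := codeSize_ofBits_le t.asBits.tail
  have denominator_le := codeSize_ofBits_le t.asBits
  rcases numerators with _ | ⟨n, numerators⟩
  · simp; omega
  · simp; omega

/-- Read a list of fractions from the item that represents it. -/
def readFracs (t : BinTree) : List (ℕ × ℕ) := joinItems t.asList

/-- Read a matrix of fractions from the item that represents it. -/
def readMatrix (t : BinTree) : List (List (ℕ × ℕ)) := t.asList.map readFracs

@[fun_prop]
theorem stackPolyTime_readFracs : StackPolyTime readFracs :=
  stackPolyTime_joinItems.comp (by fun_prop)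

@[fun_prop]
theorem stackPolyTime_readMatrix : StackPolyTime readMatrix := by
  unfold readMatrix
  fun_prop

/-- The item that represents a list of fractions. -/
def fracsItem (l : List (ℕ × ℕ)) : BinTree := toTree (l.flatMap fracItems)

/-- The item that represents a matrix of fractions. -/
def matrixItem (A : List (List (ℕ × ℕ))) : BinTree := toTree (A.map fracsItem)

@[simp] theorem readFracs_fracsItem (l : List (ℕ × ℕ)) : readFracs (fracsItem l) = l := by
  rw [readFracs, fracsItem, BinTree.asList_toTree]
  exact (congrArg joinItems (List.map_id' _)).trans (joinItems_flatMap_fracItems l)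

@[simp] theorem readMatrix_matrixItem (A : List (List (ℕ × ℕ))) :
    readMatrix (matrixItem A) = A := by
  rw [readMatrix, matrixItem, BinTree.asList_toTree, List.map_map, List.map_map]
  exact List.map_id'' (fun l => readFracs_fracsItem l) A

theorem isCodeOf_encFracs (l : List (ℕ × ℕ)) : IsCodeOf (encFracs l) [fracsItem l] :=
  IsCodeOf.encList IsCodeOf.encFrac l

theorem isCodeOf_encMatrix (A : List (List (ℕ × ℕ))) : IsCodeOf (encMatrix A) [matrixItem A] := by
  rw [matrixItem, List.map_eq_flatMap]
  exact IsCodeOf.encList isCodeOf_encFracs A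

end ParetoCover

namespace ParetoCover

/-! ### Polynomial time and NP on words -/

theorem polyTime_of_stackPolyTime_words {α β : Type} {ea : α → List Γ'} {eb : β → List Γ'}
    {f : α → β} {F : List Γ' → List Γ'} (hF : StackPolyTime F) (h : ∀ x, F (ea x) = eb (f x)) :
    PolyTime ea eb f := by
  have decode : StackPolyTime fun l : List (Fin 6) => l.map symbolEquiv.symm :=
    .map .id ((StackPolyTime.of_fin symbolEquiv.symm).comp .snd)
  refine polyTime_of_stackPolyTime symbolEquiv symbolEquiv
    (F := fun l => (F (l.map symbolEquiv.symm)).map symbolEquiv)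
    (.map (hF.comp decode) (.symbolEquiv .snd)) fun x => ?_
  rw [List.map_map, Equiv.symm_comp_self, List.map_id, h]

/-- A numbering of the disjoint union of the alphabets of words and certificates. -/
noncomputable def sumSymbolEquiv : Γ' ⊕ Bool ≃ Fin 8 := Fintype.equivFinOfCardEq rfl

theorem polyTime_of_stackPolyTime_verifier {V : List Γ' × List Bool → Bool}
    (hV : StackPolyTime V) :
    PolyTime (encodingProd (encodingList Γ') (encodingList Bool)).encode encodeBool V := by
  let word (j : Fin 8) : List Γ' := Sum.elim (fun g => [g]) (fun _ => []) (sumSymbolEquiv.symm j)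
  let bits (j : Fin 8) : List Bool := Sum.elim (fun _ => []) (fun b => [b]) (sumSymbolEquiv.symm j)
  have split : StackPolyTime fun l : List (Fin 8) => (l.flatMap word, l.flatMap bits) :=
    .pair (.flatMap .id ((StackPolyTime.of_fin word).comp .snd))
      (.flatMap .id ((StackPolyTime.of_fin bits).comp .snd))
  have output : StackPolyTime fun b : Bool => [finTwoEquiv.symm b] :=
    (StackPolyTime.ite .id (.const [1]) (.const [0])).congr fun b => by cases b <;> rfl
  refine polyTime_of_stackPolyTime sumSymbolEquiv finTwoEquiv.symm
    (F := fun l => [finTwoEquiv.symm (V (l.flatMap word, l.flatMap bits))])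
    (output.comp (hV.comp split)) fun ⟨w, u⟩ => ?_
  have encode_eq : (encodingProd (encodingList Γ') (encodingList Bool)).encode (w, u) =
      w.map Sum.inl ++ u.map Sum.inr := rfl
  have word_eq : ((w.map Sum.inl ++ u.map Sum.inr).map sumSymbolEquiv).flatMap word = w := by
    simp [word, List.flatMap_map, List.flatMap_append]
  have bits_eq : ((w.map Sum.inl ++ u.map Sum.inr).map sumSymbolEquiv).flatMap bits = u := by
    simp [bits, List.flatMap_map, List.flatMap_append]
  rw [encode_eq, word_eq, bits_eq]
  rfl

/-- The unary code of a symbol, terminated by `false`. -/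
noncomputable def symbolBits (g : Γ') : List Bool :=
  List.replicate (symbolEquiv g) true ++ [false]

/-- The word with a given concatenation of unary codes; the state counts the bits `true`. -/
noncomputable def decodeWord (u : List Bool) : List Γ' :=
  (transduce (fun j b => if b = true then (j + 1, []) else ((0 : Fin 6), [symbolEquiv.symm j]))
    0 u).2

theorem length_flatMap_symbolBits_le (w : List Γ') :
    (w.flatMap symbolBits).length ≤ 6 * w.length := by
  induction w with
  | nil => simp
  | cons g w ih =>
    rw [List.flatMap_cons, List.length_append, symbolBits, List.length_append,
      List.length_replicate, List.length_singleton, List.length_cons]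
    omega

theorem decodeWord_flatMap_symbolBits (w : List Γ') : decodeWord (w.flatMap symbolBits) = w := by
  have read_symbol (j : Fin 6) (u : List Bool) :
      decodeWord (List.replicate j true ++ false :: u) = symbolEquiv.symm j :: decodeWord u := by
    fin_cases j <;> rfl
  induction w with
  | nil => rfl
  | cons g w ih =>
    rw [List.flatMap_cons, symbolBits, List.append_assoc, List.singleton_append, read_symbol, ih,
      Equiv.symm_apply_apply]

theorem stackPolyTime_decodeWord : StackPolyTime decodeWord := by
  have step : StackPolyTime fun p : Fin 6 × Bool =>
      if p.2 = true then (p.1 + 1, []) else ((0 : Fin 6), [symbolEquiv.symm p.1]) :=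
    .ite .snd ((StackPolyTime.of_fin fun j => (j + 1, [])).comp .fst)
      ((StackPolyTime.of_fin fun j => (0, [symbolEquiv.symm j])).comp .fst)
  refine (StackPolyTime.transduce step .id (.const 0) 30 fun j b => ?_).comp_snd
  have symbol_le (g : Γ') : codeSize g ≤ 11 :=
    (codeSize_fin (symbolEquiv g)).trans_le (by omega)
  have next_le := (j + 1).isLt
  cases b
  · have := symbol_le (symbolEquiv.symm j)
    simp; omega
  · simp; omega

theorem inNP_of_stackPolyTime_verifier {L : Language Γ'} {V : List Γ' × List Γ' → Bool}
    (hV : StackPolyTime V) (h_sound : ∀ w v, V (w, v) = true → w ∈ L) (q : Polynomial ℕ)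
    (h_complete : ∀ w ∈ L, ∃ v, v.length ≤ q.eval w.length ∧ V (w, v) = true) : InNP L := by
  refine ⟨6 * q, fun x => V (x.1, decodeWord x.2), polyTime_of_stackPolyTime_verifier
    (hV.comp (.pair .fst (stackPolyTime_decodeWord.comp .snd))), fun w => ⟨fun hw => ?_, ?_⟩⟩
  · obtain ⟨v, length_le, accepted⟩ := h_complete w hw
    refine ⟨v.flatMap symbolBits, (length_flatMap_symbolBits_le v).trans ?_, ?_⟩
    · rw [Polynomial.eval_mul, Polynomial.eval_ofNat]
      exact Nat.mul_le_mul_left 6 length_le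
    · change V (w, decodeWord (v.flatMap symbolBits)) = true
      rwa [decodeWord_flatMap_symbolBits]
  · rintro ⟨u, -, accepted⟩
    exact h_sound w _ accepted

end ParetoCover

theorem StackPolyTime.getD {α β : Type} [TreeCode α] [TreeCode β] {f : α → List β} {d : α → β}
    (hf : StackPolyTime f) (hd : StackPolyTime d) (j : ℕ) :
    StackPolyTime fun x => (f x).getD j (d x) := by
  induction j generalizing f with
  | zero => exact (hf.headD hd).congr fun x => by cases f x <;> rfl
  | succ j ih => exact (ih hf.tail).congr fun x => by cases f x <;> rfl

namespace ParetoCover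

/-! ### Computing the expected cost of a cover -/

namespace Fraction

/-- The absolute value of a fraction, as a numerator and a denominator. -/
def natPair (q : Fraction) : ℕ × ℕ := (q.num.natAbs, q.den)

theorem num_nonneg {q : Fraction} (h : 0 ≤ q.val) : 0 ≤ q.num := by
  have den_pos : (0 : ℝ) < q.den := by exact_mod_cast q.den_pos
  by_contra! num_neg
  exact h.not_gt (div_neg_of_neg_of_pos (by exact_mod_cast num_neg) den_pos)

theorem fracVal_natPair {q : Fraction} (h : 0 ≤ q.val) : fracVal q.natPair = q.val := by
  rw [fracVal, natPair, val, Nat.cast_natAbs, abs_of_nonneg (num_nonneg h)]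

theorem encFraction_eq {q : Fraction} (h : 0 ≤ q.val) : encFraction q = encFrac q.natPair := by
  have nonnegative : decide (q.num < 0) = false := by simpa using num_nonneg h
  rw [encFraction, encInt, nonnegative]
  rfl

/-- The fraction with given numerator and denominator. -/
def ofNatPair (q : ℕ × ℕ) (h : 0 < q.2) : Fraction := ⟨q.1, q.2, h⟩

@[simp] theorem natPair_ofNatPair (q : ℕ × ℕ) (h : 0 < q.2) : (ofNatPair q h).natPair = q := rfl

@[simp] theorem val_ofNatPair (q : ℕ × ℕ) (h : 0 < q.2) : (ofNatPair q h).val = fracVal q := by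
  simp only [ofNatPair, val, fracVal, Int.cast_natCast]

end Fraction

theorem encFamily_eq_encList {α τ : Type} {m : ℕ} {e : α → List Γ'} {e' : τ → List Γ'}
    {v : Fin m → α} {v' : Fin m → τ} (h : ∀ i, e (v i) = e' (v' i)) :
    encFamily e v = encList e' (List.ofFn v') := by
  have map_eq : (List.ofFn v).map e = (List.ofFn v').map e' := by
    rw [List.map_ofFn, List.map_ofFn]
    exact congrArg _ (funext h)
  rw [encFamily, encList, List.flatMap_def, List.flatMap_def, map_eq]

theorem encFamily_encFraction {m : ℕ} {v : Fin m → Fraction} (h : ∀ i, 0 ≤ (v i).val) :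
    encFamily encFraction v = encFracs (List.ofFn fun i => (v i).natPair) :=
  encFamily_eq_encList fun i => Fraction.encFraction_eq (h i)

theorem encFamily_encFamily_encFraction {m n : ℕ} {v : Fin m → Fin n → Fraction}
    (h : ∀ i j, 0 ≤ (v i j).val) : encFamily (encFamily encFraction) v =
      encMatrix (List.ofFn fun i => List.ofFn fun j => (v i j).natPair) :=
  encFamily_eq_encList fun i => encFamily_encFraction (h i)

namespace DiscreteInstance

variable (I : DiscreteInstance)

/-- The grid points of an instance, as a list of fractions. -/
def points : List (ℕ × ℕ) := List.ofFn fun j => (I.a j).natPair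

/-- The probabilities of an instance, as a matrix of fractions. -/
def probs : List (List (ℕ × ℕ)) := List.ofFn fun i => List.ofFn fun j => (I.p i j).natPair

/-- The costs of an instance, as a list of fractions. -/
def costs : List (ℕ × ℕ) := List.ofFn fun i => (I.c i).natPair

theorem a_nonneg (j : Fin (I.M + 2)) : 0 ≤ (I.a j).val :=
  I.a_zero.symm.le.trans (I.a_strictMono.monotone (Fin.zero_le j))

theorem encDiscrete_eq :
    encDiscrete I = encFracs I.points ++ encMatrix I.probs ++ encFracs I.costs := by
  rw [encDiscrete, encFamily_encFraction I.a_nonneg,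
    encFamily_encFamily_encFraction fun i j => (I.p_mem i j).1, encFamily_encFraction I.c_nonneg]
  rfl

theorem measure_eq : I.measure = discreteMeasure (fun j => fracVal (I.a j).natPair)
    fun i j => fracVal (I.p i j).natPair := by
  simp only [Fraction.fracVal_natPair (I.a_nonneg _), Fraction.fracVal_natPair (I.p_mem _ _).1]
  rfl

theorem cost_eq : I.cost = fun i => fracVal (I.c i).natPair :=
  funext fun i => (Fraction.fracVal_natPair (I.c_nonneg i)).symm

theorem sum_fracVal_p (i : Fin I.n) : ∑ j, fracVal (I.p i j).natPair = 1 := by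
  simp only [Fraction.fracVal_natPair (I.p_mem _ _).1, I.p_sum]

end DiscreteInstance

namespace CoverInstance

variable {k : ℕ} (I : CoverInstance k)

/-- The points of the cover of an instance, as a matrix of fractions. -/
def coverPoints : List (List (ℕ × ℕ)) := List.ofFn fun l => List.ofFn fun i => (I.b l i).natPair

theorem b_nonneg (l : Fin k) (i : Fin I.n) : 0 ≤ (I.b l i).val := by
  obtain ⟨j, grid_point⟩ := I.b_grid l i
  exact grid_point ▸ I.a_nonneg j

theorem encCover_eq : encCover I = encFracs I.points ++ encMatrix I.probs ++ encFracs I.costs ++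
    encMatrix I.coverPoints := by
  rw [encCover, I.encDiscrete_eq, encFamily_encFamily_encFraction I.b_nonneg]
  rfl

/-- The expected cost of the cover of an instance, as a numerator and a denominator. -/
noncomputable def costPair : ℕ × ℕ :=
  expectedCostFrac k I.points I.probs I.costs I.coverPoints

theorem costPair_snd_pos : 0 < I.costPair.2 :=
  expectedCostFrac_snd_pos (fun i j => (I.p i j).den_pos) I.sum_fracVal_p
    (fun i => (I.c i).den_pos) fun l i => (I.b l i).den_pos

theorem expectedCost_eq :
    expectedCost I.measure I.cost I.cover = ENNReal.ofReal (fracVal I.costPair) := by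
  have cover_eq : I.cover = Set.range fun l i => fracVal (I.b l i).natPair := by
    simp only [CoverInstance.cover, Fraction.fracVal_natPair (I.b_nonneg _ _)]
  have covers : IsParetoCover I.measure I.cover := I.b_cover
  rw [cover_eq, I.measure_eq] at covers
  rw [cover_eq, I.measure_eq, I.cost_eq]
  exact expectedCost_eq_fracVal_expectedCostFrac (fun j => (I.a j).den_pos)
    (fun i j => (I.p i j).den_pos) I.sum_fracVal_p (fun i => (I.c i).den_pos)
    (fun l i => (I.b l i).den_pos) covers

end CoverInstance

section Readers

/-- The grid points in the code of a cover instance. -/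
def readPoints (w : List Γ') : List (ℕ × ℕ) := readFracs ((parse w).getD 0 .leaf)

/-- The probabilities in the code of a cover instance. -/
def readProbs (w : List Γ') : List (List (ℕ × ℕ)) := readMatrix ((parse w).getD 1 .leaf)

/-- The costs in the code of a cover instance. -/
def readCosts (w : List Γ') : List (ℕ × ℕ) := readFracs ((parse w).getD 2 .leaf)

/-- The points of the cover in the code of a cover instance. -/
def readCover (w : List Γ') : List (List (ℕ × ℕ)) := readMatrix ((parse w).getD 3 .leaf)

theorem stackPolyTime_getD_parse (j : ℕ) : StackPolyTime fun w => (parse w).getD j .leaf :=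
  stackPolyTime_parse.getD (.const .leaf) j

@[fun_prop]
theorem stackPolyTime_readPoints : StackPolyTime readPoints :=
  stackPolyTime_readFracs.comp (stackPolyTime_getD_parse 0)

@[fun_prop]
theorem stackPolyTime_readProbs : StackPolyTime readProbs :=
  stackPolyTime_readMatrix.comp (stackPolyTime_getD_parse 1)

@[fun_prop]
theorem stackPolyTime_readCosts : StackPolyTime readCosts :=
  stackPolyTime_readFracs.comp (stackPolyTime_getD_parse 2)

@[fun_prop]
theorem stackPolyTime_readCover : StackPolyTime readCover :=
  stackPolyTime_readMatrix.comp (stackPolyTime_getD_parse 3)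

theorem isCodeOf_cover_data (a : List (ℕ × ℕ)) (p : List (List (ℕ × ℕ))) (c : List (ℕ × ℕ))
    (b : List (List (ℕ × ℕ))) :
    IsCodeOf (encFracs a ++ encMatrix p ++ encFracs c ++ encMatrix b)
      [fracsItem a, matrixItem p, fracsItem c, matrixItem b] :=
  (((isCodeOf_encFracs a).append (isCodeOf_encMatrix p)).append (isCodeOf_encFracs c)).append
    (isCodeOf_encMatrix b)

end Readers

theorem exists_polyTime_expectedCost (k : ℕ) : ∃ f : CoverInstance k → Fraction,
    PolyTime encCover encFraction f ∧ ∀ I : CoverInstance k,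
      ((expectedCost I.measure I.cost I.cover : ENNReal) : EReal) = ((f I).val : EReal) := by
  refine ⟨fun I => .ofNatPair I.costPair I.costPair_snd_pos, ?_, fun I => ?_⟩
  · refine polyTime_of_stackPolyTime_words (F := fun w => encFrac (expectedCostFrac k (readPoints w)
      (readProbs w) (readCosts w) (readCover w))) (by fun_prop) fun I => ?_
    have items := (isCodeOf_cover_data I.points I.probs I.costs I.coverPoints).parse_eq
    rw [← I.encCover_eq] at items
    rw [Fraction.encFraction_eq (by simpa using fracVal_nonneg _), Fraction.natPair_ofNatPair]
    simp [readPoints, readProbs, readCosts, readCover, items, CoverInstance.costPair]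
  · rw [I.expectedCost_eq, Fraction.val_ofNatPair, EReal.coe_ennreal_ofReal,
      max_eq_left (fracVal_nonneg _)]

end ParetoCover

/-! ### Cheap covers by grid points -/

namespace ParetoCover

section Mono

variable {n : ℕ} {μ : Measure (Fin n → ℝ)} {B B' : Set (Fin n → ℝ)}

theorem IsParetoCover.mono [IsProbabilityMeasure μ] (h : IsParetoCover μ B) (hB : B ⊆ B') :
    IsParetoCover μ B' :=
  le_antisymm prob_le_one <| h.ge.trans <| measure_mono fun _ ⟨b, hb, hx⟩ => ⟨b, hB hb, hx⟩

theorem expectedCost_anti (μ : Measure (Fin n → ℝ)) (c : Fin n → ℝ) (hB : B ⊆ B') :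
    expectedCost μ c B' ≤ expectedCost μ c B :=
  lintegral_mono fun _ => biInf_mono hB

end Mono

theorem coe_ennreal_le_coe_real_iff (x : ℝ≥0∞) (γ : ℝ) :
    (x : EReal) ≤ (γ : EReal) ↔ 0 ≤ γ ∧ x ≤ ENNReal.ofReal γ := by
  have coe_le_iff (nonneg : 0 ≤ γ) : (x : EReal) ≤ (γ : EReal) ↔ x ≤ ENNReal.ofReal γ := by
    rw [← EReal.coe_ennreal_le_coe_ennreal_iff, EReal.coe_ennreal_ofReal, max_eq_left nonneg]
  refine ⟨fun h => ?_, fun ⟨nonneg, h⟩ => (coe_le_iff nonneg).2 h⟩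
  have nonneg : 0 ≤ γ := EReal.coe_nonneg.1 ((EReal.coe_ennreal_nonneg x).trans h)
  exact ⟨nonneg, (coe_le_iff nonneg).1 h⟩

/-- Only for `n = 0` and `1 < k` does the cube `[0,1]^n` have fewer than `k` points. -/
theorem exists_superset_ncard_eq_of_subset_cube {n k : ℕ} (hn : n ≠ 0 ∨ k = 1)
    {B : Set (Fin n → ℝ)} (hB : B ⊆ Set.Icc 0 1) (h_fin : B.Finite) (h_ne : B.Nonempty)
    (h_card : B.ncard ≤ k) : ∃ B' : Set (Fin n → ℝ), B ⊆ B' ∧ B' ⊆ Set.Icc 0 1 ∧ B'.ncard = k := by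
  rcases hn with hn | rfl
  · have : NeZero n := ⟨hn⟩
    exact (Set.Icc_infinite zero_lt_one).exists_superset_ncard_eq hB h_fin h_card
  · exact ⟨B, subset_rfl, hB, h_card.antisymm ((Set.ncard_pos h_fin).2 h_ne)⟩

theorem hasCheapCover_of_range {n k : ℕ} {μ : Measure (Fin n → ℝ)} [IsProbabilityMeasure μ]
    {c : Fin n → ℝ} {γ : ℝ} (hγ : 0 ≤ γ) (hk : 1 ≤ k) (hn : n ≠ 0 ∨ k = 1)
    {y : Fin k → Fin n → ℝ} (hy : ∀ l, y l ∈ Set.Icc 0 1)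
    (h_cover : IsParetoCover μ (Set.range y))
    (h_cost : expectedCost μ c (Set.range y) ≤ ENNReal.ofReal γ) : HasCheapCover k μ c γ := by
  have : NeZero k := ⟨by omega⟩
  have card_le : (Set.range y).ncard ≤ k := by
    rw [← Set.image_univ]
    simpa using Set.ncard_image_le (f := y) Set.finite_univ
  obtain ⟨B, range_subset, subset_cube, card_eq⟩ := exists_superset_ncard_eq_of_subset_cube hn
    (Set.range_subset_iff.2 hy) (Set.finite_range y) (Set.range_nonempty y) card_le
  have finite : B.Finite := Set.finite_of_ncard_ne_zero (by omega)
  refine ⟨finite.toFinset, fun b hb => subset_cube (by simpa using hb), ?_, ?_, ?_⟩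
  · rw [← card_eq, Set.ncard_eq_toFinset_card B finite]
  · rw [finite.coe_toFinset]
    exact h_cover.mono range_subset
  · rw [finite.coe_toFinset, coe_ennreal_le_coe_real_iff]
    exact ⟨hγ, (expectedCost_anti μ c range_subset).trans h_cost⟩

theorem HasCheapCover.nonneg {n k : ℕ} {μ : Measure (Fin n → ℝ)} {c : Fin n → ℝ} {γ : ℝ}
    (h : HasCheapCover k μ c γ) : 0 ≤ γ := by
  obtain ⟨B, -, -, -, cost_le⟩ := h
  exact ((coe_ennreal_le_coe_real_iff _ _).1 cost_le).1

theorem HasCheapCover.ne_zero_or_eq_one {n k : ℕ} {μ : Measure (Fin n → ℝ)} {c : Fin n → ℝ}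
    {γ : ℝ} (hk : 1 ≤ k) (h : HasCheapCover k μ c γ) : n ≠ 0 ∨ k = 1 := by
  obtain ⟨B, -, card_eq, -⟩ := h
  by_contra! hn
  obtain ⟨rfl, k_ne_one⟩ := hn
  have := Finset.card_le_one_of_subsingleton B
  omega

theorem exists_greatest_grid_le {ι J α : Type*} [Finite J] [LinearOrder α] {a : J → α} {y : ι → α}
    (hy : ∀ i, ∃ j, a j ≤ y i) :
    ∃ g : ι → J, ∀ x : ι → J, (fun i => a (x i)) ≤ y ↔ (fun i => a (x i)) ≤ fun i => a (g i) := by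
  have greatest (i : ι) : ∃ j, a j ≤ y i ∧ ∀ j', a j' ≤ y i → a j' ≤ a j := by
    obtain ⟨j, le, max⟩ := Set.exists_max_image {j | a j ≤ y i} a (Set.toFinite _) (hy i)
    exact ⟨j, le, max⟩
  choose g g_le g_max using greatest
  exact ⟨g, fun x => ⟨fun h i => g_max i _ (h i), fun h i => (h i).trans (g_le i)⟩⟩

section Rounding

variable {n M k : ℕ} {a : Fin (M + 2) → ℝ} {p : Fin n → Fin (M + 2) → ℝ}
  {y y' : Fin k → Fin n → ℝ}
  (h : ∀ (x : Fin n → Fin (M + 2)) l, (fun i => a (x i)) ≤ y l ↔ (fun i => a (x i)) ≤ y' l)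

include h in
theorem isParetoCover_discreteMeasure_congr : IsParetoCover (discreteMeasure a p) (Set.range y) ↔
    IsParetoCover (discreteMeasure a p) (Set.range y') := by
  classical
  simp only [IsParetoCover, discreteMeasure_apply, Set.indicator_apply, Set.mem_ofPred_eq,
    Set.exists_range_iff, h]

include h in
theorem expectedCost_discreteMeasure_mono {c : Fin n → ℝ} (hc : 0 ≤ c) (h_le : y' ≤ y) :
    expectedCost (discreteMeasure a p) c (Set.range y') ≤
      expectedCost (discreteMeasure a p) c (Set.range y) := by
  simp only [expectedCost, lintegral_discreteMeasure, coverCost_range, h]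
  gcongr with x _ l _ i _
  · exact hc i
  · exact h_le l i

end Rounding

/-- Rounding the points of a cover down to the grid does not change which grid points they cover. -/
theorem HasCheapCover.exists_grid {n M k : ℕ} {a : Fin (M + 2) → ℝ} (ha : a 0 = 0)
    {p : Fin n → Fin (M + 2) → ℝ} {c : Fin n → ℝ} (hc : 0 ≤ c) {γ : ℝ}
    (h : HasCheapCover k (discreteMeasure a p) c γ) :
    ∃ g : Fin k → Fin n → Fin (M + 2),
      IsParetoCover (discreteMeasure a p) (Set.range fun l i => a (g l i)) ∧
      expectedCost (discreteMeasure a p) c (Set.range fun l i => a (g l i)) ≤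
        ENNReal.ofReal γ := by
  obtain ⟨B, subset_cube, card_eq, cover, cost_le⟩ := h
  let e : Fin k ≃ B := (B.equivFinOfCardEq card_eq).symm
  have range_eq : (B : Set (Fin n → ℝ)) = Set.range fun l => (e l : Fin n → ℝ) := by
    rw [Set.range_comp' Subtype.val e, e.range_eq_univ, Set.image_univ, Subtype.range_coe]
  rw [range_eq] at cover cost_le
  choose g le_iff using fun l => exists_greatest_grid_le (a := a) (y := (e l : Fin n → ℝ))
    fun i => ⟨0, ha.trans_le ((subset_cube _ (e l).2).1 i)⟩
  refine ⟨g, (isParetoCover_discreteMeasure_congr fun x l => le_iff l x).1 cover, ?_⟩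
  exact (expectedCost_discreteMeasure_mono (fun x l => le_iff l x) hc
    fun l => (le_iff l (g l)).2 le_rfl).trans ((coe_ennreal_le_coe_real_iff _ _).1 cost_le).2

end ParetoCover

/-! ### Checking cheap covers -/

namespace ParetoCover

/-- The fractions of a list increase strictly from zero to one. -/
def isGrid (a : List (ℕ × ℕ)) : Bool :=
  decide (2 ≤ a.length) && a.all (fun q => decide (0 < q.2)) &&
  decide ((a.headD (0, 1)).1 = 0) &&
  decide ((a.reverse.headD (0, 1)).1 = (a.reverse.headD (0, 1)).2) &&
  (a.zip a.tail).all fun q => !fracLE q.2 q.1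

/-- The fractions of a list are the probabilities of `N` outcomes. -/
def isDistribution (N : ℕ) (r : List (ℕ × ℕ)) : Bool :=
  decide (r.length = N) && r.all (fun q => decide (0 < q.2)) &&
  decide ((fracSum r).1 = (fracSum r).2)

/-- The fractions of a list are the coordinates of a point of `[0,1]^n`. -/
def isCubePoint (n : ℕ) (r : List (ℕ × ℕ)) : Bool :=
  decide (r.length = n) && r.all fun q => decide (0 < q.2) && decide (q.1 ≤ q.2)

/-- Lists of fractions are the data `(a, p, c)` of a discrete instance. -/
def isDiscreteInstance (a : List (ℕ × ℕ)) (p : List (List (ℕ × ℕ))) (c : List (ℕ × ℕ)) : Bool :=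
  isGrid a && decide (p.length = c.length) && p.all (isDistribution a.length) &&
  c.all fun q => decide (0 < q.2)

/-- The rows of `b` form a Pareto cover with expected cost at most `γ` of the instance `(a, p, c)`.
There are `k` rows, possibly with repetitions; the test on `c` ensures that they can be completed
to a set of `k` points. -/
noncomputable def isCheapCover (k : ℕ) (a : List (ℕ × ℕ)) (p : List (List (ℕ × ℕ)))
    (c : List (ℕ × ℕ)) (γ : ℕ × ℕ) (b : List (List (ℕ × ℕ))) : Bool :=
  isDiscreteInstance a p c && decide (0 < γ.2) && decide (b.length = k) &&
  b.all (isCubePoint c.length) && (!decide (c.length = 0) || decide (k = 1)) &&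
  decide (uncoveredWeight k a p b = 0) && fracLE (expectedCostFrac k a p c b) γ

section PolynomialTime

variable {α : Type} [TreeCode α] {a c : α → List (ℕ × ℕ)} {p b : α → List (List (ℕ × ℕ))}
  {γ : α → ℕ × ℕ}

@[fun_prop]
theorem stackPolyTime_isDiscreteInstance (ha : StackPolyTime a) (hp : StackPolyTime p)
    (hc : StackPolyTime c) : StackPolyTime fun x => isDiscreteInstance (a x) (p x) (c x) := by
  unfold isDiscreteInstance isGrid isDistribution fracSum
  fun_prop

@[fun_prop]
theorem stackPolyTime_isCheapCover (k : ℕ) (ha : StackPolyTime a) (hp : StackPolyTime p)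
    (hc : StackPolyTime c) (hγ : StackPolyTime γ) (hb : StackPolyTime b) :
    StackPolyTime fun x => isCheapCover k (a x) (p x) (c x) (γ x) (b x) := by
  have uncovered := stackPolyTime_uncoveredWeight k ha hp hb
  have cost := stackPolyTime_expectedCostFrac k ha hp hc hb
  unfold isCheapCover isCubePoint
  exact .and (.and (by fun_prop) (uncovered.natEq (.const 0))) (stackPolyTime_fracLE cost hγ)

end PolynomialTime

section Fractions

variable {q : ℕ × ℕ} (hq : 0 < q.2)

include hq

theorem fracVal_eq_zero_iff : fracVal q = 0 ↔ q.1 = 0 := by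
  have den_ne_zero : (q.2 : ℝ) ≠ 0 := by exact_mod_cast hq.ne'
  simp [fracVal, den_ne_zero]

theorem fracVal_eq_one_iff : fracVal q = 1 ↔ q.1 = q.2 := by
  rw [fracVal, div_eq_one_iff_eq (by exact_mod_cast hq.ne'), Nat.cast_inj]

theorem fracVal_le_one_iff : fracVal q ≤ 1 ↔ q.1 ≤ q.2 := by
  rw [fracVal, div_le_one (by exact_mod_cast hq), Nat.cast_le]

end Fractions

section Lists

variable {τ : Type} {m : ℕ}

theorem all_ofFn_iff (v : Fin m → τ) (P : τ → Bool) :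
    (List.ofFn v).all P = true ↔ ∀ i, P (v i) = true := by
  rw [List.all_eq_true, forall_mem_ofFn_iff]

theorem zip_tail_ofFn (v : Fin (m + 1) → τ) : (List.ofFn v).zip (List.ofFn v).tail =
    List.ofFn fun j : Fin m => (v j.castSucc, v j.succ) := by
  rw [List.ofFn_succ, List.tail_cons]
  apply List.ext_getElem
  · simp
  · rintro (_ | j) _ _ <;> simp

theorem headD_ofFn (v : Fin (m + 1) → τ) (d : τ) : (List.ofFn v).headD d = v 0 := by
  rw [List.ofFn_succ, List.headD_cons]

theorem headD_reverse_ofFn (v : Fin (m + 1) → τ) (d : τ) :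
    (List.ofFn v).reverse.headD d = v (Fin.last m) := by
  rw [List.ofFn_succ', List.concat_eq_append, List.reverse_append]
  rfl

theorem exists_eq_ofFn {l : List τ} (h : l.length = m) : ∃ v : Fin m → τ, l = List.ofFn v := by
  subst h
  exact ⟨l.get, (List.ofFn_get l).symm⟩

theorem exists_eq_ofFn_ofFn {l : List (List τ)} {m' : ℕ} (h : l.length = m)
    (h' : ∀ r ∈ l, r.length = m') :
    ∃ v : Fin m → Fin m' → τ, l = List.ofFn fun i => List.ofFn (v i) := by
  obtain ⟨v, rfl⟩ := exists_eq_ofFn h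
  choose w hw using fun i => exists_eq_ofFn (h' (v i) (List.mem_ofFn.2 ⟨i, rfl⟩))
  exact ⟨w, congrArg _ (funext hw)⟩

end Lists

theorem isGrid_ofFn_iff {M : ℕ} {a : Fin (M + 2) → ℕ × ℕ} :
    isGrid (List.ofFn a) = true ↔ (∀ j, 0 < (a j).2) ∧ fracVal (a 0) = 0 ∧
      fracVal (a (Fin.last (M + 1))) = 1 ∧ StrictMono fun j => fracVal (a j) := by
  simp only [isGrid, Bool.and_eq_true, all_ofFn_iff, zip_tail_ofFn, headD_ofFn,
    headD_reverse_ofFn, decide_eq_true_iff, List.length_ofFn, Nat.le_add_left, true_and, and_assoc]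
  refine and_congr_right fun den_pos => ?_
  rw [fracVal_eq_zero_iff (den_pos _), fracVal_eq_one_iff (den_pos _), Fin.strictMono_iff_lt_succ]
  simp only [Bool.not_eq_true', ← Bool.not_eq_true, fracLE_iff (den_pos _) (den_pos _), not_le]

theorem isDistribution_ofFn_iff {N : ℕ} {r : Fin N → ℕ × ℕ} :
    isDistribution N (List.ofFn r) = true ↔ (∀ j, 0 < (r j).2) ∧ ∑ j, fracVal (r j) = 1 := by
  simp only [isDistribution, Bool.and_eq_true, all_ofFn_iff, decide_eq_true_iff,
    List.length_ofFn, true_and]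
  refine and_congr_right fun den_pos => ?_
  have h_den : ∀ q ∈ List.ofFn r, 0 < q.2 := forall_mem_ofFn_iff.2 den_pos
  have sum_eq := fracVal_fracSum h_den
  rw [List.map_ofFn, List.sum_ofFn] at sum_eq
  exact (fracVal_eq_one_iff (clearDenominators_snd_pos h_den)).symm.trans (by rw [sum_eq]; rfl)

theorem isCubePoint_ofFn_iff {n : ℕ} {r : Fin n → ℕ × ℕ} :
    isCubePoint n (List.ofFn r) = true ↔ ∀ i, 0 < (r i).2 ∧ fracVal (r i) ≤ 1 := by
  simp only [isCubePoint, Bool.and_eq_true, all_ofFn_iff, decide_eq_true_iff,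
    List.length_ofFn, true_and]
  exact forall_congr' fun i => and_congr_right fun den_pos => (fracVal_le_one_iff den_pos).symm

namespace DiscreteInstance

theorem isDiscreteInstance_data (I : DiscreteInstance) :
    isDiscreteInstance I.points I.probs I.costs = true := by
  have grid : isGrid I.points = true := by
    refine isGrid_ofFn_iff.2 ⟨fun j => (I.a j).den_pos, ?_⟩
    simp only [Fraction.fracVal_natPair (I.a_nonneg _)]
    exact ⟨I.a_zero, I.a_last, I.a_strictMono⟩
  have distributions (i : Fin I.n) : isDistribution I.points.length
      (List.ofFn fun j => (I.p i j).natPair) = true := by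
    rw [points, List.length_ofFn]
    exact isDistribution_ofFn_iff.2 ⟨fun j => (I.p i j).den_pos, I.sum_fracVal_p i⟩
  simp only [isDiscreteInstance, grid, probs, costs, all_ofFn_iff, distributions, Bool.and_eq_true,
    decide_eq_true_iff, List.length_ofFn, and_self, implies_true, true_and]
  exact fun i => (I.c i).den_pos

theorem exists_of_isDiscreteInstance {a c : List (ℕ × ℕ)} {p : List (List (ℕ × ℕ))}
    (h : isDiscreteInstance a p c = true) :
    ∃ I : DiscreteInstance, I.points = a ∧ I.probs = p ∧ I.costs = c := by
  simp only [isDiscreteInstance, Bool.and_eq_true, decide_eq_true_iff] at h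
  obtain ⟨⟨⟨grid, length_p⟩, distributions⟩, c_pos⟩ := h
  have length_a : 2 ≤ a.length := by
    simp only [isGrid, Bool.and_eq_true, decide_eq_true_iff, and_assoc] at grid
    exact grid.1
  have length_rows : ∀ r ∈ p, r.length = a.length := fun r hr => by
    have distribution := List.all_eq_true.1 distributions r hr
    simp only [isDistribution, Bool.and_eq_true, decide_eq_true_iff, and_assoc] at distribution
    exact distribution.1
  obtain ⟨M, hM⟩ := Nat.exists_eq_add_of_le' length_a
  obtain ⟨a, rfl⟩ := exists_eq_ofFn hM
  obtain ⟨n, hn⟩ : ∃ n, c.length = n := ⟨_, rfl⟩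
  obtain ⟨p, rfl⟩ := exists_eq_ofFn_ofFn (length_p.trans hn) fun r hr =>
    (length_rows r hr).trans hM
  obtain ⟨c, rfl⟩ := exists_eq_ofFn hn
  simp only [all_ofFn_iff, List.length_ofFn, isDistribution_ofFn_iff, forall_and,
    decide_eq_true_iff] at distributions c_pos
  obtain ⟨a_pos, a_zero, a_last, a_strictMono⟩ := isGrid_ofFn_iff.1 grid
  obtain ⟨p_pos, p_sum⟩ := distributions
  refine ⟨⟨_, M, fun j => .ofNatPair (a j) (a_pos j), fun i j => .ofNatPair (p i j) (p_pos i j),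
    fun i => .ofNatPair (c i) (c_pos i), ?_, ?_, ?_, ?_, ?_, ?_⟩, rfl, rfl, rfl⟩ <;>
    simp only [Fraction.val_ofNatPair]
  · exact a_zero
  · exact a_last
  · exact a_strictMono
  · exact fun i j => ⟨fracVal_nonneg _, (Finset.single_le_sum (fun j _ => fracVal_nonneg (p i j))
      (Finset.mem_univ j)).trans_eq (p_sum i)⟩
  · exact p_sum
  · exact fun i => fracVal_nonneg _

theorem isCheapCover_iff (I : DiscreteInstance) {k : ℕ} {γ : ℕ × ℕ} (hγ : 0 < γ.2)
    {b : Fin k → Fin I.n → ℕ × ℕ} :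
    isCheapCover k I.points I.probs I.costs γ (List.ofFn fun l => List.ofFn (b l)) = true ↔
      (∀ l i, 0 < (b l i).2 ∧ fracVal (b l i) ≤ 1) ∧ (I.n ≠ 0 ∨ k = 1) ∧
      IsParetoCover I.measure (Set.range fun l i => fracVal (b l i)) ∧
      expectedCost I.measure I.cost (Set.range fun l i => fracVal (b l i)) ≤
        ENNReal.ofReal (fracVal γ) := by
  have length_costs : I.costs.length = I.n := List.length_ofFn
  simp only [isCheapCover, I.isDiscreteInstance_data, hγ, length_costs, Bool.and_eq_true,
    all_ofFn_iff, isCubePoint_ofFn_iff, decide_eq_true_iff, and_assoc, List.length_ofFn, true_and,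
    Bool.or_eq_true, Bool.not_eq_true', decide_eq_false_iff_not]
  refine and_congr_right fun hb => and_congr_right fun _ => ?_
  have a_pos (j) : 0 < (I.a j).natPair.2 := (I.a j).den_pos
  have p_pos (i j) : 0 < (I.p i j).natPair.2 := (I.p i j).den_pos
  have c_pos (i) : 0 < (I.c i).natPair.2 := (I.c i).den_pos
  have b_pos (l i) : 0 < (b l i).2 := (hb l i).1
  rw [I.measure_eq, I.cost_eq,
    isParetoCover_iff_uncoveredWeight_eq_zero a_pos p_pos I.sum_fracVal_p b_pos]
  refine and_congr_right fun covered => ?_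
  rw [expectedCost_eq_fracVal_expectedCostFrac a_pos p_pos I.sum_fracVal_p c_pos b_pos
      ((isParetoCover_iff_uncoveredWeight_eq_zero a_pos p_pos I.sum_fracVal_p b_pos).2 covered),
    ENNReal.ofReal_le_ofReal_iff (fracVal_nonneg _),
    ← fracLE_iff (expectedCostFrac_snd_pos p_pos I.sum_fracVal_p c_pos b_pos) hγ]
  rfl

instance (I : DiscreteInstance) : IsProbabilityMeasure I.measure :=
  isProbabilityMeasure_discreteMeasure _ (fun i j => (I.p_mem i j).1) I.p_sum

theorem exists_isCheapCover (I : DiscreteInstance) {k : ℕ} (hk : 1 ≤ k) {γ : Fraction}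
    (h : HasCheapCover k I.measure I.cost γ.val) :
    ∃ g : Fin k → Fin I.n → Fin (I.M + 2), isCheapCover k I.points I.probs I.costs γ.natPair
      (List.ofFn fun l => List.ofFn fun i => (I.a (g l i)).natPair) = true := by
  obtain ⟨g, cover, cost_le⟩ := HasCheapCover.exists_grid I.a_zero I.c_nonneg h
  refine ⟨g, (I.isCheapCover_iff γ.den_pos).2 ?_⟩
  simp only [Fraction.fracVal_natPair h.nonneg, Fraction.fracVal_natPair (I.a_nonneg _)]
  refine ⟨fun l i => ⟨(I.a (g l i)).den_pos, ?_⟩, h.ne_zero_or_eq_one hk, cover, cost_le⟩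
  exact (I.a_strictMono.monotone (Fin.le_last _)).trans_eq I.a_last

end DiscreteInstance

theorem exists_hasCheapCover_of_isCheapCover {k : ℕ} (hk : 1 ≤ k) {a c : List (ℕ × ℕ)}
    {p b : List (List (ℕ × ℕ))} {γ : ℕ × ℕ} (h : isCheapCover k a p c γ b = true) :
    ∃ (I : DiscreteInstance) (δ : Fraction), I.points = a ∧ I.probs = p ∧ I.costs = c ∧
      δ.natPair = γ ∧ 0 ≤ δ.val ∧ HasCheapCover k I.measure I.cost δ.val := by
  have accepted := h
  simp only [isCheapCover, Bool.and_eq_true, decide_eq_true_iff, and_assoc] at h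
  obtain ⟨instance_data, γ_pos, length_b, cube_points, -⟩ := h
  obtain ⟨I, rfl, rfl, rfl⟩ := DiscreteInstance.exists_of_isDiscreteInstance instance_data
  have length_rows : ∀ r ∈ b, r.length = I.n := fun r hr => by
    have cube_point := List.all_eq_true.1 cube_points r hr
    simp only [isCubePoint, Bool.and_eq_true, decide_eq_true_iff] at cube_point
    exact cube_point.1.trans List.length_ofFn
  obtain ⟨b, rfl⟩ := exists_eq_ofFn_ofFn length_b length_rows
  obtain ⟨hb, hn, cover, cost_le⟩ := (I.isCheapCover_iff γ_pos).1 accepted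
  refine ⟨I, .ofNatPair γ γ_pos, rfl, rfl, rfl, rfl, ?_, ?_⟩ <;> rw [Fraction.val_ofNatPair]
  · exact fracVal_nonneg γ
  · exact hasCheapCover_of_range (fracVal_nonneg γ) hk hn
      (fun l => ⟨fun i => fracVal_nonneg _, fun i => (hb l i).2⟩) cover cost_le

end ParetoCover

/-! ### Membership in NP -/

namespace ParetoCover

/-- The bound in a certificate, which consists of the code of a cover instance and the code of a
list with a single entry, the bound. -/
def readBound (v : List Γ') : ℕ × ℕ := (readFracs ((parse v).getD 4 .leaf)).headD (0, 1)

@[fun_prop]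
theorem stackPolyTime_readBound : StackPolyTime readBound :=
  (stackPolyTime_readFracs.comp (stackPolyTime_getD_parse 4)).headD (.const (0, 1))

/-- A certificate for the claim that the rows of `b` form a cover with expected cost at most `γ` of
the instance `(a, p, c)`. -/
def encCertificate (a : List (ℕ × ℕ)) (p : List (List (ℕ × ℕ))) (c : List (ℕ × ℕ)) (γ : ℕ × ℕ)
    (b : List (List (ℕ × ℕ))) : List Γ' :=
  encFracs a ++ encMatrix p ++ encFracs c ++ encMatrix b ++ encFracs [γ]

theorem parse_encCertificate (a : List (ℕ × ℕ)) (p : List (List (ℕ × ℕ))) (c : List (ℕ × ℕ))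
    (γ : ℕ × ℕ) (b : List (List (ℕ × ℕ))) : parse (encCertificate a p c γ b) =
      [fracsItem a, matrixItem p, fracsItem c, matrixItem b, fracsItem [γ]] :=
  ((isCodeOf_cover_data a p c b).append (isCodeOf_encFracs [γ])).parse_eq

theorem length_encMatrix_grid_le {N k n : ℕ} (a : Fin N → ℕ × ℕ) (g : Fin k → Fin n → Fin N) :
    (encMatrix (List.ofFn fun l => List.ofFn fun i => a (g l i))).length ≤
      k * (n * (encFracs (List.ofFn a)).length + 2) + 2 := by
  have row_le (l : Fin k) : (encFracs (List.ofFn fun i => a (g l i))).length ≤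
      n * (encFracs (List.ofFn a)).length + 2 := by
    simpa using length_encList_le (e := encFrac) (l := List.ofFn fun i => a (g l i))
      (forall_mem_ofFn_iff.2 fun i => length_le_length_encList (List.mem_ofFn.2 ⟨g l i, rfl⟩))
  simpa using length_encList_le (e := encFracs)
    (l := List.ofFn fun l => List.ofFn fun i => a (g l i))
    (forall_mem_ofFn_iff.2 row_le)

theorem length_encCertificate_grid_le (I : DiscreteInstance) {γ : Fraction} (hγ : 0 ≤ γ.val)
    {k : ℕ} (g : Fin k → Fin I.n → Fin (I.M + 2)) {N : ℕ}
    (hN : (encDiscrete I ++ encFraction γ).length ≤ N) :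
    (encCertificate I.points I.probs I.costs γ.natPair
      (List.ofFn fun l => List.ofFn fun i => (I.a (g l i)).natPair)).length ≤
      N + (k * (N * N + 2) + 4) := by
  have cover_le := length_encMatrix_grid_le (fun j => (I.a j).natPair) g
  have n_le : I.n ≤ (encFracs I.costs).length := by
    simpa [DiscreteInstance.costs] using
      list_length_le_length_encList (l := I.costs) length_encFrac_pos
  rw [I.encDiscrete_eq, Fraction.encFraction_eq hγ] at hN
  simp only [List.length_append] at hN
  have cover_le_N : k * (I.n * (encFracs I.points).length + 2) ≤ k * (N * N + 2) :=
    Nat.mul_le_mul_left k (Nat.add_le_add_right (Nat.mul_le_mul (by omega) (by omega)) 2)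
  have bound_eq : (encFracs [γ.natPair]).length = (encFrac γ.natPair).length + 2 := by
    simp [length_encList]
  change _ ≤ k * (I.n * (encFracs I.points).length + 2) + 2 at cover_le
  simp only [encCertificate, List.length_append, bound_eq]
  omega

/-- A certificate consists of the data `(a, p, c)` of an instance, grid points `b` and the bound
`γ`, so that the verifier can compute the given word as `W a p c γ`. -/
theorem inNP_of_instance_word {L : Language Γ'} {k : ℕ} (hk : 1 ≤ k) {T : List (ℕ × ℕ) → Bool}
    (hT : StackPolyTime T)
    {W : List (ℕ × ℕ) → List (List (ℕ × ℕ)) → List (ℕ × ℕ) → ℕ × ℕ → List Γ'}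
    (hW : StackPolyTime fun v => W (readPoints v) (readProbs v) (readCosts v) (readBound v))
    (h_sound : ∀ (I : DiscreteInstance) (γ : Fraction), T I.points = true → 0 ≤ γ.val →
      HasCheapCover k I.measure I.cost γ.val → W I.points I.probs I.costs γ.natPair ∈ L)
    (N : Polynomial ℕ)
    (h_complete : ∀ w ∈ L, ∃ (I : DiscreteInstance) (γ : Fraction), T I.points = true ∧
      HasCheapCover k I.measure I.cost γ.val ∧ W I.points I.probs I.costs γ.natPair = w ∧
      (encDiscrete I ++ encFraction γ).length ≤ N.eval w.length) : InNP L := by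
  refine inNP_of_stackPolyTime_verifier (V := fun x =>
    decide (W (readPoints x.2) (readProbs x.2) (readCosts x.2) (readBound x.2) = x.1) &&
    T (readPoints x.2) && isCheapCover k (readPoints x.2) (readProbs x.2) (readCosts x.2)
      (readBound x.2) (readCover x.2)) ?_ (fun w v accepted => ?_)
    (N + (Polynomial.C k * (N * N + 2) + 4)) fun w hw => ?_
  · exact .and (.and ((hW.comp .snd).wordEq .fst) (hT.comp (by fun_prop))) (by fun_prop)
  · simp only [Bool.and_eq_true, decide_eq_true_iff] at accepted
    obtain ⟨⟨word_eq, test⟩, cheap⟩ := accepted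
    obtain ⟨I, γ, points_eq, probs_eq, costs_eq, bound_eq, nonneg, has_cover⟩ :=
      exists_hasCheapCover_of_isCheapCover hk cheap
    rw [← points_eq, ← probs_eq, ← costs_eq, ← bound_eq] at word_eq
    exact word_eq ▸ h_sound I γ (points_eq ▸ test) nonneg has_cover
  · obtain ⟨I, γ, test, has_cover, word_eq, length_le⟩ := h_complete w hw
    obtain ⟨g, cheap⟩ := I.exists_isCheapCover hk has_cover
    refine
      ⟨_, (length_encCertificate_grid_le I has_cover.nonneg g length_le).trans_eq (by simp), ?_⟩
    simp [readPoints, readProbs, readCosts, readBound, readCover, parse_encCertificate, test,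
      word_eq, cheap]

theorem inNP_discreteParetoCoverProblem {k : ℕ} (hk : 1 ≤ k) :
    InNP (discreteParetoCoverProblem k) := by
  have word_eq (I : DiscreteInstance) {γ : Fraction} (hγ : 0 ≤ γ.val) :
      encFracs I.points ++ encMatrix I.probs ++ encFracs I.costs ++ encFrac γ.natPair =
        encDiscrete I ++ encFraction γ := by
    rw [I.encDiscrete_eq, Fraction.encFraction_eq hγ]
  refine inNP_of_instance_word hk (.const true)
    (W := fun a p c γ => encFracs a ++ encMatrix p ++ encFracs c ++ encFrac γ) (by fun_prop)
    (fun I γ _ nonneg has_cover => ⟨I, γ, word_eq I nonneg, has_cover⟩) .X ?_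
  rintro w ⟨I, γ, rfl, has_cover⟩
  exact ⟨I, γ, rfl, has_cover, word_eq I has_cover.nonneg, by simp⟩

/-- The fraction `1 - q`. -/
def Fraction.oneSub (q : Fraction) : Fraction := ⟨q.den - q.num, q.den, q.den_pos⟩

theorem Fraction.val_oneSub (q : Fraction) : q.oneSub.val = 1 - q.val := by
  have den_ne_zero : (q.den : ℝ) ≠ 0 := by exact_mod_cast q.den_pos.ne'
  simp only [oneSub, val, Int.cast_sub, Int.cast_natCast, sub_div, div_self den_ne_zero]

theorem Fraction.num_natAbs_oneSub_le {q : Fraction} (h : q.val ∈ Set.Icc (0 : ℝ) 1) :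
    q.oneSub.num.natAbs ≤ q.den := by
  have num_nonneg := Fraction.num_nonneg h.1
  have oneSub_nonneg := Fraction.num_nonneg (q := q.oneSub)
    (by rw [Fraction.val_oneSub]; exact sub_nonneg.2 h.2)
  change (0 : ℤ) ≤ q.den - q.num at oneSub_nonneg
  change ((q.den : ℤ) - q.num).natAbs ≤ q.den
  omega

theorem length_encNat (m : ℕ) : (encNat m).length = m.size + 1 := by
  simp [encNat, encodeNat_eq_bits, Nat.size_eq_bits_len]

theorem length_encFracs_oneSub_le {q : Fraction} (h : q.val ∈ Set.Icc (0 : ℝ) 1) :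
    (encFracs [q.oneSub.natPair, q.natPair]).length ≤ 3 * (encFrac q.natPair).length := by
  have size_le : q.oneSub.num.natAbs.size ≤ q.den.size :=
    Nat.size_le_size (Fraction.num_natAbs_oneSub_le h)
  have den_eq : q.oneSub.den = q.den := rfl
  simp [length_encList, encFrac, length_encNat, Fraction.natPair, den_eq]
  omega

theorem discreteMeasure_eq_binaryMeasure {n : ℕ} {a : Fin 2 → ℝ} {p : Fin n → Fin 2 → ℝ}
    (h_zero : a 0 = 0) (h_one : a 1 = 1) (hp : ∀ i, p i 0 + p i 1 = 1) :
    discreteMeasure (M := 0) a p = binaryMeasure fun i => p i 1 := by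
  refine (Fintype.sum_equiv (Equiv.arrowCongr (Equiv.refl _) finTwoEquiv.symm) _ _ fun x => ?_).symm
  have prob_eq (i : Fin n) : p i (finTwoEquiv.symm (x i)) = if x i then p i 1 else 1 - p i 1 := by
    cases x i
    · exact eq_sub_of_add_eq (hp i)
    · rfl
  have point_eq (i : Fin n) : a (finTwoEquiv.symm (x i)) = if x i then 1 else 0 := by
    cases x i
    · exact h_zero
    · exact h_one
  simp [prob_eq, point_eq]

/-- The binary instance whose probabilities are those of the second grid point `a 1`. -/
def DiscreteInstance.toBinaryInstance (I : DiscreteInstance) : BinaryInstance where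
  n := I.n
  p i := I.p i 1
  c := I.c
  p_mem i := I.p_mem i 1
  c_nonneg := I.c_nonneg

theorem DiscreteInstance.measure_toBinaryInstance {I : DiscreteInstance} (h : I.M = 0) :
    I.toBinaryInstance.measure = I.measure := by
  obtain ⟨n, M, a, p, c, a_zero, a_last, a_strictMono, p_mem, p_sum, c_nonneg⟩ := I
  obtain rfl : M = 0 := h
  exact (discreteMeasure_eq_binaryMeasure a_zero a_last
    fun i => (Fin.sum_univ_two _).symm.trans (p_sum i)).symm

/-- A binary instance as a discrete instance, with no grid points between zero and one. -/
def BinaryInstance.toDiscreteInstance (I : BinaryInstance) : DiscreteInstance where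
  n := I.n
  M := 0
  a := ![⟨0, 1, one_pos⟩, ⟨1, 1, one_pos⟩]
  p i := ![(I.p i).oneSub, I.p i]
  c := I.c
  a_zero := by simp [Fraction.val]
  a_last := by simp [Fraction.val]
  a_strictMono := Fin.strictMono_iff_lt_succ.2 fun j => by
    obtain rfl := Subsingleton.elim j 0
    simp [Fraction.val]
  p_mem i := Fin.forall_fin_two.2
    ⟨by simpa [Fraction.val_oneSub, and_comm] using I.p_mem i, I.p_mem i⟩
  p_sum i := by simp [Fraction.val_oneSub]
  c_nonneg := I.c_nonneg

theorem BinaryInstance.encBinary_eq (I : BinaryInstance) : encBinary I =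
    encFracs (List.ofFn fun i => (I.p i).natPair) ++
      encFracs (List.ofFn fun i => (I.c i).natPair) := by
  rw [encBinary, encFamily_encFraction fun i => (I.p_mem i).1, encFamily_encFraction I.c_nonneg]

theorem length_encList_ofFn {τ : Type} (e : τ → List Γ') {n : ℕ} (v : Fin n → τ) :
    (encList e (List.ofFn v)).length = ∑ i, (e (v i)).length + 2 := by
  rw [length_encList, List.map_ofFn, List.sum_ofFn]
  rfl

theorem BinaryInstance.length_encDiscrete_toDiscreteInstance_le (I : BinaryInstance) :
    (encDiscrete I.toDiscreteInstance).length ≤ 3 * (encBinary I).length + 11 := by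
  have length_points : (encFracs I.toDiscreteInstance.points).length = 11 := by
    simp [DiscreteInstance.points, BinaryInstance.toDiscreteInstance, Fraction.natPair,
      length_encList, encFrac, length_encNat]
  have length_probs : (encMatrix I.toDiscreteInstance.probs).length ≤
      3 * (encFracs (List.ofFn fun i => (I.p i).natPair)).length := by
    have sum_le := Finset.sum_le_sum fun i (_ : i ∈ Finset.univ) =>
      length_encFracs_oneSub_le (I.p_mem i)
    rw [← Finset.mul_sum] at sum_le
    have length_eq : (encMatrix I.toDiscreteInstance.probs).length =
        ∑ i, (encFracs [(I.p i).oneSub.natPair, (I.p i).natPair]).length + 2 :=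
      length_encList_ofFn encFracs _
    rw [length_eq, length_encList_ofFn]
    omega
  rw [DiscreteInstance.encDiscrete_eq, I.encBinary_eq]
  simp only [List.length_append]
  have length_costs : I.toDiscreteInstance.costs = List.ofFn fun i => (I.c i).natPair := rfl
  rw [length_costs]
  omega

/-- The code of the binary instance whose probabilities are the second entries of the rows of `p`,
followed by the code of the bound. -/
def binaryWord (p : List (List (ℕ × ℕ))) (c : List (ℕ × ℕ)) (γ : ℕ × ℕ) : List Γ' :=
  encFracs (p.map fun r => r.tail.headD (0, 1)) ++ encFracs c ++ encFrac γ

theorem binaryWord_eq (I : DiscreteInstance) {γ : Fraction} (hγ : 0 ≤ γ.val) :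
    binaryWord I.probs I.costs γ.natPair = encBinary I.toBinaryInstance ++ encFraction γ := by
  have second_entry (i : Fin I.n) :
      (List.ofFn fun j => (I.p i j).natPair).tail.headD (0, 1) = (I.p i 1).natPair := by
    simp [List.ofFn_succ]
  rw [binaryWord, DiscreteInstance.probs, List.map_ofFn,
    BinaryInstance.encBinary_eq, Fraction.encFraction_eq hγ]
  simp only [Function.comp_def, second_entry]
  rfl

theorem inNP_binaryParetoCoverProblem {k : ℕ} (hk : 1 ≤ k) :
    InNP (binaryParetoCoverProblem k) := by
  refine inNP_of_instance_word hk (T := fun a => decide (a.length = 2)) (by fun_prop)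
    (W := fun _ p c γ => binaryWord p c γ) (by unfold binaryWord; fun_prop)
    (fun I γ length_points nonneg has_cover => ?_) (3 * .X + 11) ?_
  · have M_eq_zero : I.M = 0 := by simpa [DiscreteInstance.points] using length_points
    rw [← DiscreteInstance.measure_toBinaryInstance M_eq_zero] at has_cover
    exact ⟨I.toBinaryInstance, γ, binaryWord_eq I nonneg, has_cover⟩
  · rintro w ⟨I, γ, rfl, has_cover⟩
    have length_points : I.toDiscreteInstance.points.length = 2 := List.length_ofFn
    refine ⟨I.toDiscreteInstance, γ, decide_eq_true length_points, ?_,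
      binaryWord_eq _ has_cover.nonneg, ?_⟩
    · rwa [← DiscreteInstance.measure_toBinaryInstance rfl]
    · have length_le := I.length_encDiscrete_toDiscreteInstance_le
      simp only [List.length_append, Polynomial.eval_add, Polynomial.eval_mul,
        Polynomial.eval_X, Polynomial.eval_ofNat]
      omega

end ParetoCover

theorem mainTheorem6 (k : ℕ) (hk : 1 ≤ k) :
    (∃ f : ParetoCover.CoverInstance k → ParetoCover.Fraction,
      ParetoCover.PolyTime ParetoCover.encCover ParetoCover.encFraction f ∧
      ∀ I : ParetoCover.CoverInstance k,
        ((ParetoCover.expectedCost I.measure I.cost I.cover : ENNReal) : EReal) =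
          ((f I).val : EReal)) ∧
    ParetoCover.InNP (ParetoCover.discreteParetoCoverProblem k) ∧
    ParetoCover.InNP (ParetoCover.binaryParetoCoverProblem k) :=
  ⟨ParetoCover.exists_polyTime_expectedCost k, ParetoCover.inNP_discreteParetoCoverProblem hk,
    ParetoCover.inNP_binaryParetoCoverProblem hk⟩
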